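/- **Setting and notation.** Let $\mathcal G$ be a Hausdorff locally compact étale groupoid with unit space $\mathcal G^{(0)}$, range map $r$ and source map $s$; put $\mathcal G_y=s^{-1}(y)$, $\mathcal G^y=r^{-1}(y)$, and let $\mathcal G^y_y=\mathcal G_y\cap\mathcal G^y$ be the isotropy group at $y$. $C^*(\mathcal G)$ is the completion of the convolution $*$-algebra $C_c(\mathcal G)$ in the norm $\|f\|=\sup_\sigma\|\sigma(f)\|$ over all representations of $C_c(\mathcal G)$ by bounded operators on Hilbert spaces; for a discrete group $\Gamma$ this gives the full group $C^*$-algebra $C^*(\Gamma)$. Ideals of $C^*$-algebras are closed and two-sided; maximal ideals are proper, and the empty intersection of ideals is the whole algebra. A unitary representation $\pi$ of a group $\Gamma$ is also regarded as a representation of $C^*(\Gamma)$; $\ker\pi\subset C^*(\Gamma)$ is its kernel and $C^*_\pi(\Gamma)=C^*(\Gamma)/\ker\pi$. States on $C^*_\pi(\Gamma)$ are identified with the states on $C^*(\Gamma)$ vanishing on $\ker\pi$, and $\omega(g)$ is the value of a state at the unitary of $C^*(\Gamma)$ given by $g\in\Gamma$. For a state $\omega$, $\pi_\omega$ is its GNS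 representation. For representations $\sigma,\tau$ of the same $C^*$-algebra, $\sigma\prec\tau$ (weak containment) means $\ker\tau\subset\ker\sigma$. For a subgroup $S\subset\mathcal G^x_x$ and a unitary representation $\pi$ of $S$ on $H$, $\operatorname{Ind}^{\mathcal G}_S\pi$ is the representation of $C^*(\mathcal G)$ on the Hilbert space of functions $\xi:\mathcal G_x\to H$ with $\xi(gs)=\pi(s)^*\xi(g)$ for $s\in S$ and $\sum_{g\in\mathcal G_x/S}\|\xi(g)\|^2<\infty$, given for $f\in C_c(\mathcal G)$ by $(f\xi)(g)=\sum_{h\in\mathcal G^{r(g)}}f(h)\xi(h^{-1}g)$. For subgroups $S$ of a discrete group $\Gamma$ this defines $\operatorname{Ind}^\Gamma_S\pi$. For $g\in\mathcal G_y$ and a unitary representation $\pi$ of $\mathcal G^y_y$, $\pi^g$ is the representation $h\mapsto\pi(g^{-1}hg)$ of $\mathcal G^{r(g)}_{r(g)}$. $\operatorname{Sub}(\mathcal G)$ is the set of subgroups of all the isotropy groups, with the Fell topology: the basic open sets are $\{T: T\cap K=\emptyset,\ T\cap U_j\neq\emptyset\ (j=1,\dots,n)\}$ with $K\subset\mathcal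 G$ compact and $U_1,\dots,U_n\subset\mathcal G$ open, $n\ge 0$. A bisection is a subset of $\mathcal G$ on which $r$ and $s$ are injective. **Theorem.** Let $x\in\mathcal G^{(0)}$ be a unit such that the (discrete) group $\mathcal G^x_x$ is amenable, and for every $g\in\mathcal G^x_x$ fix an open bisection $W_g$ containing $g$. Let $\pi$ be a unitary representation of $\mathcal G^x_x$, let $Y\subset\mathcal G^{(0)}$ be a subset and, for every $y\in Y$, let $\pi_y$ be a unitary representation of $\mathcal G^y_y$. Let $(\Gamma_k)_{k\in K}$ be a collection of subgroups of $\mathcal G^x_x$ such that every finite subset of $\mathcal G^x_x$ is contained in some $\Gamma_k$ and such that, for every $k\in K$, the ideal $\ker(\pi|_{\Gamma_k})\subset C^*(\Gamma_k)$ is an intersection of maximal ideals. Call a pair $(S,\omega)$, where $S\subset\mathcal G^x_x$ is a subgroup and $\omega$ is a state on $C^*(S)$, a *state limit* if there are a net $(y_i)_{i\in I}$ in $Y$, elements $g_i\in\mathcal G_{y_i}$ and states $\omega_i$ on $C^*_{\pi_{y_i}^{g_i}}(\mathcal G^{r(g_i)}_{r(g_i)})$ such that $r(g_i)\to x$, $\mathcal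 G^{r(g_i)}_{r(g_i)}\to S$ in $\operatorname{Sub}(\mathcal G)$ and, for every $g\in S$, $\omega_i(h_{g,i})\to\omega(g)$, where $h_{g,i}$ is the unique element of $W_g\cap\mathcal G^{r(g_i)}_{r(g_i)}$ (which exists for all $i$ large enough). Then the following conditions are equivalent: 1. $\operatorname{Ind}^{\mathcal G}_{\mathcal G^x_x}\pi\prec\bigoplus_{y\in Y}\operatorname{Ind}^{\mathcal G}_{\mathcal G^y_y}\pi_y$; 2. for every $k\in K$ and every irreducible unitary representation $\rho$ of $\Gamma_k$ such that $\rho\prec\pi|_{\Gamma_k}$ and $\ker\rho\subset C^*(\Gamma_k)$ is a maximal ideal, there exist a state $\varphi$ on $C^*_\rho(\Gamma_k)$, a net $(y_i)_{i\in I}$ in $Y$, elements $g_i\in\mathcal G_{y_i}$ and states $\nu_i$ on $C^*_{\pi_{y_i}^{g_i}}(\mathcal G^{r(g_i)}_{r(g_i)})$ such that $r(g_i)\to x$ and, for every $\varepsilon>0$ and $g\in\Gamma_k$, there is an index $i_0$ such that for all $i\ge i_0$ either $W_g\cap\mathcal G^{r(g_i)}_{r(g_i)}=\emptyset$, or $W_g\cap\mathcal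 G^{r(g_i)}_{r(g_i)}=\{h\}$ for some $h$ and $|\varphi(g)-\nu_i(h)|<\varepsilon$; 3. $\pi\prec\bigoplus_{(S,\omega)}\operatorname{Ind}^{\mathcal G^x_x}_S\pi_\omega$, where the sum is over all state limits $(S,\omega)$. If, in addition, the ideal $\ker\pi\subset C^*(\mathcal G^x_x)$ is maximal, then (1)–(3) are also equivalent to 4. there are a subgroup $S\subset\mathcal G^x_x$ and a state $\omega$ on $C^*_{\pi|_S}(S)$ such that $(S,\omega)$ is a state limit. -/

import Mathlib

open CategoryTheory Filter Topology
open scoped ComplexOrder CompactlySupported InnerProductSpace ENNReal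

universe u v w

noncomputable section

set_option linter.unusedSectionVars false

/-! ### Completion of a star-algebra with a `C*`-seminorm -/

/-- A complex star-algebra with a submultiplicative `C*`-seminorm. -/
class PreCStarAlg (A : Type u) extends NonUnitalSeminormedRing A, StarRing A, NormedSpace ℂ A,
    IsScalarTower ℂ A A, SMulCommClass ℂ A A, StarModule ℂ A where
  norm_star' : ∀ a : A, ‖star a‖ = ‖a‖
  norm_star_mul_self' : ∀ a : A, ‖star a * a‖ = ‖a‖ * ‖a‖

namespace PreCStarAlg

open UniformSpace UniformSpace.Completion

variable (A : Type u) [PreCStarAlg A]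

/-- The Hausdorff completion of a star-algebra with a `C*`-seminorm. -/
abbrev Compl : Type u := Completion A

variable {A}

/-- The canonical map into the completion. -/
def toCompl (a : A) : Compl A := (a : Completion A)

lemma toCompl_add (a b : A) : toCompl (a + b) = toCompl a + toCompl b := coe_add a b
lemma toCompl_zero : toCompl (0 : A) = 0 := coe_zero
lemma toCompl_smul (c : ℂ) (a : A) : toCompl (c • a) = c • toCompl a := coe_smul c a
lemma norm_toCompl (a : A) : ‖toCompl a‖ = ‖a‖ := norm_coe a
lemma continuous_toCompl : Continuous (toCompl : A → Compl A) := continuous_coe A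
lemma denseRange_toCompl : DenseRange (toCompl : A → Compl A) := denseRange_coe
lemma isDenseInducing_toCompl : IsDenseInducing (toCompl : A → Compl A) := isDenseInducing_coe

lemma compl_induction {p : Compl A → Prop} (a : Compl A) (hp : IsClosed {a | p a})
    (ih : ∀ a : A, p (toCompl a)) : p a := Completion.induction_on a hp ih

lemma compl_induction₂ {p : Compl A → Compl A → Prop} (a b : Compl A)
    (hp : IsClosed {x : Compl A × Compl A | p x.1 x.2})
    (ih : ∀ a b : A, p (toCompl a) (toCompl b)) : p a b := Completion.induction_on₂ a b hp ih

lemma compl_induction₃ {p : Compl A → Compl A → Compl A → Prop} (a b c : Compl A)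
    (hp : IsClosed {x : Compl A × Compl A × Compl A | p x.1 x.2.1 x.2.2})
    (ih : ∀ a b c : A, p (toCompl a) (toCompl b) (toCompl c)) : p a b c :=
  Completion.induction_on₃ a b c hp ih

instance : Mul (Compl A) :=
  ⟨fun a b => (isDenseInducing_toCompl.prodMap isDenseInducing_toCompl).extend
    (fun p : A × A => toCompl (p.1 * p.2)) (a, b)⟩

lemma toCompl_mul (a b : A) : toCompl (a * b) = toCompl a * toCompl b :=
  ((isDenseInducing_toCompl.prodMap isDenseInducing_toCompl).extend_eq
    (f := fun p : A × A => toCompl (p.1 * p.2))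
    (continuous_toCompl.comp continuous_mul) (a, b)).symm

instance : ContinuousMul (Compl A) where
  continuous_mul := by
    let c : A →+ Compl A := ⟨⟨toCompl, toCompl_zero⟩, toCompl_add⟩
    let m : A →+ A →+ Compl A := (AddMonoidHom.mul : A →+ A →+ A).compr₂ c
    have : Continuous fun p : A × A => m p.1 p.2 := continuous_toCompl.comp continuous_mul
    have di : IsDenseInducing (c : A → Compl A) := isDenseInducing_toCompl
    exact (di.extend_Z_bilin di this :)

instance : NonUnitalRing (Compl A) :=
  { (inferInstance : AddCommGroup (Compl A)), (inferInstance : Mul (Compl A)) with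
    zero_mul a := by
      refine compl_induction (p := fun a => 0 * a = 0) a
        (isClosed_eq (by fun_prop) continuous_const) fun a => ?_
      rw [← toCompl_zero, ← toCompl_mul, zero_mul]
    mul_zero a := by
      refine compl_induction (p := fun a => a * 0 = 0) a
        (isClosed_eq (by fun_prop) continuous_const) fun a => ?_
      rw [← toCompl_zero, ← toCompl_mul, mul_zero]
    mul_assoc a b c := by
      refine compl_induction₃ (p := fun a b c => a * b * c = a * (b * c)) a b c
        (isClosed_eq (by fun_prop) (by fun_prop)) fun a b c => ?_
      simp only [← toCompl_mul, mul_assoc]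
    left_distrib a b c := by
      refine compl_induction₃ (p := fun a b c => a * (b + c) = a * b + a * c) a b c
        (isClosed_eq (by fun_prop) (by fun_prop)) fun a b c => ?_
      simp only [← toCompl_mul, ← toCompl_add, mul_add]
    right_distrib a b c := by
      refine compl_induction₃ (p := fun a b c => (a + b) * c = a * c + b * c) a b c
        (isClosed_eq (by fun_prop) (by fun_prop)) fun a b c => ?_
      simp only [← toCompl_mul, ← toCompl_add, add_mul] }

instance : NonUnitalNormedRing (Compl A) :=
  { (inferInstance : NormedAddCommGroup (Compl A)),
    (inferInstance : NonUnitalRing (Compl A)) with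
    norm_mul_le a b := by
      refine compl_induction₂ (p := fun a b => ‖a * b‖ ≤ ‖a‖ * ‖b‖) a b
        (isClosed_le (by fun_prop) (by fun_prop)) fun a b => ?_
      simpa only [← toCompl_mul, norm_toCompl] using norm_mul_le a b }

lemma isometry_star : Isometry (star : A → A) :=
  AddMonoidHomClass.isometry_of_norm (starAddEquiv : A ≃+ A) norm_star'

instance : Star (Compl A) := ⟨Completion.map (star : A → A)⟩

lemma toCompl_star (a : A) : toCompl (star a) = star (toCompl a) :=
  (Completion.map_coe isometry_star.uniformContinuous a).symm

instance : ContinuousStar (Compl A) := ⟨Completion.continuous_map⟩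

instance : StarRing (Compl A) where
  star_involutive a := by
    refine compl_induction (p := fun a => star (star a) = a) a
      (isClosed_eq (by fun_prop) continuous_id) fun a => ?_
    simp only [← toCompl_star, star_star]
  star_mul a b := by
    refine compl_induction₂ (p := fun a b => star (a * b) = star b * star a) a b
      (isClosed_eq (by fun_prop) (by fun_prop)) fun a b => ?_
    simp only [← toCompl_mul, ← toCompl_star, star_mul]
  star_add a b := by
    refine compl_induction₂ (p := fun a b => star (a + b) = star a + star b) a b
      (isClosed_eq (by fun_prop) (by fun_prop)) fun a b => ?_
    simp only [← toCompl_add, ← toCompl_star, star_add]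

lemma continuous_smulC (c : ℂ) : Continuous fun a : Compl A => c • a :=
  uniformContinuous_const_smul c |>.continuous

lemma compl_smul_mul (c : ℂ) (a b : Compl A) : (c • a) * b = c • (a * b) := by
  refine compl_induction₂ (p := fun a b => (c • a) * b = c • (a * b)) a b
    (isClosed_eq (((continuous_smulC c).comp continuous_fst).mul continuous_snd)
      ((continuous_smulC c).comp continuous_mul)) fun a b => ?_
  simp only [← toCompl_mul, ← toCompl_smul, smul_mul_assoc]

lemma compl_mul_smul (c : ℂ) (a b : Compl A) : a * (c • b) = c • (a * b) := by
  refine compl_induction₂ (p := fun a b => a * (c • b) = c • (a * b)) a b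
    (isClosed_eq (continuous_fst.mul ((continuous_smulC c).comp continuous_snd))
      ((continuous_smulC c).comp continuous_mul)) fun a b => ?_
  simp only [← toCompl_mul, ← toCompl_smul, mul_smul_comm]

lemma compl_star_smul (c : ℂ) (a : Compl A) : star (c • a) = star c • star a := by
  refine compl_induction (p := fun a => star (c • a) = star c • star a) a
    (isClosed_eq (continuous_star.comp (continuous_smulC c))
      ((continuous_smulC (star c)).comp continuous_star)) fun a => ?_
  simp only [← toCompl_smul, ← toCompl_star, star_smul]

lemma compl_norm_mul_self (a : Compl A) : ‖a‖ * ‖a‖ ≤ ‖star a * a‖ := by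
  refine compl_induction (p := fun a => ‖a‖ * ‖a‖ ≤ ‖star a * a‖) a
    (isClosed_le (by fun_prop) (by fun_prop)) fun a => ?_
  simp only [← toCompl_mul, ← toCompl_star, norm_toCompl, norm_star_mul_self', le_refl]

/-- The completion of a star-algebra with a `C*`-seminorm is a `C*`-algebra. -/
instance : NonUnitalCStarAlgebra (Compl A) :=
  { (inferInstance : NonUnitalNormedRing (Compl A)), (inferInstance : StarRing (Compl A)),
    (inferInstance : NormedSpace ℂ (Compl A)),
    (inferInstance : CompleteSpace (Compl A)) with
    norm_mul_self_le := compl_norm_mul_self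
    smul_assoc := compl_smul_mul
    smul_comm := fun c a b => (compl_mul_smul c a b).symm
    star_smul := compl_star_smul }

/-- Extension of a contractive star-homomorphism to the completion. -/
def extend {B : Type v} [NonUnitalCStarAlgebra B] (σ : A →⋆ₙₐ[ℂ] B)
    (hσ : ∀ a, ‖σ a‖ ≤ ‖a‖) : Compl A →⋆ₙₐ[ℂ] B :=
  have hu : UniformContinuous σ :=
    (AddMonoidHomClass.lipschitz_of_bound σ 1 (by simpa using hσ)).uniformContinuous
  have hc : Continuous (Completion.extension σ : Compl A → B) := Completion.continuous_extension
  have he : ∀ a, (Completion.extension σ : Compl A → B) (toCompl a) = σ a :=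
    fun a => Completion.extension_coe hu a
  { toFun := (Completion.extension σ : Compl A → B)
    map_zero' := by rw [← toCompl_zero, he, map_zero]
    map_add' := fun a b => by
      refine compl_induction₂ (p := fun a b => (Completion.extension σ : Compl A → B) (a + b) =
        Completion.extension σ a + Completion.extension σ b) a b (isClosed_eq (hc.comp continuous_add)
          ((hc.comp continuous_fst).add (hc.comp continuous_snd))) fun a b => ?_
      rw [← toCompl_add, he, he, he, map_add]
    map_mul' := fun a b => by
      refine compl_induction₂ (p := fun a b => (Completion.extension σ : Compl A → B) (a * b) =
        Completion.extension σ a * Completion.extension σ b) a b (isClosed_eq (hc.comp continuous_mul)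
          ((hc.comp continuous_fst).mul (hc.comp continuous_snd))) fun a b => ?_
      rw [← toCompl_mul, he, he, he, map_mul]
    map_smul' := fun c a => by
      refine compl_induction (p := fun a => (Completion.extension σ : Compl A → B) (c • a) =
        c • Completion.extension σ a) a
        (isClosed_eq (hc.comp (continuous_smulC c)) (hc.const_smul c)) fun a => ?_
      rw [← toCompl_smul, he, he, map_smul]
    map_star' := fun a => by
      refine compl_induction (p := fun a => (Completion.extension σ : Compl A → B) (star a) =
        star (Completion.extension σ a)) a
        (isClosed_eq (hc.comp continuous_star) (continuous_star.comp hc)) fun a => ?_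
      rw [← toCompl_star, he, he, map_star] }

lemma extend_toCompl {B : Type v} [NonUnitalCStarAlgebra B] (σ : A →⋆ₙₐ[ℂ] B)
    (hσ : ∀ a, ‖σ a‖ ≤ ‖a‖) (a : A) : extend σ hσ (toCompl a) = σ a :=
  Completion.extension_coe
    (AddMonoidHomClass.lipschitz_of_bound σ 1 (by simpa using hσ)).uniformContinuous a

end PreCStarAlg

/-! ### Étale groupoids and their convolution algebras

A groupoid with unit space `X` is a Mathlib `Groupoid X`; an arrow `g : a ⟶ b` has source `a` and
range `b`, so that the product `g h` of the groupoid is the composition `h ≫ g`, and the isotropy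
group at `x` is `End x`. -/

/-- The space of all arrows of a groupoid with unit space `X`. -/
structure Arr (X : Type w) [Groupoid.{v} X] where
  /-- The source of an arrow. -/
  src : X
  /-- The range of an arrow. -/
  rng : X
  /-- The arrow itself. -/
  hom : src ⟶ rng

namespace Arr

variable {X : Type w} [Groupoid.{v} X]

/-- The unit arrow at `x`. -/
def unit (x : X) : Arr X := ⟨x, x, 𝟙 x⟩

/-- The inverse of an arrow. -/
def inv (g : Arr X) : Arr X := ⟨g.rng, g.src, Groupoid.inv g.hom⟩

/-- The product `g h` of two composable arrows. -/
def mul (p : {p : Arr X × Arr X // p.1.src = p.2.rng}) : Arr X :=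
  ⟨p.1.2.src, p.1.1.rng, p.1.2.hom ≫ eqToHom p.2.symm ≫ p.1.1.hom⟩

/-- A bisection: a set of arrows on which both the source and the range map are injective. -/
def IsBisection (W : Set (Arr X)) : Prop := Set.InjOn src W ∧ Set.InjOn rng W

end Arr

/-- An étale topological groupoid: all structure maps are continuous and the source map is a local
homeomorphism. (As the unit map has the source map as a continuous left inverse, the topology of `X`
is the one induced from the space of arrows.) -/
class EtaleGroupoid (X : Type w) [Groupoid.{v} X] [TopologicalSpace X]
    [TopologicalSpace (Arr X)] : Prop where
  continuous_unit : Continuous (Arr.unit : X → Arr X)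
  continuous_inv : Continuous (Arr.inv : Arr X → Arr X)
  continuous_mul : Continuous (Arr.mul : {p : Arr X × Arr X // p.1.src = p.2.rng} → Arr X)
  isLocalHomeomorph_src : IsLocalHomeomorph (Arr.src : Arr X → X)

/-- The arrows with source `x`. -/
abbrev SrcFib {X : Type w} [Groupoid.{v} X] (x : X) := Σ y : X, (x ⟶ y)

/-- The arrows with range `y`. -/
abbrev RngFib {X : Type w} [Groupoid.{v} X] (y : X) := Σ z : X, (z ⟶ y)

/-- An arrow with range `y`, as an arrow. -/
def RngFib.arr {X : Type w} [Groupoid.{v} X] {y : X} (h : RngFib y) : Arr X := ⟨h.1, y, h.2⟩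

/-- An arrow with source `x`, as an arrow. -/
def SrcFib.arr {X : Type w} [Groupoid.{v} X] {x : X} (g : SrcFib x) : Arr X := ⟨x, g.1, g.2⟩

/-- The product `h⁻¹ g` for arrows `g`, `h` with the same range. -/
def ldiv {X : Type w} [Groupoid.{v} X] {x : X} (g : SrcFib x) (h : RngFib g.1) : SrcFib x :=
  ⟨h.1, g.2 ≫ Groupoid.inv h.2⟩

/-- The convolution action `(f · ξ)(g) = ∑_{h ∈ 𝒢^{r(g)}} f(h) ξ(h⁻¹ g)` of a function on the groupoid
on a vector valued function on the fiber `𝒢_x`. -/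
def convAct {X : Type w} [Groupoid.{v} X] {x : X} {E : Type*} [AddCommMonoid E] [SMul ℂ E]
    [TopologicalSpace E] (f : Arr X → ℂ) (ξ : SrcFib x → E) (g : SrcFib x) : E :=
  ∑' h : RngFib g.1, f h.arr • ξ (ldiv g h)

/-- The convolution product `(f₁ * f₂)(g) = ∑_{h ∈ 𝒢^{r(g)}} f₁(h) f₂(h⁻¹ g)`. -/
def conv {X : Type w} [Groupoid.{v} X] (f₁ f₂ : Arr X → ℂ) (g : Arr X) : ℂ :=
  ∑' h : RngFib g.rng, f₁ h.arr * f₂ (ldiv (⟨g.rng, g.hom⟩ : SrcFib g.src) h).arr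

/-- Functions with finite support on every range fiber. -/
def FibFin {X : Type w} [Groupoid.{v} X] (f : Arr X → ℂ) : Prop :=
  ∀ y : X, {h : RngFib y | f h.arr ≠ 0}.Finite

section algebra

variable {X : Type w} [Groupoid.{v} X]

/-- For an arrow `h` with range `y`, the bijection `k ↦ h⁻¹ k` of `𝒢^y` onto `𝒢^{s(h)}`. -/
def rngShift {y : X} (h : RngFib y) : RngFib y ≃ RngFib h.1 where
  toFun k := ⟨k.1, k.2 ≫ Groupoid.inv h.2⟩
  invFun l := ⟨l.1, l.2 ≫ h.2⟩
  left_inv k := by simp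
  right_inv l := by simp

lemma convAct_summable {x : X} {E : Type*} [NormedAddCommGroup E] [NormedSpace ℂ E]
    {f : Arr X → ℂ} (hf : FibFin f) (ξ : SrcFib x → E) (g : SrcFib x) :
    Summable fun h : RngFib g.1 => f h.arr • ξ (ldiv g h) :=
  summable_of_hasFiniteSupport ((hf g.1).subset fun h hh => by
    intro h0; exact hh (by simp [h0]))

lemma conv_eq_convAct (f₁ f₂ : Arr X → ℂ) {x : X} (g : SrcFib x) :
    conv f₁ f₂ g.arr = convAct f₁ (fun k : SrcFib x => f₂ k.arr) g := rfl

/-- The convolution action is compatible with the convolution product. -/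
lemma convAct_conv {x : X} {E : Type*} [NormedAddCommGroup E] [NormedSpace ℂ E]
    {f₁ f₂ : Arr X → ℂ} (h₁ : FibFin f₁) (h₂ : FibFin f₂) (ξ : SrcFib x → E) :
    convAct (conv f₁ f₂) ξ = convAct f₁ (convAct f₂ ξ) := by
  funext g
  let F : RngFib g.1 → RngFib g.1 → E := fun h k =>
    f₁ h.arr • f₂ (rngShift h k).arr • ξ (ldiv g k)
  have hF0 : (Function.support (Function.uncurry F)).Finite := by
    have : (⋃ h ∈ {h : RngFib g.1 | f₁ h.arr ≠ 0},
        (Prod.mk h) '' ((rngShift h).symm '' {l : RngFib h.1 | f₂ l.arr ≠ 0})).Finite :=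
      (h₁ g.1).biUnion fun h _ => ((h₂ h.1).image _).image _
    refine this.subset ?_
    rintro ⟨h, k⟩ hk
    have hk : f₁ h.arr • f₂ (rngShift h k).arr • ξ (ldiv g k) ≠ 0 := hk
    simp only [Set.mem_iUnion]
    refine ⟨h, fun h0 => hk (by rw [h0, zero_smul]), k, ⟨rngShift h k, fun h0 => hk ?_, ?_⟩, rfl⟩
    · rw [h0, zero_smul, smul_zero]
    · simp
  have hF : Summable (Function.uncurry F) := summable_of_hasFiniteSupport hF0
  have e1 : convAct (conv f₁ f₂) ξ g = ∑' k, ∑' h, F h k := by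
    refine tsum_congr fun k => ?_
    rw [conv, ← Summable.tsum_smul_const]
    · refine tsum_congr fun h => ?_
      simp only [F]
      rw [smul_smul]
      rfl
    · exact convAct_summable (E := ℂ) h₁ (fun l : SrcFib k.1 => f₂ l.arr) ⟨g.1, k.2⟩
  have e2 : convAct f₁ (convAct f₂ ξ) g = ∑' h, ∑' k, F h k := by
    refine tsum_congr fun h => ?_
    rw [convAct, ← (convAct_summable (E := E) h₂ ξ (ldiv g h)).tsum_const_smul]
    refine ((rngShift h).tsum_eq _).symm.trans ?_
    refine tsum_congr fun k => ?_
    simp only [F]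
    congr 3
    simp [ldiv, rngShift]
  rw [e1, e2]
  refine hF.tsum_comm' (fun h => ?_) fun k => ?_
  · exact summable_of_hasFiniteSupport ((hF0.image Prod.snd).subset fun k hk => ⟨(h, k), hk, rfl⟩)
  · exact summable_of_hasFiniteSupport ((hF0.image Prod.fst).subset fun h hk => ⟨(h, k), hk, rfl⟩)

end algebra

section topology

variable {X : Type w} [Groupoid.{v} X] [TopologicalSpace X] [TopologicalSpace (Arr X)]

namespace Arr

@[simp] lemma inv_src (g : Arr X) : g.inv.src = g.rng := rfl
@[simp] lemma inv_rng (g : Arr X) : g.inv.rng = g.src := rfl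
@[simp] lemma inv_inv (g : Arr X) : g.inv.inv = g := by cases g; simp [inv]

variable [EtaleGroupoid X]

lemma continuous_src : Continuous (src : Arr X → X) :=
  EtaleGroupoid.isLocalHomeomorph_src.continuous

/-- Inversion as a homeomorphism of the space of arrows. -/
def invHomeo (X : Type w) [Groupoid.{v} X] [TopologicalSpace X] [TopologicalSpace (Arr X)]
    [EtaleGroupoid X] : Arr X ≃ₜ Arr X where
  toFun := inv
  invFun := inv
  left_inv := inv_inv
  right_inv := inv_inv
  continuous_toFun := EtaleGroupoid.continuous_inv
  continuous_invFun := EtaleGroupoid.continuous_inv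

lemma isLocalHomeomorph_rng : IsLocalHomeomorph (rng : Arr X → X) :=
  (EtaleGroupoid.isLocalHomeomorph_src (X := X)).comp (invHomeo X).isLocalHomeomorph

lemma continuous_rng : Continuous (rng : Arr X → X) := isLocalHomeomorph_rng.continuous

lemma t2_units [T2Space (Arr X)] : T2Space X :=
  T2Space.of_injective_continuous (f := (unit : X → Arr X))
    (fun _ _ h => congrArg src h) EtaleGroupoid.continuous_unit

lemma exists_bisection (g : Arr X) : ∃ W : Set (Arr X), IsOpen W ∧ IsBisection W ∧ g ∈ W := by
  obtain ⟨e, he, hs⟩ := EtaleGroupoid.isLocalHomeomorph_src g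
  obtain ⟨e', he', hr⟩ := isLocalHomeomorph_rng g
  refine ⟨e.source ∩ e'.source, e.open_source.inter e'.open_source, ⟨?_, ?_⟩, he, he'⟩
  · rw [hs]; exact e.injOn.mono Set.inter_subset_left
  · rw [hr]; exact e'.injOn.mono Set.inter_subset_right

end Arr

/-- Being supported in an open bisection. -/
def BisecSupp (f : Arr X → ℂ) : Prop :=
  ∃ W : Set (Arr X), IsOpen W ∧ Arr.IsBisection W ∧ tsupport f ⊆ W

lemma RngFib.arr_injective {y : X} : Function.Injective (RngFib.arr : RngFib y → Arr X) := by
  rintro ⟨a, h⟩ ⟨b, k⟩ e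
  simp only [RngFib.arr, Arr.mk.injEq, true_and] at e
  obtain ⟨rfl, e⟩ := e
  simpa using e

lemma convAct_eq_single {x : X} {E : Type*} [NormedAddCommGroup E] [NormedSpace ℂ E]
    {f : Arr X → ℂ} {W : Set (Arr X)} (hW : Arr.IsBisection W) (hf : Function.support f ⊆ W)
    (ξ : SrcFib x → E) (g : SrcFib x) (h : RngFib g.1) (hh : h.arr ∈ W) :
    convAct f ξ g = f h.arr • ξ (ldiv g h) := by
  refine tsum_eq_single h fun k hk => ?_
  have : f k.arr = 0 := by
    by_contra h0
    exact hk (RngFib.arr_injective (hW.2 (hf h0) hh rfl))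
  rw [this, zero_smul]

lemma conv_eq_single {f₁ f₂ : Arr X → ℂ} {W : Set (Arr X)} (hW : Arr.IsBisection W)
    (hf : Function.support f₁ ⊆ W) {a b : Arr X} (h : (b.inv, a).1.src = (b.inv, a).2.rng)
    (hb : b ∈ W) : conv f₁ f₂ a = f₁ b * f₂ (Arr.mul ⟨(b.inv, a), h⟩) := by
  obtain ⟨as, ar, ah⟩ := a
  obtain ⟨bs, br, bh⟩ := b
  have h' : br = ar := h
  subst h'
  have := convAct_eq_single (E := ℂ) hW hf (fun k : SrcFib as => f₂ k.arr) ⟨br, ah⟩ ⟨bs, bh⟩ hb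
  have e : Arr.mul ⟨(Arr.inv ⟨bs, br, bh⟩, ⟨as, br, ah⟩), h⟩ =
    ⟨as, bs, ah ≫ 𝟙 br ≫ Groupoid.inv bh⟩ := rfl
  rw [e, Category.id_comp]
  exact this

lemma convAct_eq_zero {x : X} {E : Type*} [NormedAddCommGroup E] [NormedSpace ℂ E]
    {f : Arr X → ℂ} (ξ : SrcFib x → E) (g : SrcFib x) (h : ∀ h : RngFib g.1, f h.arr = 0) :
    convAct f ξ g = 0 := by
  simp [convAct, h]

variable [EtaleGroupoid X] [T2Space (Arr X)] [LocallyCompactSpace (Arr X)]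

lemma fibFin_of_compact {f : Arr X → ℂ} (hf : HasCompactSupport f) : FibFin f := by
  intro y
  choose W hWo hWb hW using fun g : Arr X => Arr.exists_bisection g
  obtain ⟨t, ht⟩ := hf.elim_finite_subcover W hWo fun g _ => Set.mem_iUnion.2 ⟨g, hW g⟩
  have : (RngFib.arr '' {h : RngFib y | f h.arr ≠ 0}).Finite := by
    refine ((t.finite_toSet.biUnion (t := fun i => W i ∩ Arr.rng ⁻¹' {y}) fun i _ => ?_)).subset ?_
    · refine Set.Subsingleton.finite fun a ha b hb => (hWb i).2 ha.1 hb.1 ?_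
      exact ha.2.trans hb.2.symm
    · rintro _ ⟨h, hh, rfl⟩
      obtain ⟨i, hi, hi'⟩ := Set.mem_iUnion₂.1 (ht (subset_tsupport f hh))
      exact Set.mem_iUnion₂.2 ⟨i, hi, hi', rfl⟩
  exact this.of_finite_image RngFib.arr_injective.injOn

/-- Induction principle: every compactly supported continuous function is a finite sum of functions
supported in open bisections. -/
lemma bisec_induction {p : C_c(Arr X, ℂ) → Prop} (h0 : p 0)
    (hadd : ∀ f g, p f → p g → p (f + g)) (hb : ∀ f : C_c(Arr X, ℂ), BisecSupp f → p f)
    (f : C_c(Arr X, ℂ)) : p f := by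
  choose W hWo hWb hW using fun g : Arr X => Arr.exists_bisection g
  obtain ⟨t, ht⟩ := f.hasCompactSupport.isCompact.elim_finite_subcover W hWo
    fun g _ => Set.mem_iUnion.2 ⟨g, hW g⟩
  let e := t.equivFin
  obtain ⟨φ, hφ, hsum, -, -⟩ := exists_continuous_sum_one_of_isOpen_isCompact
    (s := fun i => W (e.symm i)) (fun i => hWo _) f.hasCompactSupport.isCompact (fun g hg => by
      obtain ⟨i, hi, hi'⟩ := Set.mem_iUnion₂.1 (ht hg)
      exact Set.mem_iUnion.2 ⟨e ⟨i, hi⟩, by simpa using hi'⟩)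
  let F : Fin t.card → C_c(Arr X, ℂ) := fun i =>
    ⟨⟨fun g => (φ i g : ℂ) * f g, by fun_prop⟩, f.hasCompactSupport.mul_left⟩
  have hF : f = ∑ i, F i := by
    ext g
    have : (∑ i, F i) g = ∑ i, F i g := by
      rw [CompactlySupportedContinuousMap.coe_sum, Finset.sum_apply]
    rw [this]
    have h2 : ∑ i, F i g = (∑ i, (φ i g : ℂ)) * f g := by
      rw [Finset.sum_mul]; rfl
    rw [h2]
    by_cases hg : g ∈ tsupport f
    · have := hsum hg
      simp only [Finset.sum_apply, Pi.one_apply] at this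
      have h3 : ∑ i, (φ i g : ℂ) = 1 := by exact_mod_cast this
      rw [h3, one_mul]
    · rw [image_eq_zero_of_notMem_tsupport hg, mul_zero]
  rw [hF]
  refine Finset.sum_induction _ p (fun a b => hadd a b) h0 fun i _ => hb _ ?_
  refine ⟨W (e.symm i), hWo _, hWb _, ?_⟩
  refine (closure_mono ?_).trans (hφ i)
  intro g hg h1
  exact hg (by simp only [F]; change ((φ i g : ℝ) : ℂ) * f g = 0; rw [h1]; simp)

lemma conv_continuous_of_bisec {f₁ f₂ : Arr X → ℂ} (c₁ : Continuous f₁) (c₂ : Continuous f₂)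
    (k₁ : HasCompactSupport f₁) (hb : BisecSupp f₁) : Continuous (conv f₁ f₂) := by
  obtain ⟨W, hWo, hWb, hW⟩ := hb
  have : T2Space X := Arr.t2_units
  refine continuous_iff_continuousAt.2 fun g => ?_
  by_cases hg : ∃ h ∈ W, h.rng = g.rng
  · obtain ⟨h, hhW, hhg⟩ := hg
    obtain ⟨e, he, hr⟩ := Arr.isLocalHomeomorph_rng h
    have hre : ∀ a, e a = a.rng := fun a => (congrFun hr a).symm
    let O : Set (Arr X) := Arr.rng ⁻¹' (e.target ∩ e.symm ⁻¹' W)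
    have hO : IsOpen O := (e.symm.isOpen_inter_preimage hWo).preimage Arr.continuous_rng
    have hgO : g ∈ O := by
      have h1 : e h ∈ e.target := e.map_source he
      have h2 : e.symm (e h) = h := e.left_inv he
      rw [hre, hhg] at h1 h2
      exact ⟨h1, by rw [Set.mem_preimage, h2]; exact hhW⟩
    have hτ : ∀ a : O, (Arr.inv (e.symm a.1.rng), a.1).1.src = (Arr.inv (e.symm a.1.rng), a.1).2.rng :=
      fun a => by
        rw [Arr.inv_src, ← hre]; exact e.right_inv a.2.1
    have hco : ContinuousOn (conv f₁ f₂) O := by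
      rw [continuousOn_iff_continuous_domRestrict]
      have hc : Continuous fun a : O => e.symm a.1.rng :=
        e.symm.continuousOn.comp_continuous (Arr.continuous_rng.comp continuous_subtype_val)
          fun a => a.2.1
      have heq : O.domRestrict (conv f₁ f₂) = fun a : O => f₁ (e.symm a.1.rng) *
          f₂ (Arr.mul ⟨(Arr.inv (e.symm a.1.rng), a.1), hτ a⟩) := by
        exact funext fun a => conv_eq_single hWb ((subset_tsupport f₁).trans hW) (hτ a) a.2.2
      rw [heq]
      refine (c₁.comp hc).mul (c₂.comp (EtaleGroupoid.continuous_mul.comp ?_))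
      exact ((EtaleGroupoid.continuous_inv.comp hc).prodMk continuous_subtype_val).subtype_mk _
    exact hco.continuousAt (hO.mem_nhds hgO)
  · have hcl : IsClosed (Arr.rng '' tsupport f₁) :=
      (k₁.isCompact.image Arr.continuous_rng).isClosed
    have hO : IsOpen (Arr.rng ⁻¹' (Arr.rng '' tsupport f₁)ᶜ : Set (Arr X)) :=
      hcl.isOpen_compl.preimage Arr.continuous_rng
    have hgO : g ∈ (Arr.rng ⁻¹' (Arr.rng '' tsupport f₁)ᶜ : Set (Arr X)) := by
      rintro ⟨h, hh, e⟩
      exact hg ⟨h, hW hh, e⟩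
    refine (continuousAt_const (y := (0 : ℂ))).congr ?_
    filter_upwards [hO.mem_nhds hgO] with a ha
    symm
    refine convAct_eq_zero (E := ℂ) (fun k : SrcFib a.src => f₂ k.arr) ⟨a.rng, a.hom⟩ fun h => ?_
    by_contra h0
    exact ha ⟨h.arr, subset_tsupport f₁ h0, rfl⟩

lemma conv_hasCompactSupport {f₁ f₂ : Arr X → ℂ}
    (k₁ : HasCompactSupport f₁) (k₂ : HasCompactSupport f₂) : HasCompactSupport (conv f₁ f₂) := by
  have : T2Space X := Arr.t2_units
  let D : Set (Arr X × Arr X) := {p | p.1.src = p.2.rng}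
  have hD : IsClosed D := isClosed_eq (Arr.continuous_src.comp continuous_fst)
    (Arr.continuous_rng.comp continuous_snd)
  have hK : IsCompact ((↑) ⁻¹' (tsupport f₁ ×ˢ tsupport f₂) : Set D) :=
    hD.isClosedEmbedding_subtypeVal.isCompact_preimage (k₁.isCompact.prod k₂.isCompact)
  refine HasCompactSupport.intro (hK.image EtaleGroupoid.continuous_mul) fun g hg => ?_
  refine (tsum_congr fun h => ?_).trans tsum_zero
  by_contra h0
  obtain ⟨h1, h2⟩ := mul_ne_zero_iff.1 h0
  refine hg ⟨⟨(h.arr, (ldiv (⟨g.rng, g.hom⟩ : SrcFib g.src) h).arr),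
    (rfl : h.arr.src = (ldiv (⟨g.rng, g.hom⟩ : SrcFib g.src) h).arr.rng)⟩, ⟨subset_tsupport f₁ h1, subset_tsupport f₂ h2⟩, ?_⟩
  cases g
  simp [Arr.mul, ldiv, SrcFib.arr, RngFib.arr]

end topology

section convAlg

variable {X : Type w} [Groupoid.{v} X] [TopologicalSpace X] [TopologicalSpace (Arr X)]

/-- The space `C_c(𝒢)` of compactly supported continuous functions on a groupoid, to be equipped with
the convolution product. -/
def ConvAlg (X : Type w) [Groupoid.{v} X] [TopologicalSpace (Arr X)] := C_c(Arr X, ℂ)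

namespace ConvAlg

instance : AddCommGroup (ConvAlg X) := inferInstanceAs (AddCommGroup C_c(Arr X, ℂ))
instance : Module ℂ (ConvAlg X) := inferInstanceAs (Module ℂ C_c(Arr X, ℂ))

/-- The underlying compactly supported continuous function. -/
def fn (f : ConvAlg X) : C_c(Arr X, ℂ) := f

@[ext] lemma ext {f g : ConvAlg X} (h : ∀ a, f.fn a = g.fn a) : f = g :=
  CompactlySupportedContinuousMap.ext h

@[simp] lemma add_fn (f g : ConvAlg X) (a : Arr X) : (f + g).fn a = f.fn a + g.fn a := rfl
@[simp] lemma smul_fn (c : ℂ) (f : ConvAlg X) (a : Arr X) : (c • f).fn a = c * f.fn a := rfl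
@[simp] lemma zero_fn (a : Arr X) : (0 : ConvAlg X).fn a = 0 := rfl
@[simp] lemma neg_fn (f : ConvAlg X) (a : Arr X) : (-f).fn a = -f.fn a := rfl
@[simp] lemma sub_fn (f g : ConvAlg X) (a : Arr X) : (f - g).fn a = f.fn a - g.fn a := rfl

variable [EtaleGroupoid X] [T2Space (Arr X)] [LocallyCompactSpace (Arr X)]

lemma fibFin (f : ConvAlg X) : FibFin f.fn := fibFin_of_compact f.fn.hasCompactSupport

lemma convAct_add_left {x : X} {E : Type*} [NormedAddCommGroup E] [NormedSpace ℂ E]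
    (f₁ f₂ : ConvAlg X) (ξ : SrcFib x → E) :
    convAct (f₁ + f₂).fn ξ = convAct f₁.fn ξ + convAct f₂.fn ξ := by
  funext g
  rw [Pi.add_apply]
  unfold convAct
  rw [← (convAct_summable f₁.fibFin ξ g).tsum_add (convAct_summable f₂.fibFin ξ g)]
  exact tsum_congr fun h => by rw [add_fn, add_smul]

lemma convAct_smul_left {x : X} {E : Type*} [NormedAddCommGroup E] [NormedSpace ℂ E]
    (c : ℂ) (f : ConvAlg X) (ξ : SrcFib x → E) :
    convAct (c • f).fn ξ = c • convAct f.fn ξ := by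
  funext g
  rw [Pi.smul_apply]
  unfold convAct
  rw [← (convAct_summable f.fibFin ξ g).tsum_const_smul]
  exact tsum_congr fun h => by rw [smul_fn, mul_smul]

lemma convAct_add_right {x : X} {E : Type*} [NormedAddCommGroup E] [NormedSpace ℂ E]
    (f : ConvAlg X) (ξ η : SrcFib x → E) :
    convAct f.fn (ξ + η) = convAct f.fn ξ + convAct f.fn η := by
  funext g
  rw [Pi.add_apply]
  unfold convAct
  rw [← (convAct_summable f.fibFin ξ g).tsum_add (convAct_summable f.fibFin η g)]
  exact tsum_congr fun h => by rw [Pi.add_apply, smul_add]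

lemma convAct_smul_right {x : X} {E : Type*} [NormedAddCommGroup E] [NormedSpace ℂ E]
    (c : ℂ) (f : ConvAlg X) (ξ : SrcFib x → E) :
    convAct f.fn (c • ξ) = c • convAct f.fn ξ := by
  funext g
  rw [Pi.smul_apply]
  unfold convAct
  rw [← (convAct_summable f.fibFin ξ g).tsum_const_smul]
  exact tsum_congr fun h => by rw [Pi.smul_apply, smul_comm]

lemma induction {p : ConvAlg X → Prop} (h0 : p 0) (hadd : ∀ f g, p f → p g → p (f + g))
    (hb : ∀ f : ConvAlg X, BisecSupp f.fn → p f) (f : ConvAlg X) : p f :=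
  bisec_induction (p := p) h0 hadd hb f

lemma conv_continuous (f₁ f₂ : ConvAlg X) : Continuous (conv f₁.fn f₂.fn) := by
  refine bisec_induction (p := fun f : C_c(Arr X, ℂ) => Continuous (conv f f₂.fn)) ?_ ?_ ?_ f₁
  · have : conv (0 : C_c(Arr X, ℂ)) f₂.fn = 0 := by
      funext g; simp [conv]
    rw [this]; exact continuous_zero
  · intro f g hf hg
    have : conv (f + g : C_c(Arr X, ℂ)) f₂.fn = conv f f₂.fn + conv g f₂.fn := by
      funext a
      exact congrFun (convAct_add_left (E := ℂ) (f : ConvAlg X) (g : ConvAlg X)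
        (fun k : SrcFib a.src => f₂.fn k.arr)) ⟨a.rng, a.hom⟩
    rw [this]; exact hf.add hg
  · exact fun f hf => conv_continuous_of_bisec f.continuous f₂.fn.continuous f.hasCompactSupport hf

instance : Mul (ConvAlg X) :=
  ⟨fun f₁ f₂ => (⟨⟨conv f₁.fn f₂.fn, conv_continuous f₁ f₂⟩,
    conv_hasCompactSupport f₁.fn.hasCompactSupport f₂.fn.hasCompactSupport⟩ : C_c(Arr X, ℂ))⟩

lemma mul_fn (f₁ f₂ : ConvAlg X) (a : Arr X) : (f₁ * f₂).fn a = conv f₁.fn f₂.fn a := rfl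

lemma mul_fn_eq (f₁ f₂ : ConvAlg X) (a : Arr X) : (f₁ * f₂).fn a =
    convAct f₁.fn (fun k : SrcFib a.src => f₂.fn k.arr) ⟨a.rng, a.hom⟩ := rfl

lemma convAct_mul {x : X} {E : Type*} [NormedAddCommGroup E] [NormedSpace ℂ E]
    (f₁ f₂ : ConvAlg X) (ξ : SrcFib x → E) :
    convAct (f₁ * f₂).fn ξ = convAct f₁.fn (convAct f₂.fn ξ) :=
  convAct_conv f₁.fibFin f₂.fibFin ξ

instance : NonUnitalRing (ConvAlg X) :=
  { (inferInstance : AddCommGroup (ConvAlg X)), (inferInstance : Mul (ConvAlg X)) with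
    zero_mul := fun f => by ext a; simp [mul_fn, conv]
    mul_zero := fun f => by ext a; simp [mul_fn, conv]
    left_distrib := fun f g h => by
      ext a
      rw [mul_fn_eq, add_fn, mul_fn_eq, mul_fn_eq]
      exact congrFun (convAct_add_right (E := ℂ) f _ _) _
    right_distrib := fun f g h => by
      ext a
      rw [mul_fn_eq, add_fn, mul_fn_eq, mul_fn_eq, convAct_add_left]
      rfl
    mul_assoc := fun f g h => by
      ext a
      rw [mul_fn_eq, mul_fn_eq, convAct_mul]
      rfl }

instance : IsScalarTower ℂ (ConvAlg X) (ConvAlg X) where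
  smul_assoc c f g := by
    ext a
    rw [smul_eq_mul, mul_fn_eq, convAct_smul_left]
    rfl

instance : SMulCommClass ℂ (ConvAlg X) (ConvAlg X) where
  smul_comm c f g := by
    ext a
    rw [smul_eq_mul, smul_eq_mul, smul_fn, mul_fn_eq, mul_fn_eq]
    exact (congrFun (convAct_smul_right (E := ℂ) c f (fun k : SrcFib a.src => g.fn k.arr))
      ⟨a.rng, a.hom⟩).symm

instance : Star (ConvAlg X) :=
  ⟨fun f => (⟨⟨fun g => starRingEnd ℂ (f.fn g.inv),
    Complex.continuous_conj.comp (f.fn.continuous.comp EtaleGroupoid.continuous_inv)⟩,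
    (f.fn.hasCompactSupport.comp_homeomorph (Arr.invHomeo X)).comp_left (map_zero _)⟩ :
      C_c(Arr X, ℂ))⟩

lemma star_fn (f : ConvAlg X) (g : Arr X) : (star f).fn g = starRingEnd ℂ (f.fn g.inv) := rfl

instance : StarRing (ConvAlg X) where
  star_involutive f := by ext a; simp [star_fn]
  star_add f g := by ext a; simp [star_fn]
  star_mul f₁ f₂ := by
    ext ⟨s, r, a⟩
    rw [star_fn, mul_fn, mul_fn, conv, conv, Complex.conj_tsum]
    refine ((rngShift (⟨s, a⟩ : RngFib r)).tsum_eq _).symm.trans ?_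
    refine tsum_congr fun k => ?_
    rw [map_mul, mul_comm, star_fn, star_fn]
    simp [rngShift, RngFib.arr, SrcFib.arr, Arr.inv, ldiv]

instance : StarModule ℂ (ConvAlg X) where
  star_smul c f := by ext a; simp [star_fn]

end ConvAlg

end convAlg

section envelope

variable {X : Type w} [Groupoid.{v} X] [TopologicalSpace X] [TopologicalSpace (Arr X)]
  [EtaleGroupoid X] [T2Space (Arr X)] [LocallyCompactSpace (Arr X)]

/-- A representation of `C_c(𝒢)` by bounded operators on a Hilbert space. -/
abbrev ConvRep (X : Type w) [Groupoid.{v} X] [TopologicalSpace X] [TopologicalSpace (Arr X)]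
    [EtaleGroupoid X] [T2Space (Arr X)] [LocallyCompactSpace (Arr X)]
    (H : Type*) [NormedAddCommGroup H] [InnerProductSpace ℂ H] [CompleteSpace H] :=
  ConvAlg X →⋆ₙₐ[ℂ] (H →L[ℂ] H)

namespace ConvAlg

lemma isBisection_units : Arr.IsBisection (Set.range (Arr.unit : X → Arr X)) :=
  ⟨by rintro _ ⟨x, rfl⟩ _ ⟨y, rfl⟩ h; exact congrArg _ h,
    by rintro _ ⟨x, rfl⟩ _ ⟨y, rfl⟩ h; exact congrArg _ h⟩

/-- The convolution with a function supported on the units is a pointwise product. -/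
lemma conv_of_units {f₁ : Arr X → ℂ} (h : Function.support f₁ ⊆ Set.range (Arr.unit : X → Arr X))
    (f₂ : Arr X → ℂ) (a : Arr X) : conv f₁ f₂ a = f₁ (Arr.unit a.rng) * f₂ a := by
  have := conv_eq_single (f₂ := f₂) isBisection_units h (a := a) (b := Arr.unit a.rng) rfl ⟨_, rfl⟩
  rw [this]
  have e : Arr.mul ⟨((Arr.unit a.rng).inv, a), rfl⟩ =
    ⟨a.src, a.rng, a.hom ≫ 𝟙 a.rng ≫ Groupoid.inv (𝟙 a.rng)⟩ := rfl
  rw [e]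
  simp

lemma inv_unit (x : X) : (Arr.unit x).inv = Arr.unit x := by simp [Arr.unit, Arr.inv]

lemma star_mul_self_bisec (f : ConvAlg X) (hf : BisecSupp f.fn) :
    Function.support (star f * f).fn ⊆ Set.range (Arr.unit : X → Arr X) ∧
    ∃ M : ℝ, 0 ≤ M ∧ ∀ x : X, ∃ t : ℝ, 0 ≤ t ∧ t ≤ M ∧ (star f * f).fn (Arr.unit x) = t := by
  obtain ⟨W, hWo, hWb, hW⟩ := hf
  have hs := (subset_tsupport f.fn).trans hW
  refine ⟨fun g hg => ?_, ?_⟩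
  · by_contra hgu
    refine hg ((tsum_congr fun h => ?_).trans tsum_zero)
    by_contra h0
    obtain ⟨h1, h2⟩ := mul_ne_zero_iff.1 h0
    have h1' : f.fn h.arr.inv ≠ 0 := fun h3 => h1 (by rw [star_fn, h3, map_zero])
    refine hgu ?_
    have := hWb.2 (hs h1') (hs h2) rfl
    obtain ⟨s, r, g⟩ := g
    obtain ⟨z, h⟩ := h
    simp only [RngFib.arr, Arr.inv, ldiv, SrcFib.arr, Arr.mk.injEq, true_and] at this
    obtain ⟨rfl, this⟩ := this
    have := eq_of_heq this
    have : g = 𝟙 _ := by simpa using this.symm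
    rw [this]; exact ⟨_, rfl⟩
  · obtain ⟨C, hC⟩ := f.fn.hasCompactSupport.exists_bound_of_continuous f.fn.continuous
    refine ⟨C * C, mul_self_nonneg C, fun x => ?_⟩
    have hWi : Arr.IsBisection (Arr.inv ⁻¹' W) :=
      ⟨fun a ha b hb h => by
        have := hWb.2 ha hb h
        rw [← a.inv_inv, this, b.inv_inv],
      fun a ha b hb h => by
        have := hWb.1 ha hb h
        rw [← a.inv_inv, this, b.inv_inv]⟩
    have hsi : Function.support (star f).fn ⊆ Arr.inv ⁻¹' W := fun a ha =>
      hs fun h => ha (by rw [star_fn, h, map_zero])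
    by_cases hx : ∃ b ∈ Arr.inv ⁻¹' W, b.rng = x
    · obtain ⟨b, hb, rfl⟩ := hx
      refine ⟨‖f.fn b.inv‖ ^ 2, by positivity, ?_, ?_⟩
      · rw [sq]
        exact mul_le_mul (hC _) (hC _) (norm_nonneg _) ((norm_nonneg _).trans (hC b.inv))
      · rw [mul_fn, conv_eq_single hWi hsi (a := Arr.unit b.rng) (b := b) rfl hb, star_fn]
        have : Arr.mul ⟨(b.inv, Arr.unit b.rng), rfl⟩ = b.inv := by
          cases b; simp [Arr.mul, Arr.unit, Arr.inv]
        rw [this, mul_comm, Complex.mul_conj, Complex.normSq_eq_norm_sq]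
    · refine ⟨0, le_rfl, mul_self_nonneg C, ?_⟩
      refine (tsum_congr fun h => ?_).trans (tsum_zero.trans (by simp))
      have : (star f).fn h.arr = 0 := by
        by_contra h0
        exact hx ⟨h.arr, hsi h0, rfl⟩
      rw [this, zero_mul]

/-- The norms of a fixed element in all representations are uniformly bounded. -/
lemma exists_rep_bound (f : ConvAlg X) : ∃ C : ℝ, ∀ (H : Type u) [NormedAddCommGroup H]
    [InnerProductSpace ℂ H] [CompleteSpace H] (σ : ConvRep X H), ‖σ f‖ ≤ C := by
  refine induction (p := fun f : ConvAlg X => ∃ C : ℝ, ∀ (H : Type u)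
    [NormedAddCommGroup H] [InnerProductSpace ℂ H] [CompleteSpace H] (σ : ConvRep X H),
    ‖σ f‖ ≤ C) ?_ ?_ ?_ f
  · exact ⟨0, fun H _ _ _ σ => (norm_le_zero_iff.2 (map_zero σ))⟩
  · rintro f g ⟨C, hC⟩ ⟨D, hD⟩
    refine ⟨C + D, fun H _ _ _ σ => ?_⟩
    rw [map_add]
    exact (norm_add_le _ _).trans (add_le_add (hC H σ) (hD H σ))
  · intro f hf
    obtain ⟨hu, M, hM, hx⟩ := star_mul_self_bisec f hf
    obtain ⟨a, ha⟩ : ∃ a : ConvAlg X, a = star f * f := ⟨_, rfl⟩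
    rw [← ha] at hu hx
    let b : ConvAlg X := (⟨⟨fun g => ((Real.sqrt (M * ‖a.fn g‖ - ‖a.fn g‖ ^ 2) : ℝ) : ℂ),
      by fun_prop⟩, a.fn.hasCompactSupport.comp_left
        (g := fun z : ℂ => ((Real.sqrt (M * ‖z‖ - ‖z‖ ^ 2) : ℝ) : ℂ)) (by simp)⟩ : C_c(Arr X, ℂ))
    have hb : ∀ g, b.fn g = ((Real.sqrt (M * ‖a.fn g‖ - ‖a.fn g‖ ^ 2) : ℝ) : ℂ) := fun g => rfl
    have hub : Function.support b.fn ⊆ Set.range (Arr.unit : X → Arr X) := fun g hg =>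
      hu fun h0 => hg (by rw [hb, h0]; simp)
    have hstar : ∀ c : ConvAlg X, Function.support c.fn ⊆ Set.range (Arr.unit : X → Arr X) →
        Function.support (star c).fn ⊆ Set.range (Arr.unit : X → Arr X) := fun c hc g hg => by
      have : g.inv ∈ Set.range (Arr.unit : X → Arr X) := hc fun h0 => hg (by rw [star_fn, h0, map_zero])
      obtain ⟨x, hx⟩ := this
      exact ⟨x, by rw [← g.inv_inv, ← hx, inv_unit]⟩
    have key : star b * b = (M : ℂ) • a - star a * a := by
      ext g
      rw [sub_fn, smul_fn, mul_fn, mul_fn, conv_of_units (hstar b hub), conv_of_units (hstar a hu)]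
      by_cases hg : g ∈ Set.range (Arr.unit : X → Arr X)
      · obtain ⟨x, rfl⟩ := hg
        obtain ⟨t, ht0, htM, ht⟩ := hx x
        have e : (Arr.unit (Arr.unit x).rng : Arr X) = Arr.unit x := rfl
        have hn : ‖(t : ℂ)‖ = t := by rw [Complex.norm_real, Real.norm_of_nonneg ht0]
        rw [e, star_fn, star_fn, inv_unit, hb, ht, Complex.conj_ofReal, Complex.conj_ofReal, hn,
          ← Complex.ofReal_mul, Real.mul_self_sqrt (by nlinarith)]
        push_cast; ring
      · have h1 : a.fn g = 0 := by by_contra h0; exact hg (hu h0)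
        have h2 : b.fn g = 0 := by by_contra h0; exact hg (hub h0)
        rw [h1, h2]; simp
    refine ⟨Real.sqrt M, fun H _ _ _ σ => ?_⟩
    have hT : ‖σ a‖ ≤ M := by
      refine ContinuousLinearMap.opNorm_le_bound _ hM fun ξ => ?_
      have h1 : σ (star b * b) = (M : ℂ) • σ a - star (σ a) * σ a := by
        rw [key, map_sub, map_smul, map_mul, map_star]
      rw [map_mul, map_star] at h1
      have h2 := congrArg (fun T : H →L[ℂ] H => RCLike.re (inner ℂ (T ξ) ξ)) h1
      simp only [mul_apply_eq_comp, sub_apply,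
        smul_apply, ContinuousLinearMap.star_eq_adjoint,
        ContinuousLinearMap.adjoint_inner_left, inner_sub_left, inner_smul_left,
        Complex.conj_ofReal, inner_self_eq_norm_sq_to_K, map_sub] at h2
      have h3 : RCLike.re ((M : ℂ) * inner ℂ (σ a ξ) ξ) = M * RCLike.re (inner ℂ (σ a ξ) ξ) :=
        RCLike.re_ofReal_mul M _
      rw [h3] at h2
      have h4 : RCLike.re (inner ℂ (σ a ξ) ξ) ≤ ‖σ a ξ‖ * ‖ξ‖ := re_inner_le_norm _ _
      norm_cast at h2
      have h5 : ‖σ a ξ‖ ^ 2 ≤ M * (‖σ a ξ‖ * ‖ξ‖) := by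
        have : 0 ≤ ‖σ b ξ‖ ^ 2 := by positivity
        nlinarith
      rcases (norm_nonneg (σ a ξ)).eq_or_lt with h6 | h6
      · rw [← h6]; positivity
      · nlinarith
    refine Real.le_sqrt_of_sq_le ?_
    rw [sq, ← CStarRing.norm_star_mul_self, ← map_star, ← map_mul, ← ha]
    exact hT

/-- The norm `‖f‖ = sup_σ ‖σ(f)‖`, the supremum over all representations of `C_c(𝒢)`. -/
def repNorm (f : ConvAlg X) : ℝ :=
  sSup {r : ℝ | ∃ (H : Type max v w) (_ : NormedAddCommGroup H) (_ : InnerProductSpace ℂ H)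
    (_ : CompleteSpace H) (σ : ConvRep X H), r = ‖σ f‖}

lemma le_repNorm (f : ConvAlg X) {H : Type max v w} [NormedAddCommGroup H] [InnerProductSpace ℂ H]
    [CompleteSpace H] (σ : ConvRep X H) : ‖σ f‖ ≤ repNorm f := by
  obtain ⟨C, hC⟩ := exists_rep_bound.{max v w} f
  refine le_csSup ⟨C, ?_⟩ ⟨H, _, _, _, σ, rfl⟩
  rintro _ ⟨H, _, _, _, σ, rfl⟩
  exact hC H σ

lemma repNorm_nonneg (f : ConvAlg X) : 0 ≤ repNorm f :=
  Real.sSup_nonneg (by rintro _ ⟨H, _, _, _, σ, rfl⟩; exact norm_nonneg _)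

lemma repNorm_le {f : ConvAlg X} {C : ℝ} (h0 : 0 ≤ C)
    (h : ∀ (H : Type max v w) [NormedAddCommGroup H] [InnerProductSpace ℂ H] [CompleteSpace H]
      (σ : ConvRep X H), ‖σ f‖ ≤ C) : repNorm f ≤ C :=
  Real.sSup_le (by rintro _ ⟨H, _, _, _, σ, rfl⟩; exact h H σ) h0

lemma repNorm_mul_le (f g : ConvAlg X) : repNorm (f * g) ≤ repNorm f * repNorm g :=
  repNorm_le (mul_nonneg (repNorm_nonneg f) (repNorm_nonneg g)) fun H _ _ _ σ => by
    rw [map_mul]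
    exact (norm_mul_le _ _).trans
      (mul_le_mul (le_repNorm f σ) (le_repNorm g σ) (norm_nonneg _) (repNorm_nonneg f))

lemma repNorm_star_le (f : ConvAlg X) : repNorm (star f) ≤ repNorm f :=
  repNorm_le (repNorm_nonneg f) fun H _ _ _ σ => by
    rw [map_star, norm_star]; exact le_repNorm f σ

lemma repNorm_star (f : ConvAlg X) : repNorm (star f) = repNorm f :=
  le_antisymm (repNorm_star_le f) (by simpa using repNorm_star_le (star f))

lemma repNorm_star_mul_self (f : ConvAlg X) : repNorm (star f * f) = repNorm f * repNorm f := by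
  refine le_antisymm (by simpa [repNorm_star] using repNorm_mul_le (star f) f) ?_
  have : repNorm f ≤ Real.sqrt (repNorm (star f * f)) :=
    repNorm_le (Real.sqrt_nonneg _) fun H _ _ _ σ => by
      refine Real.le_sqrt_of_sq_le ?_
      rw [sq, ← CStarRing.norm_star_mul_self, ← map_star, ← map_mul]
      exact le_repNorm _ σ
  have h2 := mul_self_le_mul_self (repNorm_nonneg f) this
  rwa [Real.mul_self_sqrt (repNorm_nonneg _)] at h2

instance : SeminormedAddCommGroup (ConvAlg X) :=
  AddGroupSeminorm.toSeminormedAddCommGroup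
    { toFun := repNorm
      map_zero' := le_antisymm (repNorm_le le_rfl fun H _ _ _ σ => by rw [map_zero, norm_zero])
        (repNorm_nonneg 0)
      add_le' := fun f g => repNorm_le (add_nonneg (repNorm_nonneg f) (repNorm_nonneg g))
        fun H _ _ _ σ => by
          rw [map_add]
          exact (norm_add_le _ _).trans (add_le_add (le_repNorm f σ) (le_repNorm g σ))
      neg' := fun f => by unfold repNorm; simp only [map_neg, norm_neg] }

lemma norm_eq_repNorm (f : ConvAlg X) : ‖f‖ = repNorm f := rfl

instance : NormedSpace ℂ (ConvAlg X) where
  norm_smul_le c f := repNorm_le (mul_nonneg (norm_nonneg c) (repNorm_nonneg f))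
    fun H _ _ _ σ => by
      rw [map_smul]
      exact (norm_smul_le _ _).trans (mul_le_mul_of_nonneg_left (le_repNorm f σ) (norm_nonneg c))

instance : NonUnitalSeminormedRing (ConvAlg X) :=
  { (inferInstance : SeminormedAddCommGroup (ConvAlg X)),
    (inferInstance : NonUnitalRing (ConvAlg X)) with
    norm_mul_le := repNorm_mul_le }

instance : PreCStarAlg (ConvAlg X) :=
  { (inferInstance : NonUnitalSeminormedRing (ConvAlg X)),
    (inferInstance : StarRing (ConvAlg X)),
    (inferInstance : NormedSpace ℂ (ConvAlg X)),
    (inferInstance : IsScalarTower ℂ (ConvAlg X) (ConvAlg X)),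
    (inferInstance : SMulCommClass ℂ (ConvAlg X) (ConvAlg X)),
    (inferInstance : StarModule ℂ (ConvAlg X)) with
    norm_star' := repNorm_star
    norm_star_mul_self' := repNorm_star_mul_self }

end ConvAlg

/-- The full groupoid `C*`-algebra, the completion of `C_c(𝒢)` with respect to the norm `sup ‖σ(f)‖`
over all representations `σ`. -/
abbrev GpdCStar (X : Type w) [Groupoid.{v} X] [TopologicalSpace X] [TopologicalSpace (Arr X)]
    [EtaleGroupoid X] [T2Space (Arr X)] [LocallyCompactSpace (Arr X)] : Type max v w :=
  PreCStarAlg.Compl (ConvAlg X)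

/-- A representation of the full groupoid `C*`-algebra on a Hilbert space. -/
abbrev CStarRep (X : Type w) [Groupoid.{v} X] [TopologicalSpace X] [TopologicalSpace (Arr X)]
    [EtaleGroupoid X] [T2Space (Arr X)] [LocallyCompactSpace (Arr X)]
    (H : Type*) [NormedAddCommGroup H] [InnerProductSpace ℂ H] [CompleteSpace H] :=
  GpdCStar X →⋆ₙₐ[ℂ] (H →L[ℂ] H)

/-- The extension of a representation of `C_c(𝒢)` to the full groupoid `C*`-algebra. -/
def ConvRep.toCStar {H : Type max v w} [NormedAddCommGroup H] [InnerProductSpace ℂ H]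
    [CompleteSpace H] (σ : ConvRep X H) : CStarRep X H :=
  PreCStarAlg.extend σ fun f => ConvAlg.le_repNorm f σ

end envelope

/-! ### Unitary representations and induction -/

/-- A unitary representation of a (discrete) group on a Hilbert space. -/
abbrev URep (S : Type*) [Group S] (H : Type*) [NormedAddCommGroup H] [InnerProductSpace ℂ H]
    [CompleteSpace H] := S →* unitary (H →L[ℂ] H)

section induction

variable {X : Type w} [Groupoid.{v} X]

/-- The product `g s` of an arrow with source `x` and an element of the isotropy group at `x`. -/
def rmul {x : X} (g : SrcFib x) (s : End x) : SrcFib x := ⟨g.1, (show x ⟶ x from s) ≫ g.2⟩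

lemma rmul_one {x : X} (g : SrcFib x) : rmul g 1 = g := by
  obtain ⟨y, g⟩ := g
  exact congrArg _ (Category.id_comp g)

lemma rmul_mul {x : X} (g : SrcFib x) (s t : End x) : rmul g (s * t) = rmul (rmul g s) t := by
  obtain ⟨y, g⟩ := g
  exact congrArg _ (Category.assoc _ _ g)

lemma rmul_injective {x : X} (g : SrcFib x) {s t : End x} (h : rmul g s = rmul g t) : s = t := by
  obtain ⟨y, g⟩ := g
  simp only [rmul, Sigma.mk.injEq, heq_eq_eq, true_and] at h
  exact (cancel_mono g).1 h

lemma ldiv_rmul {x : X} (g : SrcFib x) (s : End x) (h : RngFib g.1) :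
    ldiv (rmul g s) h = rmul (ldiv g h) s := by
  exact congrArg (Sigma.mk h.1) (Category.assoc _ _ _)

variable {x : X} {S : Type*} [Group S] (ι : S →* End x)

/-- Two arrows with source `x` are equivalent if they differ by right multiplication by an element
of (the image of) `S`. -/
def cosetSetoid : Setoid (SrcFib x) where
  r a b := ∃ s : S, b = rmul a (ι s)
  iseqv :=
    { refl := fun a => ⟨1, by rw [map_one, rmul_one]⟩
      symm := by
        rintro a _ ⟨s, rfl⟩
        exact ⟨s⁻¹, by rw [← rmul_mul, ← map_mul, mul_inv_cancel, map_one, rmul_one]⟩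
      trans := by
        rintro a _ _ ⟨s, rfl⟩ ⟨t, rfl⟩
        exact ⟨s * t, by rw [map_mul, rmul_mul]⟩ }

/-- The set `𝒢_x / S` of cosets. -/
abbrev Cosets := Quotient (cosetSetoid ι)

lemma exists_out (g : SrcFib x) :
    ∃ s : S, g = rmul (Quotient.mk (cosetSetoid ι) g).out (ι s) :=
  Quotient.exact (Quotient.out_eq (Quotient.mk (cosetSetoid ι) g))

variable {H : Type*} [NormedAddCommGroup H] [InnerProductSpace ℂ H] [CompleteSpace H] (π : URep S H)

/-- The functions `ξ : 𝒢_x → H` such that `ξ(g s) = π(s)^* ξ(g)` for all `s ∈ S` and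
`∑_{g ∈ 𝒢_x / S} ‖ξ(g)‖² < ∞`. -/
def indFun : Submodule ℂ (SrcFib x → H) where
  carrier := {ξ | (∀ (g : SrcFib x) (s : S), ξ (rmul g (ι s)) = star (π s : H →L[ℂ] H) (ξ g)) ∧
    Memℓp (fun q : Cosets ι => ξ q.out) 2}
  add_mem' := by
    rintro ξ η ⟨h1, h2⟩ ⟨h3, h4⟩
    exact ⟨fun g s => by simp only [Pi.add_apply, h1, h3, map_add], h2.add h4⟩
  zero_mem' := ⟨fun g s => by simp, zero_memℓp⟩
  smul_mem' := by
    rintro c ξ ⟨h1, h2⟩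
    exact ⟨fun g s => by simp only [Pi.smul_apply, h1, map_smul], h2.const_smul c⟩

/-- The Hilbert space `Ind H` of the representation induced from a subgroup `S` of the isotropy group
at `x`; the subgroup is given by an injective homomorphism `ι` into the isotropy group. -/
def IndSpace (_hι : Function.Injective ι) : Type _ := indFun ι π

namespace IndSpace

variable (hι : Function.Injective ι)

instance : AddCommGroup (IndSpace ι π hι) := inferInstanceAs (AddCommGroup (indFun ι π))
instance : Module ℂ (IndSpace ι π hι) := inferInstanceAs (Module ℂ (indFun ι π))

variable {ι π hι}

/-- The underlying function on `𝒢_x`. -/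
def fn (ξ : IndSpace ι π hι) : SrcFib x → H := Subtype.val (p := fun η => η ∈ indFun ι π) ξ

lemma equivariant (ξ : IndSpace ι π hι) (g : SrcFib x) (s : S) :
    ξ.fn (rmul g (ι s)) = star (π s : H →L[ℂ] H) (ξ.fn g) :=
  (Subtype.property (p := fun η => η ∈ indFun ι π) ξ).1 g s

lemma memlp (ξ : IndSpace ι π hι) : Memℓp (fun q : Cosets ι => ξ.fn q.out) 2 :=
  (Subtype.property (p := fun η => η ∈ indFun ι π) ξ).2

@[simp] lemma add_fn (ξ η : IndSpace ι π hι) : (ξ + η).fn = ξ.fn + η.fn := rfl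
@[simp] lemma smul_fn (c : ℂ) (ξ : IndSpace ι π hι) : (c • ξ).fn = c • ξ.fn := rfl

lemma fn_injective : Function.Injective (fn : IndSpace ι π hι → SrcFib x → H) :=
  Subtype.val_injective

/-- The restriction of a function in `Ind H` to a set of representatives of the cosets. -/
def toLp : IndSpace ι π hι →ₗ[ℂ] lp (fun _ : Cosets ι => H) 2 where
  toFun ξ := ⟨fun q => ξ.fn q.out, ξ.memlp⟩
  map_add' _ _ := rfl
  map_smul' _ _ := rfl

lemma star_unitary_mul (s t : S) : star (π (s * t) : H →L[ℂ] H) =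
    star (π t : H →L[ℂ] H) * star (π s : H →L[ℂ] H) := by
  rw [map_mul, Submonoid.coe_mul, star_mul]

lemma norm_star_unitary (s : S) (v : H) : ‖star (π s : H →L[ℂ] H) v‖ = ‖v‖ :=
  ContinuousLinearMap.norm_map_of_mem_unitary (u := star (π s : H →L[ℂ] H))
    (Unitary.star_mem (π s).2) v

lemma inner_star_unitary (s : S) (v v' : H) :
    inner ℂ (star (π s : H →L[ℂ] H) v) (star (π s : H →L[ℂ] H) v') = inner ℂ v v' :=
  ContinuousLinearMap.inner_map_map_of_mem_unitary (u := star (π s : H →L[ℂ] H))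
    (Unitary.star_mem (π s).2) v v'

lemma toLp_injective : Function.Injective (toLp : IndSpace ι π hι → _) := by
  intro ξ η h
  refine fn_injective (funext fun g => ?_)
  obtain ⟨s, hs⟩ := exists_out ι g
  rw [hs, equivariant, equivariant]
  exact congrArg _ (congrFun (congrArg Subtype.val h) (Quotient.mk (cosetSetoid ι) g))

lemma toLp_surjective :
    Function.Surjective (toLp : IndSpace ι π hι → _) := by
  intro η
  choose s hs using exists_out ι
  have hmk : ∀ (g : SrcFib x) (t : S), (Quotient.mk (cosetSetoid ι) (rmul g (ι t))) =
    Quotient.mk (cosetSetoid ι) g := fun g t => (Quotient.sound ⟨t, rfl⟩ :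
      Quotient.mk (cosetSetoid ι) g = Quotient.mk (cosetSetoid ι) (rmul g (ι t))).symm
  let ξ : SrcFib x → H := fun g => star (π (s g) : H →L[ℂ] H) (η (Quotient.mk _ g))
  have hξ : ∀ q : Cosets ι, ξ q.out = η q := by
    intro q
    have h1 := hs q.out
    have : s q.out = 1 := by
      apply hι
      apply rmul_injective q.out
      rw [map_one, rmul_one]
      conv_rhs => rw [h1]
      rw [Quotient.out_eq]
    simp only [ξ, this, map_one]
    rw [Quotient.out_eq]
    simp
  refine ⟨⟨ξ, ⟨fun g t => ?_, ?_⟩⟩, ?_⟩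
  · have : s (rmul g (ι t)) = s g * t := by
      apply hι
      apply rmul_injective (Quotient.mk (cosetSetoid ι) g).out
      have := hs (rmul g (ι t))
      rw [hmk] at this
      rw [← this, map_mul, rmul_mul, ← hs g]
    simp only [ξ]
    rw [this, star_unitary_mul, hmk]
    rfl
  · simp only [hξ]
    exact η.2
  · exact Subtype.ext (funext hξ)

/-- The inner product `(ξ, η) = ∑_{g ∈ 𝒢_x / S} (ξ(g), η(g))`. -/
abbrev core : InnerProductSpace.Core ℂ (IndSpace ι π hι) where
  inner ξ η := ∑' q : Cosets ι, inner ℂ (ξ.fn q.out) (η.fn q.out)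
  conj_inner_symm ξ η := inner_conj_symm (𝕜 := ℂ) (toLp ξ) (toLp η)
  re_inner_nonneg ξ := inner_self_nonneg (𝕜 := ℂ) (x := toLp ξ)
  add_left ξ η ζ := by
    have := inner_add_left (𝕜 := ℂ) (toLp ξ) (toLp η) (toLp ζ)
    rwa [← map_add] at this
  smul_left ξ η c := by
    have := inner_smul_left (𝕜 := ℂ) (toLp ξ) (toLp η) c
    rwa [← map_smul] at this
  definite ξ h := toLp_injective ((inner_self_eq_zero (𝕜 := ℂ) (x := toLp ξ)).1 h |>.trans
    (map_zero toLp).symm)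

instance : NormedAddCommGroup (IndSpace ι π hι) := (core (ι := ι) (π := π) (hι := hι)).toNormedAddCommGroup
instance : InnerProductSpace ℂ (IndSpace ι π hι) := InnerProductSpace.ofCore core.toCore

lemma inner_eq (ξ η : IndSpace ι π hι) :
    inner ℂ ξ η = ∑' q : Cosets ι, inner ℂ (ξ.fn q.out) (η.fn q.out) := rfl

lemma inner_toLp (ξ η : IndSpace ι π hι) : inner ℂ (toLp ξ) (toLp η) = inner ℂ ξ η := rfl

lemma norm_toLp (ξ : IndSpace ι π hι) : ‖toLp ξ‖ = ‖ξ‖ := by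
  rw [norm_eq_sqrt_re_inner (𝕜 := ℂ), norm_eq_sqrt_re_inner (𝕜 := ℂ) ξ, inner_toLp]

instance : CompleteSpace (IndSpace ι π hι) := by
  let e : IndSpace ι π hι ≃ₗᵢ[ℂ] lp (fun _ : Cosets ι => H) 2 :=
    ⟨LinearEquiv.ofBijective toLp ⟨toLp_injective, toLp_surjective⟩, norm_toLp⟩
  exact (completeSpace_congr (e := e.toEquiv) e.isometry.isUniformEmbedding).2 inferInstance

end IndSpace

end induction

section inducedRep

variable {X : Type w} [Groupoid.{v} X] [TopologicalSpace X] [TopologicalSpace (Arr X)]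
  [EtaleGroupoid X] [T2Space (Arr X)] [LocallyCompactSpace (Arr X)]
  {x : X} {S : Type*} [Group S] {ι : S →* End x} {hι : Function.Injective ι}
  {H : Type*} [NormedAddCommGroup H] [InnerProductSpace ℂ H] [CompleteSpace H] {π : URep S H}

namespace IndSpace

lemma convAct_equivariant (f : ConvAlg X) (ξ : IndSpace ι π hι) (g : SrcFib x) (s : S) :
    convAct f.fn ξ.fn (rmul g (ι s)) = star (π s : H →L[ℂ] H) (convAct f.fn ξ.fn g) := by
  unfold convAct
  rw [(star (π s : H →L[ℂ] H)).map_tsum (convAct_summable f.fibFin ξ.fn g)]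
  refine tsum_congr fun h => ?_
  rw [map_smul, ← equivariant]
  exact congrArg (fun k => f.fn (RngFib.arr (y := g.1) h) • ξ.fn k) (ldiv_rmul g (ι s) h)

/-- For a bisection `W`, the partial map `g ↦ h⁻¹ g` (`h ∈ W`) is injective modulo `S`. -/
lemma ldiv_coset_inj {W : Set (Arr X)} (hW : Arr.IsBisection W) {g g' : SrcFib x}
    {h : RngFib g.1} {h' : RngFib g'.1} (hh : h.arr ∈ W) (hh' : h'.arr ∈ W)
    (e : Quotient.mk (cosetSetoid ι) (ldiv g h) = Quotient.mk (cosetSetoid ι) (ldiv g' h')) :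
    Quotient.mk (cosetSetoid ι) g = Quotient.mk (cosetSetoid ι) g' := by
  obtain ⟨s, hs⟩ := Quotient.exact e
  have h1 : h'.arr.src = h.arr.src := congrArg Sigma.fst hs
  have h2 := hW.1 hh' hh h1
  obtain ⟨y, g⟩ := g
  obtain ⟨y', g'⟩ := g'
  obtain ⟨z, h⟩ := h
  obtain ⟨z', h'⟩ := h'
  simp only [RngFib.arr, Arr.mk.injEq] at h2
  obtain ⟨rfl, rfl, h2⟩ := h2
  have h2 := eq_of_heq h2
  subst h2
  refine Quotient.sound ⟨s, ?_⟩
  simp only [ldiv, rmul, Sigma.mk.injEq, heq_eq_eq, true_and] at hs ⊢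
  rw [← Category.assoc] at hs
  exact (cancel_mono _).1 hs

/-- For a bisection `W`, the partial map `g ↦ h⁻¹ g` (`h ∈ W`) is well defined modulo `S`. -/
lemma ldiv_coset_wd {W : Set (Arr X)} (hW : Arr.IsBisection W) {g g' : SrcFib x}
    {h : RngFib g.1} {h' : RngFib g'.1} (hh : h.arr ∈ W) (hh' : h'.arr ∈ W)
    (e : Quotient.mk (cosetSetoid ι) g = Quotient.mk (cosetSetoid ι) g') :
    Quotient.mk (cosetSetoid ι) (ldiv g h) = Quotient.mk (cosetSetoid ι) (ldiv g' h') := by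
  obtain ⟨s, rfl⟩ := Quotient.exact e
  have h1 : h' = (show RngFib (rmul g (ι s)).1 from h) := RngFib.arr_injective (hW.2 hh' hh rfl)
  rw [h1]
  exact Quotient.sound ⟨s, ldiv_rmul g (ι s) h⟩

lemma norm_coset (ξ : IndSpace ι π hι) (g : SrcFib x) :
    ‖ξ.fn (Quotient.mk (cosetSetoid ι) g).out‖ = ‖ξ.fn g‖ := by
  obtain ⟨s, hs⟩ := exists_out ι g
  conv_rhs => rw [hs, equivariant, norm_star_unitary]

lemma norm_sq_eq (ξ : IndSpace ι π hι) : ‖ξ‖ ^ 2 = ∑' q : Cosets ι, ‖ξ.fn q.out‖ ^ 2 := by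
  have := lp.norm_rpow_eq_tsum (p := 2) (by norm_num) (toLp ξ)
  rw [norm_toLp] at this
  have h2 : ‖ξ‖ ^ 2 = ∑' q : Cosets ι, ‖toLp ξ q‖ ^ 2 := by simpa using this
  exact h2

lemma summable_norm_sq (ξ : IndSpace ι π hι) : Summable fun q : Cosets ι => ‖ξ.fn q.out‖ ^ 2 := by
  have := ξ.memlp.summable (by norm_num)
  simpa using this

lemma convAct_bound (f : ConvAlg X) : ∃ C : ℝ, 0 ≤ C ∧ ∀ ξ : IndSpace ι π hι,
    Memℓp (fun q : Cosets ι => convAct f.fn ξ.fn q.out) 2 ∧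
    ∀ η : IndSpace ι π hι, η.fn = convAct f.fn ξ.fn → ‖η‖ ≤ C * ‖ξ‖ := by
  refine ConvAlg.induction (p := fun f => ∃ C : ℝ, 0 ≤ C ∧ ∀ ξ : IndSpace ι π hι,
    Memℓp (fun q : Cosets ι => convAct f.fn ξ.fn q.out) 2 ∧
    ∀ η : IndSpace ι π hι, η.fn = convAct f.fn ξ.fn → ‖η‖ ≤ C * ‖ξ‖) ?_ ?_ ?_ f
  · refine ⟨0, le_rfl, fun ξ => ?_⟩
    have h0 : convAct (0 : ConvAlg X).fn ξ.fn = 0 := by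
      funext g; exact convAct_eq_zero _ _ fun h => rfl
    refine ⟨by rw [h0]; exact zero_memℓp, fun η hη => ?_⟩
    have : η = 0 := fn_injective (hη.trans h0)
    rw [this]; simp
  · rintro f g ⟨C, hC, h⟩ ⟨D, hD, h'⟩
    refine ⟨C + D, add_nonneg hC hD, fun ξ => ?_⟩
    have hadd := ConvAlg.convAct_add_left f g ξ.fn
    refine ⟨by rw [hadd]; exact (h ξ).1.add (h' ξ).1, fun η hη => ?_⟩
    let a : IndSpace ι π hι := ⟨convAct f.fn ξ.fn, convAct_equivariant f ξ, (h ξ).1⟩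
    let b : IndSpace ι π hι := ⟨convAct g.fn ξ.fn, convAct_equivariant g ξ, (h' ξ).1⟩
    have : η = a + b := fn_injective (hη.trans hadd)
    rw [this, add_mul]
    exact (norm_add_le _ _).trans (add_le_add ((h ξ).2 a rfl) ((h' ξ).2 b rfl))
  · rintro f ⟨W, hWo, hWb, hW⟩
    obtain ⟨C, hC⟩ := f.fn.hasCompactSupport.exists_bound_of_continuous f.fn.continuous
    have hs := (subset_tsupport f.fn).trans hW
    refine ⟨|C|, abs_nonneg C, fun ξ => ?_⟩
    let D := {q : Cosets ι // ∃ h : RngFib q.out.1, h.arr ∈ W}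
    choose k hk using fun q : D => q.2
    let t : D → Cosets ι := fun q => Quotient.mk (cosetSetoid ι) (ldiv q.1.out (k q))
    have ht : Function.Injective t := fun q q' e => by
      have := ldiv_coset_inj hWb (hk q) (hk q') e
      rw [Quotient.out_eq, Quotient.out_eq] at this
      exact Subtype.ext this
    let F : Cosets ι → ℝ := fun q => ‖convAct f.fn ξ.fn q.out‖ ^ 2
    have hF0 : ∀ q, q ∉ Set.range (Subtype.val : D → Cosets ι) → F q = 0 := fun q hq => by
      have : convAct f.fn ξ.fn q.out = 0 := convAct_eq_zero _ _ fun h => by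
        by_contra h0
        exact hq ⟨⟨q, h, hs h0⟩, rfl⟩
      simp only [F, this]; simp
    have hFD : ∀ q : D, F q.1 ≤ C ^ 2 * ‖ξ.fn (t q).out‖ ^ 2 := fun q => by
      simp only [F, t]
      rw [convAct_eq_single hWb hs ξ.fn q.1.out (k q) (hk q), norm_smul, mul_pow, norm_coset]
      have := pow_le_pow_left₀ (norm_nonneg _) (hC (k q).arr) 2
      gcongr
    have hN := (ξ.summable_norm_sq.mul_left (C ^ 2))
    have hs1 : Summable (F ∘ (Subtype.val : D → Cosets ι)) :=
      Summable.of_nonneg_of_le (fun q => by simp only [F, Function.comp]; positivity) hFD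
        (hN.comp_injective ht)
    have hsF : Summable F := (Subtype.val_injective.summable_iff hF0).1 hs1
    refine ⟨memℓp_gen (by simpa using hsF), fun η hη => ?_⟩
    have e1 : ∑' q, F q = ∑' q : D, F q.1 := by
      refine (Subtype.val_injective.tsum_eq ?_).symm
      intro q hq
      by_contra h0
      exact hq (hF0 q h0)
    have e2 : ∑' q : D, F q.1 ≤ ∑' q : Cosets ι, C ^ 2 * ‖ξ.fn q.out‖ ^ 2 :=
      Summable.tsum_le_tsum_of_inj t ht (fun q _ => by positivity) hFD hs1 hN
    have e3 : ‖η‖ ^ 2 ≤ (|C| * ‖ξ‖) ^ 2 := by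
      rw [norm_sq_eq, hη, mul_pow, sq_abs, norm_sq_eq ξ, ← tsum_mul_left, ]
      exact e1.le.trans e2
    exact (sq_le_sq₀ (norm_nonneg _) (by positivity)).1 e3

/-- The operator `(Ind π)(f)` on `Ind H`, `((Ind π)(f)ξ)(g) = ∑_{h ∈ 𝒢^{r(g)}} f(h) ξ(h⁻¹ g)`. -/
def op (f : ConvAlg X) : IndSpace ι π hι →L[ℂ] IndSpace ι π hι :=
  LinearMap.mkContinuousOfExistsBound
    { toFun := fun ξ => ⟨convAct f.fn ξ.fn, convAct_equivariant f ξ,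
        ((convAct_bound f).choose_spec.2 ξ).1⟩
      map_add' := fun ξ η => fn_injective (ConvAlg.convAct_add_right f ξ.fn η.fn)
      map_smul' := fun c ξ => fn_injective (ConvAlg.convAct_smul_right c f ξ.fn) }
    ⟨(convAct_bound f).choose, fun ξ => ((convAct_bound f).choose_spec.2 ξ).2 _ rfl⟩

lemma op_fn (f : ConvAlg X) (ξ : IndSpace ι π hι) : (op f ξ).fn = convAct f.fn ξ.fn := rfl

lemma op_add (f g : ConvAlg X) : (op (f + g) : IndSpace ι π hι →L[ℂ] IndSpace ι π hι) = op f + op g := by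
  ext1 ξ; exact fn_injective (ConvAlg.convAct_add_left f g ξ.fn)

lemma inner_coset (ξ η : IndSpace ι π hι) (g : SrcFib x) :
    inner ℂ (ξ.fn (Quotient.mk (cosetSetoid ι) g).out) (η.fn (Quotient.mk (cosetSetoid ι) g).out) =
      inner ℂ (ξ.fn g) (η.fn g) := by
  obtain ⟨s, hs⟩ := exists_out ι g
  conv_rhs => rw [hs, equivariant, equivariant, inner_star_unitary]

lemma op_inner (f : ConvAlg X) (ξ η : IndSpace ι π hι) :
    inner ℂ (op f ξ) η = inner ℂ ξ (op (star f) η) := by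
  refine ConvAlg.induction (p := fun f => inner ℂ (op f ξ) η = inner ℂ ξ (op (star f) η)) ?_ ?_ ?_ f
  · have : (op (0 : ConvAlg X) : IndSpace ι π hι →L[ℂ] IndSpace ι π hι) = 0 := by
      have := op_add (ι := ι) (π := π) (hι := hι) (0 : ConvAlg X) 0
      simpa using this
    rw [star_zero, this]; simp
  · intro f g hf hg
    rw [star_add, op_add, op_add, add_apply, add_apply, inner_add_left, inner_add_right, hf, hg]
  · rintro f ⟨W, hWo, hWb, hW⟩
    have hs := (subset_tsupport f.fn).trans hW
    have hWi : Arr.IsBisection (Arr.inv ⁻¹' W) :=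
      ⟨fun a ha b hb h => by
        have := hWb.2 ha hb h
        rw [← a.inv_inv, this, b.inv_inv],
      fun a ha b hb h => by
        have := hWb.1 ha hb h
        rw [← a.inv_inv, this, b.inv_inv]⟩
    have hsi : Function.support (star f).fn ⊆ Arr.inv ⁻¹' W := fun a ha =>
      hs fun h => ha (by rw [ConvAlg.star_fn, h, map_zero])
    have key : ∀ (g : SrcFib x) (h : RngFib g.1), h.arr ∈ W →
        inner ℂ ((op f ξ).fn g) (η.fn g) =
          inner ℂ (ξ.fn (ldiv g h)) ((op (star f) η).fn (ldiv g h)) := by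
      intro g h hh
      let k : RngFib (ldiv g h).1 := ⟨g.1, Groupoid.inv h.2⟩
      have hk : k.arr = h.arr.inv := rfl
      rw [op_fn, op_fn, convAct_eq_single hWb hs ξ.fn g h hh,
        convAct_eq_single hWi hsi η.fn (ldiv g h) k (by rw [hk, Set.mem_preimage, Arr.inv_inv]; exact hh),
        hk, ConvAlg.star_fn, Arr.inv_inv, inner_smul_left, inner_smul_right]
      congr 3
      simp [ldiv, k]
    rw [inner_eq, inner_eq]
    let G : Cosets ι → ℂ := fun q => inner ℂ ((op f ξ).fn q.out) (η.fn q.out)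
    have hG : ∀ q : Function.support G, ∃ h : RngFib q.1.out.1, h.arr ∈ W := fun q => by
      by_contra! h0
      refine q.2 ?_
      have : (op f ξ).fn q.1.out = 0 := convAct_eq_zero _ _ fun h => by
        by_contra h1
        exact h0 h (hs h1)
      simp only [G, this, inner_zero_left]
    choose k hk using hG
    symm
    refine tsum_eq_tsum_of_ne_zero_bij (g := G)
      (fun q => Quotient.mk (cosetSetoid ι) (ldiv q.1.out (k q))) ?_ ?_ ?_
    · intro q q' e
      have := ldiv_coset_inj hWb (hk q) (hk q') e
      rw [Quotient.out_eq, Quotient.out_eq] at this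
      exact Subtype.ext this
    · intro p hp
      obtain ⟨l, hl⟩ : ∃ l : RngFib p.out.1, l.arr ∈ Arr.inv ⁻¹' W := by
        by_contra! h0
        refine hp ?_
        have : (op (star f) η).fn p.out = 0 := convAct_eq_zero _ _ fun h => by
          by_contra h1
          exact h0 h (hsi h1)
        simp only [this, inner_zero_right]
      let h : RngFib (ldiv p.out l).1 := ⟨p.out.1, Groupoid.inv l.2⟩
      have hh : h.arr ∈ W := hl
      have hdd : ldiv (ldiv p.out l) h = p.out := by simp [ldiv, h]
      have h1 := key (ldiv p.out l) h hh
      rw [hdd] at h1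
      have hq : Quotient.mk (cosetSetoid ι) (ldiv p.out l) ∈ Function.support G := by
        simp only [Function.mem_support, G]
        rw [inner_coset, h1]
        exact hp
      refine ⟨⟨_, hq⟩, ?_⟩
      have h2 := ldiv_coset_wd (g' := ldiv p.out l) (h' := h) hWb (hk ⟨_, hq⟩) hh
        (Quotient.out_eq (Quotient.mk (cosetSetoid ι) (ldiv p.out l)))
      exact h2.trans (by rw [hdd, Quotient.out_eq])
    · intro q
      refine (inner_coset ξ (op (star f) η) _).trans ?_
      exact (key q.1.out (k q) (hk q)).symm

end IndSpace

/-- The induced representation `Ind π` of `C_c(𝒢)`. -/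
def indConv {X : Type w} [Groupoid.{v} X] [TopologicalSpace X] [TopologicalSpace (Arr X)]
    [EtaleGroupoid X] [T2Space (Arr X)] [LocallyCompactSpace (Arr X)] {x : X}
    {S : Type*} [Group S] (ι : S →* End x) (hι : Function.Injective ι)
    {H : Type*} [NormedAddCommGroup H] [InnerProductSpace ℂ H] [CompleteSpace H] (π : URep S H) :
    ConvRep X (IndSpace ι π hι) :=
  { toFun := IndSpace.op
    map_smul' := fun c f => by
      ext1 ξ
      exact IndSpace.fn_injective (ConvAlg.convAct_smul_left c f ξ.fn)
    map_zero' := by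
      ext1 ξ
      exact IndSpace.fn_injective (funext fun g => convAct_eq_zero _ _ fun h => rfl)
    map_add' := IndSpace.op_add
    map_mul' := fun f g => by
      ext1 ξ
      exact IndSpace.fn_injective (ConvAlg.convAct_mul f g ξ.fn)
    map_star' := fun f => by
      rw [ContinuousLinearMap.star_eq_adjoint, ContinuousLinearMap.eq_adjoint_iff]
      intro ξ η
      have := IndSpace.op_inner (star f) ξ η
      rwa [star_star] at this }

/-- The induced representation `Ind π` of the full groupoid `C*`-algebra. -/
def indRep {X : Type w} [Groupoid.{v} X] [TopologicalSpace X] [TopologicalSpace (Arr X)]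
    [EtaleGroupoid X] [T2Space (Arr X)] [LocallyCompactSpace (Arr X)] {x : X}
    {S : Type*} [Group S] (ι : S →* End x) (hι : Function.Injective ι)
    {H : Type max v w} [NormedAddCommGroup H] [InnerProductSpace ℂ H] [CompleteSpace H]
    (π : URep S H) : CStarRep X (IndSpace ι π hι) :=
  (indConv ι hι π).toCStar

end inducedRep

/-! ### The `C*`-algebra of a discrete group -/

section group

variable {Γ : Type v} [Group Γ]

instance : TopologicalSpace (SingleObj Γ) := ⊥
instance : DiscreteTopology (SingleObj Γ) := ⟨rfl⟩
instance : TopologicalSpace (Arr (SingleObj Γ)) := ⊥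
instance : DiscreteTopology (Arr (SingleObj Γ)) := ⟨rfl⟩

/-- A discrete group, viewed as a groupoid with one unit, is an étale groupoid. -/
instance : EtaleGroupoid (SingleObj Γ) where
  continuous_unit := continuous_of_discreteTopology
  continuous_inv := continuous_of_discreteTopology
  continuous_mul := continuous_of_discreteTopology
  isLocalHomeomorph_src := by
    refine isLocalHomeomorph_iff_isOpenEmbedding_restrict.2 fun g => ⟨{g}, by simp, ?_⟩
    refine IsOpenEmbedding.of_continuous_injective_isOpenMap continuous_of_discreteTopology
      (fun a b _ => Subtype.ext (a.2.trans b.2.symm)) fun _ _ => isOpen_discrete _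

/-- The full `C*`-algebra of a discrete group. -/
abbrev GroupCStar (Γ : Type v) [Group Γ] : Type v := GpdCStar (SingleObj Γ)

/-- A group element as an arrow. -/
def arrOf (g : Γ) : Arr (SingleObj Γ) := ⟨SingleObj.star Γ, SingleObj.star Γ, g⟩

/-- An arrow of a one-object groupoid as a group element. -/
def arrTo (a : Arr (SingleObj Γ)) : Γ := a.hom

open scoped Classical in
/-- The indicator function of `{g}`. -/
def delta (g : Γ) : ConvAlg (SingleObj Γ) :=
  (⟨⟨fun a => if arrTo a = g then 1 else 0, continuous_of_discreteTopology⟩,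
    HasCompactSupport.intro (K := {arrOf g}) isCompact_singleton fun a ha =>
      if_neg fun h => ha (by subst h; rfl)⟩ : C_c(Arr (SingleObj Γ), ℂ))

/-- The canonical unitary `g ∈ C*(Γ)`. -/
def gElt (g : Γ) : GroupCStar Γ := PreCStarAlg.toCompl (delta g)

open scoped Classical in
lemma delta_fn (g : Γ) (a : Arr (SingleObj Γ)) :
    (delta g).fn a = if arrTo a = g then 1 else 0 := rfl

lemma isBisection_singleton {X : Type w} [Groupoid.{v} X] (a : Arr X) : Arr.IsBisection {a} :=
  ⟨Set.injOn_singleton _ _, Set.injOn_singleton _ _⟩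

lemma delta_support (g : Γ) : Function.support (delta g).fn ⊆ {arrOf g} := by
  intro a ha
  by_contra h
  exact ha (if_neg fun h' => h (by subst h'; rfl))

lemma delta_mul_fn (g : Γ) (f : ConvAlg (SingleObj Γ)) (a : Arr (SingleObj Γ)) :
    (delta g * f).fn a = f.fn (arrOf (g⁻¹ * arrTo a)) := by
  obtain ⟨⟨⟩, ⟨⟩, a⟩ := a
  have := convAct_eq_single (E := ℂ) (isBisection_singleton (arrOf g)) (delta_support g)
    (fun k : SrcFib (SingleObj.star Γ) => f.fn k.arr) ⟨SingleObj.star Γ, a⟩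
    ⟨SingleObj.star Γ, g⟩ rfl
  refine Eq.trans this ?_
  have h1 : (delta g).fn (RngFib.arr (y := SingleObj.star Γ) ⟨SingleObj.star Γ, g⟩) = 1 := if_pos rfl
  rw [h1, one_smul]
  rfl

lemma delta_one_mul (f : ConvAlg (SingleObj Γ)) : delta 1 * f = f := by
  ext a
  rw [delta_mul_fn, inv_one, one_mul]
  rfl

open scoped Classical in
lemma delta_mul (g h : Γ) : delta g * delta h = delta (g * h) := by
  ext a
  rw [delta_mul_fn]
  rw [delta_fn, delta_fn]
  change (if g⁻¹ * arrTo a = h then (1 : ℂ) else 0) = _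
  simp only [inv_mul_eq_iff_eq_mul]

open scoped Classical in
lemma star_delta (g : Γ) : star (delta g) = delta g⁻¹ := by
  ext a
  rw [ConvAlg.star_fn, delta_fn, delta_fn]
  change starRingEnd ℂ (if (arrTo a)⁻¹ = g then (1 : ℂ) else 0) = _
  simp only [inv_eq_iff_eq_inv]
  split_ifs <;> simp

lemma gElt_mul (g h : Γ) : gElt g * gElt h = gElt (g * h) := by
  rw [gElt, gElt, gElt, ← PreCStarAlg.toCompl_mul, delta_mul]

lemma star_gElt (g : Γ) : star (gElt g) = gElt g⁻¹ := by
  rw [gElt, gElt, ← PreCStarAlg.toCompl_star, star_delta]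

lemma gElt_one_mul (a : GroupCStar Γ) : gElt 1 * a = a := by
  refine PreCStarAlg.compl_induction (p := fun a => gElt 1 * a = a) a
    (isClosed_eq (continuous_const.mul continuous_id) continuous_id) fun a => ?_
  rw [gElt, ← PreCStarAlg.toCompl_mul, delta_one_mul]

/-- A Hilbert space representation of `C*(Γ)` under which the unit acts as the identity restricts to a
unitary representation of `Γ`. -/
def urepOf {H : Type*} [NormedAddCommGroup H] [InnerProductSpace ℂ H] [CompleteSpace H]
    (σ : GroupCStar Γ →⋆ₙₐ[ℂ] (H →L[ℂ] H)) (h1 : σ (gElt 1) = 1) : URep Γ H where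
  toFun g := ⟨σ (gElt g), by
    rw [Unitary.mem_iff, ← map_star, star_gElt, ← map_mul, ← map_mul, gElt_mul, gElt_mul,
      inv_mul_cancel, mul_inv_cancel]
    exact ⟨h1, h1⟩⟩
  map_one' := Subtype.ext h1
  map_mul' g h := Subtype.ext (by
    change σ (gElt (g * h)) = σ (gElt g) * σ (gElt h)
    rw [← map_mul, gElt_mul])

variable {H : Type*} [NormedAddCommGroup H] [InnerProductSpace ℂ H] [CompleteSpace H]

/-- The orbit function `g ↦ π(g)⁻¹` on the group. -/
def orbitFn (π : URep Γ H) (g : SrcFib (SingleObj.star Γ)) : H →L[ℂ] H :=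
  (π (arrTo g.arr)⁻¹ : unitary (H →L[ℂ] H))

lemma convAct_orbitFn (π : URep Γ H) (f : ConvAlg (SingleObj Γ)) (g : SrcFib (SingleObj.star Γ)) :
    convAct f.fn (orbitFn π) g =
      orbitFn π g * ∑' h : RngFib (SingleObj.star Γ), f.fn h.arr • (π (arrTo h.arr) : H →L[ℂ] H) := by
  have hs : Summable fun h : RngFib (SingleObj.star Γ) =>
      f.fn h.arr • (π (arrTo h.arr) : H →L[ℂ] H) :=
    summable_of_hasFiniteSupport ((f.fibFin _).subset fun h hh h0 => hh (by simp [h0]))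
  rw [← hs.tsum_mul_left]
  obtain ⟨⟨⟩, g⟩ := g
  refine tsum_congr fun h => ?_
  rw [mul_smul_comm]
  congr 1
  change ((π (arrTo (ldiv (⟨SingleObj.star Γ, g⟩ : SrcFib (SingleObj.star Γ)) h).arr)⁻¹ :
    unitary (H →L[ℂ] H)) : H →L[ℂ] H) = (π (arrTo (arrOf g))⁻¹ * π (arrTo h.arr) : unitary (H →L[ℂ] H))
  rw [← map_mul]
  congr 2
  exact (mul_inv_rev _ _).trans (congrArg _ (inv_inv _))

/-- The integrated form `f ↦ ∑_g f(g) π(g)` of a unitary representation of a discrete group. -/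
def URep.toConv (π : URep Γ H) : ConvRep (SingleObj Γ) H where
  toFun f := ∑' h : RngFib (SingleObj.star Γ), f.fn h.arr • (π (arrTo h.arr) : H →L[ℂ] H)
  map_smul' c f := by
    have hs : Summable fun h : RngFib (SingleObj.star Γ) =>
        f.fn h.arr • (π (arrTo h.arr) : H →L[ℂ] H) :=
      summable_of_hasFiniteSupport ((f.fibFin _).subset fun h hh h0 => hh (by simp [h0]))
    refine Eq.trans ?_ (hs.tsum_const_smul c)
    exact tsum_congr fun h => by rw [ConvAlg.smul_fn, mul_smul]
  map_zero' := (tsum_congr fun h => by rw [ConvAlg.zero_fn, zero_smul]).trans tsum_zero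
  map_add' f f' := by
    have hs : ∀ f : ConvAlg (SingleObj Γ), Summable fun h : RngFib (SingleObj.star Γ) =>
        f.fn h.arr • (π (arrTo h.arr) : H →L[ℂ] H) := fun f =>
      summable_of_hasFiniteSupport ((f.fibFin _).subset fun h hh h0 => hh (by simp [h0]))
    rw [← (hs f).tsum_add (hs f')]
    exact tsum_congr fun h => by rw [ConvAlg.add_fn, add_smul]
  map_mul' f f' := by
    let e : SrcFib (SingleObj.star Γ) := ⟨SingleObj.star Γ, (1 : Γ)⟩
    have h1 : orbitFn π e = 1 := by
      change ((π (1 : Γ)⁻¹ : unitary (H →L[ℂ] H)) : H →L[ℂ] H) = 1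
      simp
    have h2 : convAct f'.fn (orbitFn π) = fun g => orbitFn π g *
        ∑' h : RngFib (SingleObj.star Γ), f'.fn h.arr • (π (arrTo h.arr) : H →L[ℂ] H) :=
      funext fun g => convAct_orbitFn π f' g
    have h3 := convAct_orbitFn π (f * f') e
    rw [h1, one_mul] at h3
    rw [← h3, ConvAlg.convAct_mul, h2]
    have h4 := convAct_orbitFn π f e
    rw [h1, one_mul] at h4
    rw [← h4]
    unfold convAct
    rw [← (convAct_summable f.fibFin (orbitFn π) e).tsum_mul_right]
    exact tsum_congr fun h => (smul_mul_assoc _ _ _).symm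
  map_star' f := by
    rw [tsum_star]
    let E : RngFib (SingleObj.star Γ) ≃ RngFib (SingleObj.star Γ) :=
      { toFun := fun h => ⟨SingleObj.star Γ, (arrTo h.arr)⁻¹⟩
        invFun := fun h => ⟨SingleObj.star Γ, (arrTo h.arr)⁻¹⟩
        left_inv := fun h => by
          obtain ⟨⟨⟩, h⟩ := h; exact congrArg (Sigma.mk _) (inv_inv (show Γ from h))
        right_inv := fun h => by
          obtain ⟨⟨⟩, h⟩ := h; exact congrArg (Sigma.mk _) (inv_inv (show Γ from h)) }
    refine (E.tsum_eq _).symm.trans (tsum_congr fun h => ?_)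
    obtain ⟨⟨⟩, h⟩ := h
    rw [star_smul, ConvAlg.star_fn]
    congr 1
    · change starRingEnd ℂ (f.fn (arrOf (h : Γ)⁻¹⁻¹)) = starRingEnd ℂ (f.fn (arrOf (h : Γ)))
      rw [inv_inv]
    · change ((π (h : Γ)⁻¹ : unitary (H →L[ℂ] H)) : H →L[ℂ] H) = star (π (h : Γ) : H →L[ℂ] H)
      rw [map_inv]; rfl

/-- The extension of a unitary representation of a discrete group to its full `C*`-algebra. -/
def URep.toCStar {H : Type v} [NormedAddCommGroup H] [InnerProductSpace ℂ H] [CompleteSpace H]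
    (π : URep Γ H) : CStarRep (SingleObj Γ) H := π.toConv.toCStar

end group

/-! ### Direct sums, kernels and weak containment -/

section representations

variable {A : Type*} [NonUnitalCStarAlgebra A]

/-- The direct sum of a family of representations of a `C*`-algebra on Hilbert spaces. -/
def dirSum {J : Type*} {H : J → Type*} [∀ j, NormedAddCommGroup (H j)]
    [∀ j, InnerProductSpace ℂ (H j)] [∀ j, CompleteSpace (H j)]
    (σ : ∀ j, A →⋆ₙₐ[ℂ] (H j →L[ℂ] H j)) : A →⋆ₙₐ[ℂ] (lp H 2 →L[ℂ] lp H 2) where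
  toFun a := lp.mapCLM 2 (fun j => σ j a) (norm_nonneg a)
    fun j => NonUnitalStarAlgHom.norm_apply_le (σ j) a
  map_smul' c a := by ext ξ j; simp
  map_zero' := by ext ξ j; simp
  map_add' a b := by ext ξ j; simp
  map_mul' a b := by ext ξ j; simp
  map_star' a := by
    refine (ContinuousLinearMap.eq_adjoint_iff _ _).2 fun ξ η => ?_
    rw [lp.inner_eq_tsum, lp.inner_eq_tsum]
    refine tsum_congr fun j => ?_
    simp [map_star, ContinuousLinearMap.star_eq_adjoint, ContinuousLinearMap.adjoint_inner_left]

/-- Weak containment `σ ≺ τ` of representations of a `C*`-algebra: `ker τ ⊆ ker σ`. -/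
def WeaklyContained {H₁ H₂ : Type*} [NormedAddCommGroup H₁] [InnerProductSpace ℂ H₁]
    [CompleteSpace H₁] [NormedAddCommGroup H₂] [InnerProductSpace ℂ H₂] [CompleteSpace H₂]
    (σ : A →⋆ₙₐ[ℂ] (H₁ →L[ℂ] H₁)) (τ : A →⋆ₙₐ[ℂ] (H₂ →L[ℂ] H₂)) : Prop :=
  TwoSidedIdeal.ker τ ≤ TwoSidedIdeal.ker σ

/-- A maximal ideal of a `C*`-algebra, that is, a maximal proper closed two-sided ideal. -/
def IsMaximalIdeal (M : TwoSidedIdeal A) : Prop :=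
  IsClosed (M : Set A) ∧ M ≠ ⊤ ∧ ∀ J : TwoSidedIdeal A, IsClosed (J : Set A) → M < J → J = ⊤

/-- An ideal which is the intersection of a (possibly empty) family of maximal ideals. -/
def IsIntersectionOfMaximalIdeals (I : TwoSidedIdeal A) : Prop :=
  ∃ 𝓜 : Set (TwoSidedIdeal A), (∀ M ∈ 𝓜, IsMaximalIdeal M) ∧ I = sInf 𝓜

/-- A state on a `C*`-algebra: a positive linear functional of norm one. -/
def IsState (φ : A →L[ℂ] ℂ) : Prop := (∀ a, 0 ≤ φ (star a * a)) ∧ ‖φ‖ = 1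

end representations

/-! ### Unitary representations and states of discrete groups -/

section groupReps

variable {Γ : Type v} [Group Γ]

/-- A state on the full `C*`-algebra of a discrete group. -/
abbrev State (Γ : Type v) [Group Γ] := {φ : GroupCStar Γ →L[ℂ] ℂ // IsState φ}

/-- The value `φ(g)` of a state at a group element. -/
def State.evalAt (φ : State Γ) (g : Γ) : ℂ := φ.1 (gElt g)

instance : PartialOrder (GroupCStar Γ) := CStarAlgebra.spectralOrder _
instance : StarOrderedRing (GroupCStar Γ) := CStarAlgebra.spectralOrderedRing _

/-- A state as a positive linear map. -/
def State.positive (φ : State Γ) : GroupCStar Γ →ₚ[ℂ] ℂ :=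
  PositiveLinearMap.mk₀ φ.1.toLinearMap fun a ha => by
    obtain ⟨b, rfl⟩ := CStarAlgebra.nonneg_iff_eq_star_mul_self.1 ha
    exact φ.2.1 b

/-- The Hilbert space of the GNS representation of a state. -/
def State.GNSSpace (φ : State Γ) : Type v := φ.positive.GNS

instance (φ : State Γ) : NormedAddCommGroup φ.GNSSpace :=
  inferInstanceAs (NormedAddCommGroup φ.positive.GNS)
instance (φ : State Γ) : InnerProductSpace ℂ φ.GNSSpace :=
  inferInstanceAs (InnerProductSpace ℂ φ.positive.GNS)
instance (φ : State Γ) : CompleteSpace φ.GNSSpace :=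
  inferInstanceAs (CompleteSpace φ.positive.GNS)

/-- The GNS representation `π_φ` of a state `φ` on `C*(Γ)`, as a unitary representation of `Γ`. -/
def State.gns (φ : State Γ) : URep Γ φ.GNSSpace :=
  urepOf (H := φ.GNSSpace) φ.positive.gnsNonUnitalStarAlgHom (by
    change φ.positive.gnsNonUnitalStarAlgHom (gElt 1) = 1
    ext ξ
    induction ξ using UniformSpace.Completion.induction_on with
    | hp => exact isClosed_eq (ContinuousLinearMap.continuous _) continuous_id
    | ih ξ =>
      rw [PositiveLinearMap.gnsNonUnitalStarAlgHom_apply_coe,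
        PositiveLinearMap.leftMulMapPreGNS_apply]
      refine congrArg _ ?_
      exact congrArg φ.positive.toPreGNS (gElt_one_mul _))

variable {H : Type v} [NormedAddCommGroup H] [InnerProductSpace ℂ H] [CompleteSpace H]

/-- The kernel of a unitary representation of a group, an ideal of its full `C*`-algebra. -/
def URep.ker (π : URep Γ H) : TwoSidedIdeal (GroupCStar Γ) := TwoSidedIdeal.ker π.toCStar

/-- A state on `C*_π(Γ) = C*(Γ) / ker π`, viewed as a state on `C*(Γ)` which vanishes on `ker π`. -/
def State.IsOn (φ : State Γ) (π : URep Γ H) : Prop := ∀ a ∈ π.ker, φ.1 a = 0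

/-- The restriction of a unitary representation to a subgroup. -/
def URep.res (π : URep Γ H) (S : Subgroup Γ) : URep S H := π.comp S.subtype

/-- A unitary representation is irreducible if it is nonzero and has no nontrivial closed invariant
subspaces. -/
def URep.IsIrreducible (π : URep Γ H) : Prop :=
  Nontrivial H ∧ ∀ V : Submodule ℂ H, IsClosed (V : Set H) →
    (∀ g : Γ, ∀ ξ ∈ V, (π g : H →L[ℂ] H) ξ ∈ V) → V = ⊥ ∨ V = ⊤

open scoped Pointwise in
open scoped Classical in
/-- A discrete group is amenable if it satisfies the Følner condition. -/
def IsAmenable (Γ : Type*) [Group Γ] : Prop :=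
  ∀ (E : Finset Γ) (ε : ℝ), 0 < ε → ∃ F : Finset Γ, F.Nonempty ∧
    ∀ g ∈ E, ((symmDiff (g • F) F).card : ℝ) ≤ ε * F.card

/-- The inclusion of a subgroup `S` of `Γ` into the isotropy group `Γ` of the one-object groupoid. -/
def groupIncl (S : Subgroup Γ) :
    S →* @End (SingleObj Γ) (SingleObj.groupoid (G := Γ)).toCategory.toCategoryStruct (SingleObj.star Γ) where
  toFun s := (s : Γ)
  map_one' := rfl
  map_mul' _ _ := rfl

lemma groupIncl_injective (S : Subgroup Γ) : Function.Injective (groupIncl S) :=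
  Subtype.val_injective

/-- For a subgroup `S` of a discrete group `Γ`, the representation of `C*(Γ)` induced from a unitary
representation of `S`. -/
def groupIndRep (S : Subgroup Γ) (π : URep S H) :
    GroupCStar Γ →⋆ₙₐ[ℂ] (IndSpace (groupIncl S) π (groupIncl_injective S) →L[ℂ]
      IndSpace (groupIncl S) π (groupIncl_injective S)) :=
  indRep (X := SingleObj Γ) (groupIncl S) (groupIncl_injective S) π

end groupReps

/-! ### Isotropy groups, the space of subgroups, and state limits -/

section isotropy

variable {X : Type u} [Groupoid.{u} X]

/-- The unitary representation `π^g(h) = π(g⁻¹ h g)` of the isotropy group at the range of `g`, where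
`π` is a unitary representation of the isotropy group at the source of `g`. -/
def conjRep {y z : X} (g : y ⟶ z) {H : Type u} [NormedAddCommGroup H] [InnerProductSpace ℂ H]
    [CompleteSpace H] (π : URep (End y) H) : URep (End z) H where
  toFun h := π (show End y from g ≫ (show z ⟶ z from h) ≫ Groupoid.inv g)
  map_one' := by
    refine Eq.trans (congrArg π ?_) (map_one π)
    change g ≫ 𝟙 z ≫ Groupoid.inv g = 𝟙 y
    simp
  map_mul' h k := by
    rw [← map_mul]
    refine congrArg π ?_
    change g ≫ ((show z ⟶ z from k) ≫ (show z ⟶ z from h)) ≫ Groupoid.inv g =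
      (g ≫ (show z ⟶ z from k) ≫ Groupoid.inv g) ≫ (g ≫ (show z ⟶ z from h) ≫ Groupoid.inv g)
    simp

/-- An element of an isotropy group, as an arrow. -/
def isoArr {x : X} (g : End x) : Arr X := ⟨x, x, g⟩

/-- A subgroup of a groupoid: a subgroup of one of the isotropy groups. -/
structure GpdSub (X : Type u) [Groupoid.{u} X] where
  /-- The unit. -/
  pt : X
  /-- The subgroup of the isotropy group at the unit. -/
  grp : Subgroup (End pt)

/-- The set of arrows belonging to a subgroup of a groupoid. -/
def GpdSub.arrows (T : GpdSub X) : Set (Arr X) := {a | ∃ g ∈ T.grp, a = isoArr g}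

/-- The isotropy group at `z`, as a subgroup of the groupoid. -/
def GpdSub.isotropy (z : X) : GpdSub X := ⟨z, ⊤⟩

/-- The Fell topology on the space of subgroups of a topological groupoid. -/
instance [TopologicalSpace (Arr X)] : TopologicalSpace (GpdSub X) :=
  TopologicalSpace.generateFrom {V | ∃ (K : Set (Arr X)) (𝓤 : Set (Set (Arr X))), IsCompact K ∧
    𝓤.Finite ∧ (∀ U ∈ 𝓤, IsOpen U) ∧
    V = {T : GpdSub X | T.arrows ∩ K = ∅ ∧ ∀ U ∈ 𝓤, (T.arrows ∩ U).Nonempty}}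

variable [TopologicalSpace X] [TopologicalSpace (Arr X)] {x : X} {Y : Set X} {HY : Y → Type u}
  [∀ y, NormedAddCommGroup (HY y)] [∀ y, InnerProductSpace ℂ (HY y)] [∀ y, CompleteSpace (HY y)]

/-- The pair `(S, ω)` is a limit of the isotropy data: there are a net `(y_i)` in `Y`, arrows
`g_i : y_i ⟶ z_i` and states `ω_i` on `C*_{π_{y_i}^{g_i}}` of the isotropy groups at `z_i = r(g_i)`
such that `z_i → x`, the isotropy groups at `z_i` converge to `S` in the Fell topology and, for every
`s ∈ S`, the bisection `W_s` meets the isotropy group at `z_i` in exactly one element `h_{s,i}` for all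
`i` large enough, and `ω_i(h_{s,i}) → ω(s)`. -/
def IsStateLimit (W : End x → Set (Arr X)) (πY : ∀ y : Y, URep (End (y : X)) (HY y))
    (S : Subgroup (End x)) (ω : State S) : Prop :=
  ∃ (I : Type u) (_ : Preorder I) (_ : IsDirected I (· ≤ ·)) (_ : Nonempty I)
    (y : I → Y) (z : I → X) (g : ∀ i, (y i : X) ⟶ z i) (ν : ∀ i, State (End (z i))),
    (∀ i, (ν i).IsOn (conjRep (g i) (πY (y i)))) ∧
    Tendsto z atTop (𝓝 x) ∧
    Tendsto (fun i => GpdSub.isotropy (z i)) atTop (𝓝 (⟨x, S⟩ : GpdSub X)) ∧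
    ∀ s : S, ∀ ε : ℝ, 0 < ε → ∀ᶠ i in atTop, ∃ h : End (z i),
      W s ∩ (GpdSub.isotropy (z i)).arrows = {isoArr h} ∧ ‖(ν i).evalAt h - ω.evalAt s‖ < ε

/-- The approximation property of a unitary representation `ρ` of a subgroup `Δ` of the isotropy group
at `x`: there are a state `φ` on `C*_ρ(Δ)`, a net `(y_i)` in `Y`, arrows `g_i : y_i ⟶ z_i` and states
`ν_i` on `C*_{π_{y_i}^{g_i}}` of the isotropy groups at `z_i = r(g_i)` such that `z_i → x` and, for all
`ε > 0` and `g ∈ Δ`, eventually `W_g` either does not meet the isotropy group at `z_i`, or meets it in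
exactly one element `h`, and then `|φ(g) - ν_i(h)| < ε`. -/
def HasStateApproximation (W : End x → Set (Arr X)) (πY : ∀ y : Y, URep (End (y : X)) (HY y))
    (Δ : Subgroup (End x)) {L : Type u} [NormedAddCommGroup L] [InnerProductSpace ℂ L]
    [CompleteSpace L] (ρ : URep Δ L) : Prop :=
  ∃ φ : State Δ, φ.IsOn ρ ∧
  ∃ (I : Type u) (_ : Preorder I) (_ : IsDirected I (· ≤ ·)) (_ : Nonempty I)
    (y : I → Y) (z : I → X) (g : ∀ i, (y i : X) ⟶ z i) (ν : ∀ i, State (End (z i))),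
    (∀ i, (ν i).IsOn (conjRep (g i) (πY (y i)))) ∧
    Tendsto z atTop (𝓝 x) ∧
    ∀ ε : ℝ, 0 < ε → ∀ s : Δ, ∃ i₀, ∀ i, i₀ ≤ i →
      W s ∩ (GpdSub.isotropy (z i)).arrows = ∅ ∨
      ∃ h : End (z i), W s ∩ (GpdSub.isotropy (z i)).arrows = {isoArr h} ∧
        ‖φ.evalAt s - (ν i).evalAt h‖ < ε

variable [EtaleGroupoid X] [T2Space (Arr X)] [LocallyCompactSpace (Arr X)]

/-- The representation of `C*(𝒢)` induced from a unitary representation of the isotropy group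
at `x`. -/
def isoIndRep {H : Type u} [NormedAddCommGroup H] [InnerProductSpace ℂ H] [CompleteSpace H]
    (π : URep (End x) H) :=
  indRep (X := X) (MonoidHom.id (End x)) Function.injective_id π

end isotropy

end

/-!
Weak containment of induced representations of an étale groupoid in terms of limits of states on
isotropy groups.

The bridge between the groupoid and its isotropy groups is the contraction
`resCStar z : C*(𝒢) → C*(𝒢^z_z)` which extends the restriction of functions. For `g : y ⟶ z` the matrix
coefficients of `Ind π_y` at vectors supported on the coset of `g` are those of `π_y^g ∘ resCStar z`
(`inner_isoIndRep_point`), and such vectors are total.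

*Weak containment gives state approximations* (`exists_close_states`). Let `ρ ≺ π|_Δ`. If on some
neighbourhood of `x` no state on any `π_y^g` were close, on the finite subset `E` of `Δ` in question, to a
state on `ρ`, then finitely many linear functionals would separate the two compact families of values
(`exists_separating_family`). Replacing group elements `s` by functions supported in the bisections `W s`
turns these functionals into self-adjoint functions `a` on `𝒢` with `0 ≤ a ≤ r < 1` in `ρ`, while over every
unit `z` near `x` one of them satisfies `a ≥ 1` and preserves the fibers over `z`. Since the isotropy groups
near `x` may miss some of the bisections, the functionals depend on which elements of `E` survive at `z`;
this is why finitely many functions are used simultaneously. For a cut-off function `q` at `x` this gives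
`‖q ξ‖² ≤ ∑ ‖aⁿ ξ‖²` in all the `Ind π_y`. Such an inequality is inherited by weakly contained
representations (`norm_sq_le_sum_of_ker_le`), hence by `Ind π` and by `ρ`, where `aⁿ → 0`.

*State approximations give state limits.* Along an ultrafilter the isotropy groups converge to a
subgroup `S` and the states converge on it (`HasStateApproximation.exists_isStateLimit`); the limit agrees
with a state `φ` on `C*_ρ(Δ)` on `S ∩ Δ`. Hence the product of the conjugate of `φ` with the coefficient of
`Ind π_ω` at its canonical vector is the nonnegative function `1_S |φ|²`. For an amenable group such a pair
cannot be separated: by Kesten's criterion (`IsAmenable.exists_almost_invariant`) the tensor product of one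
representation with the conjugate of the other has almost invariant vectors, because its averages over
finite sets dominate, coefficient by coefficient, those of the regular representation. Therefore no element
acts as almost `0` in the first and as almost `1` in the second (`IsAmenable.not_norm_sum_le`). When `ker ρ`
is maximal, this forces `ρ ≺ Ind π_ω|_Δ` (`IsAmenable.ker_le_of_isMaximalIdeal`). As `ker π|_{Γ k}` is an
intersection of maximal ideals, each of which is the kernel of an irreducible representation
(`IsMaximalIdeal.exists_irreducible`), and as the `Γ k` exhaust the finite subsets, `π` is weakly contained
in the sum over the state limits.

*State limits give weak containment* (`weaklyContained_isoIndRep`). For a function `f` on `𝒢` the values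
`ω_i(f|)` on the isotropy groups converge to `∑_{s ∈ S} f(s) ω(s)`, so an element of `C*(𝒢)` which vanishes
in all the `Ind π_y` restricts to an element of `C*(𝒢^x_x)` which vanishes in the representation induced
from every state limit (`IsStateLimit.toCStar_ind_eq_zero`), hence in `π`, and therefore it vanishes
in `Ind π`.

If `ker π` is maximal, the approximation argument with `Δ = 𝒢^x_x` and `ρ = π` produces a state limit on
`π|_S`. Conversely a state on `C*_{π|S}(S)` extends to a state on `C*_π(𝒢^x_x)`
(`State.exists_extension`), and the amenability argument applies to this single state limit.
-/

noncomputable section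

/-! ### Kernels and norms of representations -/

section kernels

variable {A B C : Type*} [NonUnitalCStarAlgebra A] [NonUnitalCStarAlgebra B]
  [NonUnitalCStarAlgebra C]

lemma continuous_rep (σ : A →⋆ₙₐ[ℂ] B) : Continuous σ :=
  (AddMonoidHomClass.lipschitz_of_bound σ 1
    (by simpa using NonUnitalStarAlgHom.norm_apply_le σ)).continuous

/-- If the kernel of `τ` is contained in the kernel of `σ`, then `σ` is dominated in norm by `τ`. With
`b = a⋆ a` and `g` the truncation at height `‖τ b‖`, the element `b - g(b)` lies in the kernel
of `τ`, hence `σ b = g(σ b)`. -/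
theorem norm_apply_le_of_ker_le (σ : A →⋆ₙₐ[ℂ] B) (τ : A →⋆ₙₐ[ℂ] C)
    (h : ∀ a, τ a = 0 → σ a = 0) (a : A) : ‖σ a‖ ≤ ‖τ a‖ := by
  have hσc := continuous_rep σ
  have hτc := continuous_rep τ
  have key : ∀ b : A, IsSelfAdjoint b → ‖σ b‖ ≤ ‖τ b‖ := by
    intro b hb
    let r := ‖τ b‖
    have hr : 0 ≤ r := norm_nonneg _
    let g : ℝ → ℝ := fun t => max (-r) (min t r)
    have hg : Continuous g := by fun_prop
    have hg0 : g 0 = 0 := by simp [g, hr]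
    have h1 : τ (b - cfcₙ g b) = 0 := by
      rw [map_sub, NonUnitalStarAlgHomClass.map_cfcₙ τ g b hg.continuousOn hg0 hτc hb
        (hb.map τ)]
      have : cfcₙ g (τ b) = cfcₙ (id : ℝ → ℝ) (τ b) := by
        refine cfcₙ_congr (p := IsSelfAdjoint) fun t ht => ?_
        have h2 : |t| ≤ r := by
          have := NonUnitalIsometricContinuousFunctionalCalculus.norm_quasispectrum_le
            (p := IsSelfAdjoint) (τ b) ht (hb.map τ)
          simpa using this
        rw [abs_le] at h2
        simp [g, h2.1, h2.2]
      rw [this, cfcₙ_id (p := IsSelfAdjoint) ℝ (τ b) (ha := hb.map τ), sub_self]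
    have h2 := h _ h1
    rw [map_sub, NonUnitalStarAlgHomClass.map_cfcₙ σ g b hg.continuousOn hg0 hσc hb
        (hb.map σ), sub_eq_zero] at h2
    rw [h2]
    refine norm_cfcₙ_le (p := IsSelfAdjoint) fun t _ => ?_
    rw [Real.norm_eq_abs, abs_le]
    exact ⟨le_max_left _ _, max_le (by linarith) (min_le_right _ _)⟩
  have := key (star a * a) (IsSelfAdjoint.star_mul_self a)
  rw [map_mul, map_mul, map_star, map_star, CStarRing.norm_star_mul_self,
    CStarRing.norm_star_mul_self] at this
  exact (mul_self_le_mul_self_iff (norm_nonneg _) (norm_nonneg _)).2 this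

theorem nonneg_of_ker_le [PartialOrder B] [StarOrderedRing B] [PartialOrder C] [StarOrderedRing C]
    [NonnegSpectrumClass ℝ B] [NonnegSpectrumClass ℝ C]
    (σ : A →⋆ₙₐ[ℂ] B) (τ : A →⋆ₙₐ[ℂ] C)
    (h : ∀ a, τ a = 0 → σ a = 0) {a : A} (ha : IsSelfAdjoint a) (h0 : 0 ≤ τ a) : 0 ≤ σ a := by
  have hσc := continuous_rep σ
  have hτc := continuous_rep τ
  have hf : Continuous fun t : ℝ => t⁻ := by simp only [negPart_def]; fun_prop
  have h1 : τ a⁻ = 0 := by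
    rw [CFC.negPart_def, NonUnitalStarAlgHomClass.map_cfcₙ τ _ a hf.continuousOn (by simp) hτc ha
        (ha.map τ), ← CFC.negPart_def]
    exact (CFC.negPart_eq_zero_iff _ (ha.map τ)).2 h0
  have h2 := h _ h1
  rw [CFC.negPart_def, NonUnitalStarAlgHomClass.map_cfcₙ σ _ a hf.continuousOn (by simp) hσc ha
        (ha.map σ), ← CFC.negPart_def] at h2
  exact (CFC.negPart_eq_zero_iff _ (ha.map σ)).1 h2

lemma WeaklyContained.apply_eq_zero {H₁ H₂ : Type*} [NormedAddCommGroup H₁] [InnerProductSpace ℂ H₁]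
    [CompleteSpace H₁] [NormedAddCommGroup H₂] [InnerProductSpace ℂ H₂] [CompleteSpace H₂]
    {σ : A →⋆ₙₐ[ℂ] (H₁ →L[ℂ] H₁)} {τ : A →⋆ₙₐ[ℂ] (H₂ →L[ℂ] H₂)} (h : WeaklyContained σ τ) (a : A)
    (ha : τ a = 0) : σ a = 0 :=
  (TwoSidedIdeal.mem_ker σ).1 (h ((TwoSidedIdeal.mem_ker τ).2 ha))

lemma weaklyContained_of_forall {H₁ H₂ : Type*} [NormedAddCommGroup H₁] [InnerProductSpace ℂ H₁]
    [CompleteSpace H₁] [NormedAddCommGroup H₂] [InnerProductSpace ℂ H₂] [CompleteSpace H₂]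
    {σ : A →⋆ₙₐ[ℂ] (H₁ →L[ℂ] H₁)} {τ : A →⋆ₙₐ[ℂ] (H₂ →L[ℂ] H₂)} (h : ∀ a, τ a = 0 → σ a = 0) :
    WeaklyContained σ τ := fun a ha =>
  (TwoSidedIdeal.mem_ker σ).2 (h a ((TwoSidedIdeal.mem_ker τ).1 ha))

lemma dirSum_apply {J : Type*} {H : J → Type*} [∀ j, NormedAddCommGroup (H j)]
    [∀ j, InnerProductSpace ℂ (H j)] [∀ j, CompleteSpace (H j)]
    (σ : ∀ j, A →⋆ₙₐ[ℂ] (H j →L[ℂ] H j)) (a : A) (ξ : lp H 2) (j : J) :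
    dirSum σ a ξ j = σ j a (ξ j) := rfl

open scoped Classical in
lemma dirSum_single {J : Type*} {H : J → Type*} [∀ j, NormedAddCommGroup (H j)]
    [∀ j, InnerProductSpace ℂ (H j)] [∀ j, CompleteSpace (H j)]
    (σ : ∀ j, A →⋆ₙₐ[ℂ] (H j →L[ℂ] H j)) (a : A) (j : J) (v : H j) :
    dirSum σ a (lp.single 2 j v) = lp.single 2 j (σ j a v) := by
  ext i
  rw [dirSum_apply]
  by_cases h : i = j
  · subst h; simp
  · simp [lp.single_apply, h]

lemma dirSum_eq_zero_iff {J : Type*} {H : J → Type*} [∀ j, NormedAddCommGroup (H j)]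
    [∀ j, InnerProductSpace ℂ (H j)] [∀ j, CompleteSpace (H j)]
    (σ : ∀ j, A →⋆ₙₐ[ℂ] (H j →L[ℂ] H j)) (a : A) : dirSum σ a = 0 ↔ ∀ j, σ j a = 0 := by
  classical
  constructor
  · intro h j
    ext v
    have h1 := congrArg (fun T : lp H 2 →L[ℂ] lp H 2 => T (lp.single 2 j v) j) h
    simpa [dirSum_apply] using h1
  · intro h
    ext ξ j
    rw [dirSum_apply, h]; rfl

end kernels

/-! ### Elements of finite support in the `C*`-algebra of a discrete group -/

section groupAlgebra

variable {Γ : Type v} [Group Γ]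

/-- The element `∑ c_g g` of `C*(Γ)` given by a finitely supported function. -/
def groupSum : (Γ →₀ ℂ) →ₗ[ℂ] GroupCStar Γ := Finsupp.linearCombination ℂ gElt

lemma groupSum_single (g : Γ) (z : ℂ) : groupSum (Finsupp.single g z) = z • gElt g :=
  Finsupp.linearCombination_single ..

open scoped Classical in
lemma toCompl_eq_groupSum (f : ConvAlg (SingleObj Γ)) :
    ∃ c : Γ →₀ ℂ, (∀ g, c g = f.fn (arrOf g)) ∧ PreCStarAlg.toCompl f = groupSum c := by
  have hfin : {g : Γ | f.fn (arrOf g) ≠ 0}.Finite := by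
    have := f.fibFin (SingleObj.star Γ)
    refine (this.image fun h : RngFib (SingleObj.star Γ) => arrTo h.arr).subset fun g hg => ?_
    exact ⟨⟨SingleObj.star Γ, g⟩, hg, rfl⟩
  let c : Γ →₀ ℂ := Finsupp.ofSupportFinite (fun g => f.fn (arrOf g)) hfin
  refine ⟨c, fun g => rfl, ?_⟩
  have h1 : f = c.sum fun g z => z • delta g := by
    ext a
    let ev : ConvAlg (SingleObj Γ) →+ ℂ := ⟨⟨fun f => f.fn a, rfl⟩, fun _ _ => rfl⟩
    have h2 : (c.sum fun g z => z • delta g).fn a = c.sum fun g z => (z • delta g).fn a :=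
      map_finsuppSum ev c _
    rw [h2, Finsupp.sum, Finset.sum_eq_single (arrTo a)]
    · rw [ConvAlg.smul_fn, delta_fn, if_pos rfl, mul_one]; rfl
    · intro b _ hb
      rw [ConvAlg.smul_fn, delta_fn, if_neg (Ne.symm hb), mul_zero]
    · intro h
      rw [ConvAlg.smul_fn, Finsupp.notMem_support_iff.1 h, zero_mul]
  let T : ConvAlg (SingleObj Γ) →ₗ[ℂ] GroupCStar Γ := ⟨⟨PreCStarAlg.toCompl,
    PreCStarAlg.toCompl_add⟩, PreCStarAlg.toCompl_smul⟩
  change T f = _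
  conv_lhs => rw [h1]
  rw [map_finsuppSum]
  simp only [map_smul]
  rfl

lemma denseRange_groupSum : DenseRange (groupSum : (Γ →₀ ℂ) → GroupCStar Γ) := by
  refine (PreCStarAlg.denseRange_toCompl (A := ConvAlg (SingleObj Γ))).mono ?_
  rintro _ ⟨f, rfl⟩
  obtain ⟨c, -, h⟩ := toCompl_eq_groupSum f
  exact ⟨c, h.symm⟩

lemma groupCStar_induction {p : GroupCStar Γ → Prop} (a : GroupCStar Γ) (hp : IsClosed {a | p a})
    (h : ∀ c, p (groupSum c)) : p a :=
  denseRange_groupSum.induction_on a hp h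

/-- Continuous linear maps on `C*(Γ)` are determined by their values on group elements. -/
lemma groupCStar_clm_ext {E : Type*} [NormedAddCommGroup E] [NormedSpace ℂ E]
    {S T : GroupCStar Γ → E} (hS : Continuous S) (hT : Continuous T) (hSl : IsLinearMap ℂ S)
    (hTl : IsLinearMap ℂ T) (h : ∀ g, S (gElt g) = T (gElt g)) (a : GroupCStar Γ) : S a = T a := by
  refine groupCStar_induction (p := fun a => S a = T a) a (isClosed_eq hS hT) fun c => ?_
  induction c using Finsupp.induction_linear with
  | zero => rw [map_zero]; exact hSl.map_zero.trans hTl.map_zero.symm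
  | add f g hf hg => rw [map_add, hSl.map_add, hTl.map_add, hf, hg]
  | single g z => rw [groupSum_single, hSl.map_smul, hTl.map_smul, h]

lemma mul_gElt_one (a : GroupCStar Γ) : a * gElt 1 = a := by
  have h := congrArg star (gElt_one_mul (star a))
  rwa [star_mul, star_star, star_gElt, inv_one] at h

lemma norm_gElt_le (g : Γ) : ‖gElt g‖ ≤ 1 := by
  have h : ‖(gElt g : GroupCStar Γ)‖ * ‖(gElt g : GroupCStar Γ)‖ = ‖(gElt 1 : GroupCStar Γ)‖ := by
    rw [← CStarRing.norm_star_mul_self, star_gElt, gElt_mul, inv_mul_cancel]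
  have h1 : ‖(gElt 1 : GroupCStar Γ)‖ * ‖(gElt 1 : GroupCStar Γ)‖ = ‖(gElt 1 : GroupCStar Γ)‖ := by
    rw [← CStarRing.norm_star_mul_self, star_gElt, gElt_mul, inv_mul_cancel]
  have h2 := norm_nonneg (gElt 1 : GroupCStar Γ)
  have h3 := norm_nonneg (gElt g : GroupCStar Γ)
  have h4 : ‖(gElt 1 : GroupCStar Γ)‖ ≤ 1 := by
    by_contra hc
    nlinarith
  nlinarith

variable {H : Type*} [NormedAddCommGroup H] [InnerProductSpace ℂ H] [CompleteSpace H]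

/-- The operator `∑ c_g π(g)` given by a finitely supported function. -/
def URep.sum (π : URep Γ H) : (Γ →₀ ℂ) →ₗ[ℂ] (H →L[ℂ] H) :=
  Finsupp.linearCombination ℂ fun g => (π g : H →L[ℂ] H)

lemma URep.sum_single (π : URep Γ H) (g : Γ) (z : ℂ) :
    π.sum (Finsupp.single g z) = z • (π g : H →L[ℂ] H) :=
  Finsupp.linearCombination_single ..

lemma URep.toConv_delta (π : URep Γ H) (g : Γ) : π.toConv (delta g) = π g := by
  change ∑' h : RngFib (SingleObj.star Γ), (delta g).fn h.arr • (π (arrTo h.arr) : H →L[ℂ] H) = _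
  rw [tsum_eq_single ⟨SingleObj.star Γ, g⟩]
  · have h1 : (delta g).fn (RngFib.arr (y := SingleObj.star Γ) ⟨SingleObj.star Γ, g⟩) = 1 :=
      if_pos rfl
    rw [h1, one_smul]; rfl
  · rintro ⟨⟨⟩, h⟩ hne
    have : (delta g).fn (RngFib.arr (y := SingleObj.star Γ) ⟨SingleObj.star Γ, h⟩) = 0 :=
      if_neg fun h' => hne (by subst h'; rfl)
    rw [show (RngFib.arr (y := SingleObj.star Γ) ⟨PUnit.unit, h⟩) =
      RngFib.arr (y := SingleObj.star Γ) ⟨SingleObj.star Γ, h⟩ from rfl, this, zero_smul]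

/-- A representation of `C*(Γ)` is determined on finitely supported elements by its values on `Γ`. -/
lemma rep_groupSum (σ : GroupCStar Γ →⋆ₙₐ[ℂ] (H →L[ℂ] H)) (h1 : σ (gElt 1) = 1) (c : Γ →₀ ℂ) :
    σ (groupSum c) = (urepOf σ h1).sum c := by
  rw [groupSum, URep.sum, Finsupp.linearCombination_apply, Finsupp.linearCombination_apply,
    map_finsuppSum]
  exact Finsupp.sum_congr fun g _ => map_smul σ _ _

end groupAlgebra

section groupRep

variable {Γ : Type v} [Group Γ]
variable {H : Type v} [NormedAddCommGroup H] [InnerProductSpace ℂ H] [CompleteSpace H]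

lemma URep.toCStar_gElt (π : URep Γ H) (g : Γ) : π.toCStar (gElt g) = π g :=
  (PreCStarAlg.extend_toCompl π.toConv (fun f => ConvAlg.le_repNorm f π.toConv) (delta g)).trans
    (π.toConv_delta g)

lemma URep.toCStar_one (π : URep Γ H) : π.toCStar (gElt 1) = 1 := by
  rw [π.toCStar_gElt, map_one]; rfl

lemma URep.urepOf_toCStar (π : URep Γ H) : urepOf π.toCStar π.toCStar_one = π := by
  ext1 g; exact Subtype.ext (π.toCStar_gElt g)

lemma URep.toCStar_groupSum (π : URep Γ H) (c : Γ →₀ ℂ) : π.toCStar (groupSum c) = π.sum c := by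
  rw [rep_groupSum _ π.toCStar_one, π.urepOf_toCStar]

lemma toCStar_urepOf (σ : GroupCStar Γ →⋆ₙₐ[ℂ] (H →L[ℂ] H)) (h1 : σ (gElt 1) = 1)
    (a : GroupCStar Γ) : (urepOf σ h1).toCStar a = σ a :=
  groupCStar_clm_ext (continuous_rep _) (continuous_rep _) ⟨map_add _, map_smul _⟩
    ⟨map_add _, map_smul _⟩ (fun g => URep.toCStar_gElt _ g) a

lemma URep.norm_toCStar_le (π : URep Γ H) (a : GroupCStar Γ) : ‖π.toCStar a‖ ≤ ‖a‖ :=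
  NonUnitalStarAlgHom.norm_apply_le _ a

lemma URep.mem_ker (π : URep Γ H) (a : GroupCStar Γ) : a ∈ π.ker ↔ π.toCStar a = 0 :=
  TwoSidedIdeal.mem_ker _

lemma URep.isClosed_ker (π : URep Γ H) : IsClosed (π.ker : Set (GroupCStar Γ)) := by
  have : (π.ker : Set (GroupCStar Γ)) = π.toCStar ⁻¹' {0} := by
    ext a; exact π.mem_ker a
  rw [this]
  exact isClosed_singleton.preimage (continuous_rep _)

lemma URep.inner_apply_apply (π : URep Γ H) (g : Γ) (ξ η : H) :
    ⟪(π g : H →L[ℂ] H) ξ, (π g : H →L[ℂ] H) η⟫_ℂ = ⟪ξ, η⟫_ℂ :=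
  ContinuousLinearMap.inner_map_map_of_mem_unitary (π g).2 ξ η

lemma URep.norm_apply (π : URep Γ H) (g : Γ) (ξ : H) : ‖(π g : H →L[ℂ] H) ξ‖ = ‖ξ‖ :=
  ContinuousLinearMap.norm_map_of_mem_unitary (π g).2 ξ

lemma URep.mul_apply (π : URep Γ H) (g h : Γ) (ξ : H) :
    (π (g * h) : H →L[ℂ] H) ξ = (π g : H →L[ℂ] H) ((π h : H →L[ℂ] H) ξ) := by
  rw [map_mul]; rfl

lemma URep.one_apply (π : URep Γ H) (ξ : H) : (π 1 : H →L[ℂ] H) ξ = ξ := by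
  rw [map_one]; rfl

lemma URep.adjoint_apply (π : URep Γ H) (g : Γ) (ξ η : H) :
    ⟪(π g : H →L[ℂ] H) ξ, η⟫_ℂ = ⟪ξ, (π g⁻¹ : H →L[ℂ] H) η⟫_ℂ := by
  rw [← π.inner_apply_apply g⁻¹, ← π.mul_apply, inv_mul_cancel, π.one_apply]

end groupRep

/-! ### States on the `C*`-algebra of a discrete group -/

section states

variable {Γ : Type v} [Group Γ]

/-- The normed ring structure of `C*(Γ)`, with its unit. -/
abbrev groupCStarRing (Γ : Type v) [Group Γ] : NormedRing (GroupCStar Γ) :=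
  { (inferInstance : NonUnitalNormedRing (GroupCStar Γ)) with
    one := gElt 1
    one_mul := gElt_one_mul
    mul_one := mul_gElt_one }

/-- The full `C*`-algebra of a discrete group as a unital `C*`-algebra. -/
abbrev groupCStarUnital (Γ : Type v) [Group Γ] : CStarAlgebra (GroupCStar Γ) :=
  let R := groupCStarRing Γ
  let _ : Algebra ℂ (GroupCStar Γ) :=
    Algebra.ofModule (fun z a b => smul_mul_assoc z a b) (fun z a b => mul_smul_comm z a b)
  { (inferInstance : NonUnitalCStarAlgebra (GroupCStar Γ)), R,
    (inferInstance : Algebra ℂ (GroupCStar Γ)) with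
    norm_smul_le := norm_smul_le }

lemma norm_gElt_one_sub_le {a : GroupCStar Γ} (ha : ‖a‖ ≤ 1) : ‖gElt 1 - star a * a‖ ≤ 1 := by
  let _ := groupCStarUnital Γ
  have h0 : (0 : GroupCStar Γ) ≤ star a * a := star_mul_self_nonneg a
  have h1 : star a * a ≤ 1 := by
    rw [← CStarAlgebra.norm_le_one_iff_of_nonneg _ h0, CStarRing.norm_star_mul_self]
    exact mul_le_one₀ ha (norm_nonneg _) ha
  rw [show (gElt 1 : GroupCStar Γ) = 1 from rfl, CStarAlgebra.norm_le_one_iff_of_nonneg _ (sub_nonneg.2 h1)]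
  exact sub_le_self _ h0

end states

section states

variable {Γ : Type v} [Group Γ]

/-- The unitary representation given by a homomorphism into bounded operators which is compatible with
adjoints. -/
def URep.ofHom {H : Type*} [NormedAddCommGroup H] [InnerProductSpace ℂ H] [CompleteSpace H]
    (V : Γ →* (H →L[ℂ] H)) (hV : ∀ g ξ η, ⟪V g ξ, η⟫_ℂ = ⟪ξ, V g⁻¹ η⟫_ℂ) : URep Γ H where
  toFun g := ⟨V g, by
    have h : star (V g) = V g⁻¹ := by
      rw [ContinuousLinearMap.star_eq_adjoint]
      refine ((ContinuousLinearMap.eq_adjoint_iff _ _).2 fun ξ η => ?_).symm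
      rw [hV, inv_inv]
    rw [Unitary.mem_iff, h, ← map_mul, ← map_mul, inv_mul_cancel, mul_inv_cancel, map_one]
    exact ⟨rfl, rfl⟩⟩
  map_one' := Subtype.ext (map_one V)
  map_mul' g h := Subtype.ext (map_mul V g h)

lemma URep.continuous_toCStar {H : Type v} [NormedAddCommGroup H] [InnerProductSpace ℂ H]
    [CompleteSpace H] (π : URep Γ H) : Continuous π.toCStar := continuous_rep _

lemma State.nonneg (φ : State Γ) (a : GroupCStar Γ) : 0 ≤ φ.1 (star a * a) := φ.2.1 a

lemma State.norm_le (φ : State Γ) (a : GroupCStar Γ) : ‖φ.1 a‖ ≤ ‖a‖ := by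
  have := φ.1.le_opNorm a
  rwa [φ.2.2, one_mul] at this

/-- The cyclic vector of the GNS representation. -/
def State.vec (φ : State Γ) : φ.GNSSpace :=
  ((φ.positive.toPreGNS (gElt 1) : φ.positive.PreGNS) : φ.positive.GNS)

lemma State.gns_toCStar (φ : State Γ) (a : GroupCStar Γ) :
    φ.gns.toCStar a = φ.positive.gnsNonUnitalStarAlgHom a := toCStar_urepOf _ _ a

lemma State.toCStar_vec (φ : State Γ) (a : GroupCStar Γ) :
    φ.gns.toCStar a φ.vec = ((φ.positive.toPreGNS a : φ.positive.PreGNS) : φ.positive.GNS) := by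
  rw [φ.gns_toCStar]
  refine Eq.trans (PositiveLinearMap.gnsNonUnitalStarAlgHom_apply_coe _) ?_
  refine congrArg _ ?_
  exact congrArg φ.positive.toPreGNS (mul_gElt_one a)

lemma State.inner_toCStar_vec (φ : State Γ) (a b : GroupCStar Γ) :
    ⟪φ.gns.toCStar a φ.vec, φ.gns.toCStar b φ.vec⟫_ℂ = φ.1 (star a * b) := by
  rw [φ.toCStar_vec, φ.toCStar_vec]
  exact UniformSpace.Completion.inner_coe _ _

lemma State.inner_vec (φ : State Γ) (a : GroupCStar Γ) :
    ⟪φ.vec, φ.gns.toCStar a φ.vec⟫_ℂ = φ.1 a := by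
  have h := φ.inner_toCStar_vec (gElt 1) a
  rwa [URep.toCStar_one, star_gElt, inv_one, gElt_one_mul] at h

lemma State.apply_one (φ : State Γ) : φ.1 (gElt 1) = 1 := by
  have e1 : (gElt 1 : GroupCStar Γ) = star (gElt 1) * gElt 1 := by
    rw [star_gElt, gElt_mul, inv_one, one_mul]
  have h0 : 0 ≤ φ.1 (gElt 1) := by rw [e1]; exact φ.nonneg _
  have h1 : ⟪φ.vec, φ.vec⟫_ℂ = φ.1 (gElt 1) := by
    have := φ.inner_vec (gElt 1)
    rwa [URep.toCStar_one] at this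
  have h2 : ‖φ.vec‖ ≤ 1 := by
    have h3 : ‖φ.vec‖ ^ 2 ≤ 1 := by
      rw [← inner_self_eq_norm_sq (𝕜 := ℂ), h1]
      exact (Complex.re_le_norm _).trans ((φ.norm_le _).trans (norm_gElt_le 1))
    nlinarith [norm_nonneg φ.vec]
  have h4 : ‖φ.1‖ ≤ ‖φ.vec‖ := by
    refine ContinuousLinearMap.opNorm_le_bound _ (norm_nonneg _) fun a => ?_
    rw [← φ.inner_vec a]
    refine (norm_inner_le_norm _ _).trans ?_
    gcongr
    refine ((φ.gns.toCStar a).le_opNorm _).trans ?_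
    exact (mul_le_of_le_one_right (norm_nonneg _) h2).trans (φ.gns.norm_toCStar_le a)
  rw [φ.2.2] at h4
  have h5 : ‖φ.vec‖ = 1 := le_antisymm h2 h4
  rw [← h1, inner_self_eq_norm_sq_to_K, h5]; simp

lemma State.norm_vec (φ : State Γ) : ‖φ.vec‖ = 1 := by
  have h1 : ⟪φ.vec, φ.vec⟫_ℂ = 1 := by
    have := φ.inner_vec (gElt 1)
    rwa [URep.toCStar_one, φ.apply_one] at this
  rw [inner_self_eq_norm_sq_to_K] at h1
  have h2 : ‖φ.vec‖ ^ 2 = 1 := Complex.ofReal_injective (by push_cast; exact h1)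
  nlinarith [norm_nonneg φ.vec]

lemma State.inner_vec_apply (φ : State Γ) (g : Γ) :
    ⟪φ.vec, (φ.gns g : φ.GNSSpace →L[ℂ] φ.GNSSpace) φ.vec⟫_ℂ = φ.evalAt g := by
  rw [← URep.toCStar_gElt, φ.inner_vec]; rfl

/-- A vector whose orbit spans a dense subspace: its orthogonal complement is trivial. -/
def URep.IsCyclic {H : Type*} [NormedAddCommGroup H] [InnerProductSpace ℂ H] [CompleteSpace H]
    (π : URep Γ H) (ζ : H) : Prop := ∀ ξ : H, (∀ g, ⟪ξ, (π g : H →L[ℂ] H) ζ⟫_ℂ = 0) → ξ = 0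

lemma State.isCyclic (φ : State Γ) : φ.gns.IsCyclic φ.vec := by
  intro ξ hξ
  have h : ∀ a, ⟪ξ, φ.gns.toCStar a φ.vec⟫_ℂ = 0 := by
    intro a
    refine groupCStar_clm_ext (S := fun a => ⟪ξ, φ.gns.toCStar a φ.vec⟫_ℂ) (T := fun _ => 0) ?_
      continuous_const ⟨fun a b => ?_, fun c a => ?_⟩ ⟨by simp, by simp⟩ (fun g => ?_) a
    · exact ((innerSL ℂ ξ).continuous).comp ((ContinuousLinearMap.apply ℂ _ φ.vec).continuous.comp
        φ.gns.continuous_toCStar)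
    · rw [map_add, add_apply, inner_add_right]
    · rw [map_smul, smul_apply, inner_smul_right, smul_eq_mul]
    · rw [URep.toCStar_gElt]; exact hξ g
  have h2 : ∀ η : φ.GNSSpace, ⟪ξ, η⟫_ℂ = 0 := by
    intro η
    refine UniformSpace.Completion.induction_on (α := φ.positive.PreGNS)
      (p := fun η : φ.GNSSpace => ⟪ξ, η⟫_ℂ = 0) η ?_ fun b => ?_
    · exact isClosed_eq (innerSL ℂ ξ).continuous continuous_const
    · have := h (φ.positive.ofPreGNS b)
      rwa [φ.toCStar_vec] at this
  exact inner_self_eq_zero.1 (h2 ξ)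

section rep

variable {H : Type v} [NormedAddCommGroup H] [InnerProductSpace ℂ H] [CompleteSpace H]

/-- An element of `C*(Γ)` whose matrix coefficients vanish on a cyclic orbit is in the kernel. -/
lemma URep.IsCyclic.toCStar_eq_zero {π : URep Γ H} {ζ : H} (hζ : π.IsCyclic ζ) {a : GroupCStar Γ}
    (h : ∀ g k, ⟪π.toCStar a ((π g : H →L[ℂ] H) ζ), (π k : H →L[ℂ] H) ζ⟫_ℂ = 0) :
    π.toCStar a = 0 := by
  have h1 : ∀ g, π.toCStar a ((π g : H →L[ℂ] H) ζ) = 0 := fun g => hζ _ (h g)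
  ext η
  refine inner_self_eq_zero.1 (?_ : ⟪π.toCStar a η, π.toCStar a η⟫_ℂ = 0)
  rw [← ContinuousLinearMap.adjoint_inner_right, ]
  have h3 : ContinuousLinearMap.adjoint (π.toCStar a) (π.toCStar a η) = 0 := by
    refine hζ _ fun g => ?_
    rw [ContinuousLinearMap.adjoint_inner_left, h1, inner_zero_right]
  rw [h3, inner_zero_right]

/-- A state that vanishes on the kernel of `π` gives a GNS representation which is weakly contained
in `π`. -/
lemma State.ker_le_of_isOn {φ : State Γ} {π : URep Γ H} (h : φ.IsOn π) : π.ker ≤ φ.gns.ker := by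
  intro a ha
  rw [URep.mem_ker]
  refine φ.isCyclic.toCStar_eq_zero fun g k => ?_
  rw [← URep.toCStar_gElt, ← URep.toCStar_gElt, ← mul_apply_eq_comp, ← map_mul,
    φ.inner_toCStar_vec]
  refine h _ ?_
  rw [URep.mem_ker] at ha ⊢
  simp [map_mul, map_star, ha]

lemma State.norm_apply_le_of_isOn {φ : State Γ} {π : URep Γ H} (h : φ.IsOn π) (a : GroupCStar Γ) :
    ‖φ.1 a‖ ≤ ‖π.toCStar a‖ := by
  have h1 : ‖φ.gns.toCStar a‖ ≤ ‖π.toCStar a‖ := by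
    refine norm_apply_le_of_ker_le _ _ (fun b hb => ?_) a
    exact (URep.mem_ker _ _).1 (State.ker_le_of_isOn h ((URep.mem_ker _ _).2 hb))
  rw [← φ.inner_vec]
  refine (norm_inner_le_norm _ _).trans ?_
  have h2 := (φ.gns.toCStar a).le_opNorm φ.vec
  rw [φ.norm_vec] at h2 ⊢
  linarith

lemma State.isOn_gns (φ : State Γ) : φ.IsOn φ.gns := by
  intro a ha
  rw [← φ.inner_vec, (URep.mem_ker _ _).1 ha, zero_apply, inner_zero_right]

/-- A contractive functional taking the value `1` at the unit is a state. -/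
lemma isState_of_norm_le_one {f : GroupCStar Γ →L[ℂ] ℂ} (hf : ‖f‖ ≤ 1) (h1 : f (gElt 1) = 1) :
    IsState f := by
  have hle : ∀ a, ‖f a‖ ≤ ‖a‖ := fun a =>
    (f.le_opNorm a).trans (mul_le_of_le_one_left (norm_nonneg _) hf)
  have hreal : ∀ b : GroupCStar Γ, star b = b → (f b).im = 0 := by
    intro b hb
    have key : ∀ t : ℝ, 2 * (f b).im * t ≤ ‖b‖ ^ 2 := by
      intro t
      let c : GroupCStar Γ := b + (Complex.I * t) • gElt 1
      have h2 : ‖c‖ ^ 2 ≤ ‖b‖ ^ 2 + t ^ 2 := by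
        have e1 : star c * c = b * b + ((t : ℂ) ^ 2) • gElt 1 := by
          simp only [c, star_add, star_smul, star_gElt, inv_one, hb, mul_add, add_mul,
            smul_mul_assoc, mul_smul_comm, gElt_one_mul, mul_gElt_one]
          have : star (Complex.I * (t : ℂ)) = -(Complex.I * t) := by
            simp
          have h3 : Complex.I * (t : ℂ) * -(Complex.I * t) = (t : ℂ) ^ 2 := by
            linear_combination (-(t : ℂ) ^ 2) * Complex.I_sq
          rw [this, smul_add, smul_smul, h3, neg_smul]
          abel
        rw [sq, ← CStarRing.norm_star_mul_self, e1]
        refine (norm_add_le _ _).trans ?_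
        refine add_le_add ((norm_mul_le _ _).trans (by rw [sq])) ?_
        rw [norm_smul]
        have : ‖((t : ℂ) ^ 2)‖ = t ^ 2 := by
          rw [norm_pow, Complex.norm_real, Real.norm_eq_abs, sq_abs]
        rw [this]
        exact mul_le_of_le_one_right (sq_nonneg t) (norm_gElt_le 1)
      have h3 : f c = f b + Complex.I * t := by
        simp only [c, map_add, map_smul, h1, smul_eq_mul, mul_one]
      have h4 : ‖f c‖ ^ 2 ≤ ‖c‖ ^ 2 := by
        gcongr; exact hle c
      rw [h3, ← Complex.normSq_eq_norm_sq, Complex.normSq_apply] at h4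
      simp only [Complex.add_re, Complex.mul_re, Complex.I_re, Complex.I_im, Complex.ofReal_re,
        Complex.ofReal_im, Complex.add_im, Complex.mul_im] at h4
      nlinarith [mul_self_nonneg (f b).re, mul_self_nonneg (f b).im]
    by_contra hne
    have := key ((‖b‖ ^ 2 + 1) / (2 * (f b).im))
    rw [mul_div_cancel₀ _ (mul_ne_zero two_ne_zero hne)] at this
    linarith
  have hpos1 : ∀ a : GroupCStar Γ, ‖a‖ ≤ 1 → 0 ≤ (f (star a * a)).re := by
    intro a ha
    have h2 := (hle _).trans (norm_gElt_one_sub_le ha)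
    rw [map_sub, h1] at h2
    have h3 := (Complex.re_le_norm _).trans h2
    rw [Complex.sub_re, Complex.one_re] at h3
    linarith
  refine ⟨fun a => ?_, le_antisymm hf ?_⟩
  · rw [Complex.le_def]
    refine ⟨?_, (hreal _ (by rw [star_mul, star_star])).symm⟩
    rw [Complex.zero_re]
    rcases eq_or_ne a 0 with rfl | hne
    · simp
    have hn : (0 : ℝ) < ‖a‖ := norm_pos_iff.2 hne
    have h2 := hpos1 (((‖a‖⁻¹ : ℝ) : ℂ) • a) (by
      rw [norm_smul, Complex.norm_real, norm_inv, norm_norm, inv_mul_cancel₀ hn.ne'])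
    rw [star_smul, smul_mul_assoc, mul_smul_comm, smul_smul, map_smul, smul_eq_mul] at h2
    have h3 : star ((‖a‖⁻¹ : ℝ) : ℂ) * ((‖a‖⁻¹ : ℝ) : ℂ) = ((‖a‖⁻¹ * ‖a‖⁻¹ : ℝ) : ℂ) := by
      rw [Complex.star_def, Complex.conj_ofReal, Complex.ofReal_mul]
    rw [h3, Complex.re_ofReal_mul] at h2
    exact nonneg_of_mul_nonneg_right h2 (by positivity)
  · have h2 := f.le_opNorm (gElt 1)
    rw [h1, norm_one] at h2
    exact h2.trans (mul_le_of_le_one_right (norm_nonneg _) (norm_gElt_le 1))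

/-- The vector state given by a unit vector. -/
def URep.vectorState (π : URep Γ H) (ζ : H) (hζ : ‖ζ‖ = 1) : State Γ :=
  ⟨LinearMap.mkContinuous ⟨⟨fun a => ⟪ζ, π.toCStar a ζ⟫_ℂ, fun a b => by
      rw [map_add, add_apply, inner_add_right]⟩, fun c a => by
      change ⟪ζ, π.toCStar (c • a) ζ⟫_ℂ = c • ⟪ζ, π.toCStar a ζ⟫_ℂ
      rw [map_smul, smul_apply, inner_smul_right]; rfl⟩ 1 fun a => by
      refine (norm_inner_le_norm _ _).trans ?_
      have := (π.toCStar a).le_opNorm ζ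
      rw [hζ] at this ⊢
      linarith [π.norm_toCStar_le a], isState_of_norm_le_one
        (LinearMap.mkContinuous_norm_le _ zero_le_one _) (by
          change ⟪ζ, π.toCStar (gElt 1) ζ⟫_ℂ = 1
          rw [π.toCStar_one, one_apply_eq_self, inner_self_eq_norm_sq_to_K, hζ]
          simp)⟩

lemma URep.vectorState_apply (π : URep Γ H) (ζ : H) (hζ : ‖ζ‖ = 1) (a : GroupCStar Γ) :
    (π.vectorState ζ hζ).1 a = ⟪ζ, π.toCStar a ζ⟫_ℂ := rfl

lemma URep.vectorState_isOn (π : URep Γ H) (ζ : H) (hζ : ‖ζ‖ = 1) :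
    (π.vectorState ζ hζ).IsOn π := fun a ha => by
  rw [π.vectorState_apply, (π.mem_ker a).1 ha, zero_apply, inner_zero_right]

end rep

end states

/-! ### Positive definite functions -/

section positiveDefinite

variable {Γ : Type v} [Group Γ]

/-- A normalized positive definite function on a group. -/
structure IsPosDefFun (ω : Γ → ℂ) : Prop where
  map_one : ω 1 = 1
  map_inv : ∀ g, ω g⁻¹ = starRingEnd ℂ (ω g)
  nonneg : ∀ c : Γ →₀ ℂ,
    0 ≤ ∑ s ∈ c.support, ∑ t ∈ c.support, starRingEnd ℂ (c s) * c t * ω (s⁻¹ * t)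

/-- The space of finitely supported functions on `Γ`, to be equipped with the inner product given by a
positive definite function. -/
def PosDefSpace {ω : Γ → ℂ} (_ : IsPosDefFun ω) : Type v := Γ →₀ ℂ

namespace IsPosDefFun

variable {ω : Γ → ℂ} (hω : IsPosDefFun ω)

instance : AddCommGroup (PosDefSpace hω) := inferInstanceAs (AddCommGroup (Γ →₀ ℂ))
instance : Module ℂ (PosDefSpace hω) := inferInstanceAs (Module ℂ (Γ →₀ ℂ))

/-- The sesquilinear form `(c, d) ↦ ∑ c̄(s) d(t) ω(s⁻¹ t)`. -/
def form (ω : Γ → ℂ) (c d : Γ →₀ ℂ) : ℂ :=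
  c.sum fun s z => d.sum fun t w => starRingEnd ℂ z * w * ω (s⁻¹ * t)

lemma form_add_left (c c' d : Γ →₀ ℂ) : form ω (c + c') d = form ω c d + form ω c' d := by
  unfold form
  refine Finsupp.sum_add_index' (fun s => ?_) fun s z z' => ?_
  · simp
  · simp only [map_add, add_mul, Finsupp.sum_add]

lemma form_smul_left (a : ℂ) (c d : Γ →₀ ℂ) :
    form ω (a • c) d = starRingEnd ℂ a * form ω c d := by
  unfold form
  rw [Finsupp.sum_smul_index (fun s => by simp), Finsupp.mul_sum]
  refine Finsupp.sum_congr fun s _ => ?_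
  rw [Finsupp.mul_sum]
  refine Finsupp.sum_congr fun t _ => ?_
  rw [map_mul]; ring

lemma conj_form (hω : IsPosDefFun ω) (c d : Γ →₀ ℂ) : starRingEnd ℂ (form ω d c) = form ω c d := by
  unfold form
  rw [map_finsuppSum]
  simp only [map_finsuppSum]
  rw [Finsupp.sum_comm]
  refine Finsupp.sum_congr fun s _ => Finsupp.sum_congr fun t _ => ?_
  rw [map_mul, map_mul, Complex.conj_conj, ← hω.map_inv, mul_inv_rev, inv_inv]
  ring

lemma form_single (s t : Γ) (z w : ℂ) :
    form ω (Finsupp.single s z) (Finsupp.single t w) = starRingEnd ℂ z * w * ω (s⁻¹ * t) := by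
  unfold form
  rw [Finsupp.sum_single_index (by simp), Finsupp.sum_single_index (by simp)]

lemma form_mapDomain (g : Γ) (c d : Γ →₀ ℂ) :
    form ω (c.mapDomain (g * ·)) d = form ω c (d.mapDomain (g⁻¹ * ·)) := by
  unfold form
  rw [Finsupp.sum_mapDomain_index (by simp) (by simp [add_mul, Finsupp.sum_add])]
  refine Finsupp.sum_congr fun s _ => ?_
  rw [Finsupp.sum_mapDomain_index (by simp) (by simp [mul_add, add_mul])]
  refine Finsupp.sum_congr fun t _ => ?_
  rw [mul_inv_rev, mul_assoc s⁻¹]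

/-- The semi-inner product given by a positive definite function. -/
abbrev core : PreInnerProductSpace.Core ℂ (PosDefSpace hω) where
  inner c d := form ω c d
  conj_inner_symm c d := hω.conj_form c d
  re_inner_nonneg c := (Complex.le_def.1 (hω.nonneg c)).1
  add_left c c' d := form_add_left c c' d
  smul_left c d a := form_smul_left a c d

instance : SeminormedAddCommGroup (PosDefSpace hω) :=
  InnerProductSpace.Core.toSeminormedAddCommGroup (c := hω.core)

instance : InnerProductSpace ℂ (PosDefSpace hω) := InnerProductSpace.ofCore hω.core

lemma inner_def (c d : PosDefSpace hω) : ⟪c, d⟫_ℂ = form ω c d := rfl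

/-- Left translation on the space of finitely supported functions. -/
def translate (g : Γ) : PosDefSpace hω →ₗ[ℂ] PosDefSpace hω := Finsupp.lmapDomain ℂ ℂ (g * ·)

lemma inner_translate (g : Γ) (c d : PosDefSpace hω) :
    ⟪hω.translate g c, d⟫_ℂ = ⟪c, hω.translate g⁻¹ d⟫_ℂ := form_mapDomain g c d

lemma translate_mul (g h : Γ) (c : PosDefSpace hω) :
    hω.translate (g * h) c = hω.translate g (hω.translate h c) := by
  refine Eq.trans ?_ (Finsupp.mapDomain_comp (v := (c : Γ →₀ ℂ)) (f := (h * ·)) (g := (g * ·)))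
  exact congrArg (fun f => Finsupp.mapDomain f (c : Γ →₀ ℂ)) (funext fun k => mul_assoc g h k)

lemma translate_one (c : PosDefSpace hω) : hω.translate 1 c = c := by
  refine Eq.trans ?_ (Finsupp.mapDomain_id (v := (c : Γ →₀ ℂ)))
  exact congrArg (fun f => Finsupp.mapDomain f (c : Γ →₀ ℂ)) (funext fun k => one_mul k)

/-- Left translation as a bounded operator. -/
def translateL (g : Γ) : PosDefSpace hω →L[ℂ] PosDefSpace hω :=
  (hω.translate g).mkContinuous 1 fun c => by
    rw [one_mul]
    refine le_of_eq ?_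
    have h : ⟪hω.translate g c, hω.translate g c⟫_ℂ = ⟪c, c⟫_ℂ := by
      rw [hω.inner_translate, ← hω.translate_mul, inv_mul_cancel, hω.translate_one]
    rw [@norm_eq_sqrt_re_inner ℂ, h, ← @norm_eq_sqrt_re_inner ℂ]

/-- The Hilbert space associated with a positive definite function. -/
abbrev HilbertSpace : Type v := UniformSpace.Completion (PosDefSpace hω)

lemma completion_translateL_coe (g : Γ) (c : PosDefSpace hω) :
    (hω.translateL g).completion (c : hω.HilbertSpace) =
      ((hω.translate g c : PosDefSpace hω) : hω.HilbertSpace) :=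
  ContinuousLinearMap.completion_apply_coe _ _

lemma completion_translateL_one : (hω.translateL 1).completion = 1 := by
  ext ξ
  refine UniformSpace.Completion.induction_on ξ
    (isClosed_eq (ContinuousLinearMap.continuous _) continuous_id) fun c => ?_
  rw [completion_translateL_coe, translate_one]; rfl

lemma completion_translateL_mul (g h : Γ) : (hω.translateL (g * h)).completion =
    (hω.translateL g).completion * (hω.translateL h).completion := by
  ext ξ
  refine UniformSpace.Completion.induction_on ξ
    (isClosed_eq (ContinuousLinearMap.continuous _) (ContinuousLinearMap.continuous _)) fun c => ?_
  rw [mul_apply_eq_comp, completion_translateL_coe, completion_translateL_coe,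
    completion_translateL_coe, translate_mul]

lemma inner_completion_translateL (g : Γ) (ξ η : hω.HilbertSpace) :
    ⟪(hω.translateL g).completion ξ, η⟫_ℂ = ⟪ξ, (hω.translateL g⁻¹).completion η⟫_ℂ := by
  refine UniformSpace.Completion.induction_on₂ ξ η
    (isClosed_eq (by fun_prop) (by fun_prop)) fun c d => ?_
  rw [completion_translateL_coe, completion_translateL_coe, UniformSpace.Completion.inner_coe,
    UniformSpace.Completion.inner_coe]
  exact hω.inner_translate g c d

/-- The unitary representation associated with a positive definite function. -/
def rep : URep Γ hω.HilbertSpace :=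
  URep.ofHom ⟨⟨fun g => (hω.translateL g).completion, hω.completion_translateL_one⟩,
    hω.completion_translateL_mul⟩ hω.inner_completion_translateL

lemma rep_apply (g : Γ) :
    (hω.rep g : hω.HilbertSpace →L[ℂ] hω.HilbertSpace) = (hω.translateL g).completion := rfl

/-- The point mass at the neutral element. -/
def point : PosDefSpace hω := Finsupp.single (1 : Γ) (1 : ℂ)

lemma inner_point_translate (g : Γ) : ⟪hω.point, hω.translate g hω.point⟫_ℂ = ω g := by
  have he : hω.translate g hω.point = (Finsupp.single g (1 : ℂ) : Γ →₀ ℂ) := by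
    refine (Finsupp.mapDomain_single (f := (g * ·)) (a := (1 : Γ)) (b := (1 : ℂ))).trans ?_
    rw [mul_one]
  rw [hω.inner_def]
  refine (congrArg (form ω _) he).trans ((form_single _ _ _ _).trans ?_)
  simp

lemma inner_point_rep (g : Γ) : ⟪(hω.point : hω.HilbertSpace),
    (hω.rep g : hω.HilbertSpace →L[ℂ] hω.HilbertSpace) hω.point⟫_ℂ = ω g := by
  rw [rep_apply, completion_translateL_coe, UniformSpace.Completion.inner_coe,
    inner_point_translate]

lemma norm_point : ‖(hω.point : hω.HilbertSpace)‖ = 1 := by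
  have h := hω.inner_point_rep 1
  rw [hω.rep.one_apply, hω.map_one, inner_self_eq_norm_sq_to_K] at h
  have h2 : ‖(hω.point : hω.HilbertSpace)‖ ^ 2 = 1 :=
    Complex.ofReal_injective (by push_cast; exact h)
  nlinarith [norm_nonneg (hω.point : hω.HilbertSpace)]

/-- A normalized positive definite function extends to a state. -/
theorem exists_state (hω : IsPosDefFun ω) : ∃ φ : State Γ, ∀ g, φ.evalAt g = ω g := by
  refine ⟨hω.rep.vectorState _ hω.norm_point, fun g => ?_⟩
  rw [State.evalAt, URep.vectorState_apply, URep.toCStar_gElt, inner_point_rep]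

end IsPosDefFun

/-- The values of a state on the group elements form a normalized positive definite function. -/
lemma State.isPosDefFun (φ : State Γ) : IsPosDefFun φ.evalAt where
  map_one := φ.apply_one
  map_inv g := by
    rw [← φ.inner_vec_apply g⁻¹, ← φ.inner_vec_apply g, inner_conj_symm, φ.gns.adjoint_apply]
  nonneg c := by
    have h := φ.nonneg (groupSum c)
    refine h.trans_eq ?_
    rw [groupSum, Finsupp.linearCombination_apply, Finsupp.sum, star_sum, Finset.sum_mul_sum,
      map_sum]
    refine Finset.sum_congr rfl fun s _ => ?_
    rw [map_sum]
    refine Finset.sum_congr rfl fun t _ => ?_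
    rw [star_smul, smul_mul_assoc, mul_smul_comm, star_gElt, gElt_mul, map_smul, map_smul,
      smul_eq_mul, smul_eq_mul, ← mul_assoc]
    rfl

end positiveDefinite

/-! ### Irreducible representations with a given maximal kernel -/

section maximal

variable {Γ : Type v} [Group Γ]

lemma TwoSidedIdeal.eq_top_of_gElt_one_mem {M : TwoSidedIdeal (GroupCStar Γ)} (h : gElt 1 ∈ M) :
    M = ⊤ := by
  refine eq_top_iff.2 fun a _ => ?_
  rw [← mul_gElt_one a]
  exact M.mul_mem_left _ _ h

/-- A proper ideal has distance at least one from the unit. -/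
lemma one_le_norm_gElt_one_sub {M : TwoSidedIdeal (GroupCStar Γ)} (hM : M ≠ ⊤) {m : GroupCStar Γ}
    (hm : m ∈ M) : 1 ≤ ‖gElt 1 - m‖ := by
  by_contra! hlt
  let _ := groupCStarUnital Γ
  let u := Units.oneSub (1 - m) hlt
  have hu : (u : GroupCStar Γ) = m := by simp [u]
  refine hM (TwoSidedIdeal.eq_top_of_gElt_one_mem ?_)
  have : (gElt 1 : GroupCStar Γ) = ((u⁻¹ : (GroupCStar Γ)ˣ) : GroupCStar Γ) * m := by
    rw [← hu, Units.inv_mul]; rfl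
  rw [this]
  exact M.mul_mem_left _ _ hm

/-- A two-sided ideal as a complex subspace. -/
def idealSubmodule (M : TwoSidedIdeal (GroupCStar Γ)) : Submodule ℂ (GroupCStar Γ) where
  carrier := M
  add_mem' := M.add_mem
  zero_mem' := M.zero_mem
  smul_mem' z a ha := by
    rw [← gElt_one_mul a, ← smul_mul_assoc]
    exact M.mul_mem_left _ _ ha

lemma exists_state_vanishing {M : TwoSidedIdeal (GroupCStar Γ)} (hc : IsClosed (M : Set (GroupCStar Γ)))
    (hM : M ≠ ⊤) : ∃ φ : State Γ, ∀ a ∈ M, φ.1 a = 0 := by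
  let N := idealSubmodule M
  have : IsClosed (N : Set (GroupCStar Γ)) := hc
  have h1 : ‖(N.mkQ (gElt 1) : GroupCStar Γ ⧸ N)‖ = 1 := by
    refine le_antisymm ((Submodule.Quotient.norm_mk_le N _).trans (norm_gElt_le 1)) ?_
    refine le_of_forall_pos_lt_add fun ε hε => ?_
    obtain ⟨b, hb, hlt⟩ := Submodule.Quotient.norm_mk_lt (N.mkQ (gElt 1)) hε
    have hmem : gElt 1 - b ∈ M := (Submodule.Quotient.eq N).1 hb.symm
    have := one_le_norm_gElt_one_sub hM hmem
    rw [sub_sub_cancel] at this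
    exact this.trans_lt hlt
  obtain ⟨f, hf1, hf2⟩ := exists_dual_vector ℂ (N.mkQ (gElt 1) : GroupCStar Γ ⧸ N)
    (norm_ne_zero_iff.1 (by rw [h1]; norm_num))
  rw [h1] at hf2
  let F : GroupCStar Γ →L[ℂ] ℂ := (f.toLinearMap ∘ₗ N.mkQ).mkContinuous 1 fun a => by
    have := f.le_opNorm (N.mkQ a)
    rw [hf1] at this
    refine this.trans ?_
    gcongr
    exact Submodule.Quotient.norm_mk_le N a
  refine ⟨⟨F, isState_of_norm_le_one (LinearMap.mkContinuous_norm_le _ zero_le_one _) ?_⟩, ?_⟩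
  · exact hf2.trans (by simp)
  · intro a ha
    change f (N.mkQ a) = 0
    rw [show N.mkQ a = 0 from (Submodule.Quotient.mk_eq_zero N).2 ha, map_zero]

/-- The states which vanish on an ideal, as a subset of the space of all functions. -/
def stateSet (M : TwoSidedIdeal (GroupCStar Γ)) : Set (GroupCStar Γ → ℂ) :=
  {f | ∃ φ : State Γ, (∀ a ∈ M, φ.1 a = 0) ∧ f = φ.1}

lemma stateSet_eq (M : TwoSidedIdeal (GroupCStar Γ)) : stateSet M =
    {f | (∀ a b, f (a + b) = f a + f b) ∧ (∀ (c : ℂ) a, f (c • a) = c • f a) ∧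
      (∀ a, ‖f a‖ ≤ ‖a‖) ∧ f (gElt 1) = 1 ∧ ∀ a ∈ M, f a = 0} := by
  ext f
  constructor
  · rintro ⟨φ, hφ, rfl⟩
    exact ⟨map_add _, map_smul _, φ.norm_le, φ.apply_one, hφ⟩
  · rintro ⟨h1, h2, h3, h4, h5⟩
    let F : GroupCStar Γ →L[ℂ] ℂ := LinearMap.mkContinuous ⟨⟨f, h1⟩, h2⟩ 1 fun a => by
      rw [one_mul]; exact h3 a
    exact ⟨⟨F, isState_of_norm_le_one (LinearMap.mkContinuous_norm_le _ zero_le_one _) h4⟩, h5, rfl⟩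

lemma isCompact_stateSet (M : TwoSidedIdeal (GroupCStar Γ)) : IsCompact (stateSet M) := by
  have h1 : IsCompact (Set.univ.pi fun a : GroupCStar Γ => Metric.closedBall (0 : ℂ) ‖a‖) :=
    isCompact_univ_pi fun a => isCompact_closedBall _ _
  rw [stateSet_eq]
  refine h1.of_isClosed_subset ?_ fun f hf a _ => by simpa using hf.2.2.1 a
  simp only [Set.ofPred_and, Set.ofPred_forall]
  refine (isClosed_iInter fun a => isClosed_iInter fun b => isClosed_eq (by fun_prop)
    (by fun_prop)).inter ?_
  refine (isClosed_iInter fun c => isClosed_iInter fun a => isClosed_eq (by fun_prop)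
    (by fun_prop)).inter ?_
  refine (isClosed_iInter fun a => isClosed_le (by fun_prop) (by fun_prop)).inter ?_
  refine (isClosed_eq (by fun_prop) (by fun_prop)).inter ?_
  exact isClosed_iInter fun a => isClosed_iInter fun _ => isClosed_eq (by fun_prop) (by fun_prop)

/-- If `M` is annihilated by `φ`, then it is annihilated by the GNS representation. -/
lemma State.toCStar_eq_zero_of_mem {φ : State Γ} {M : TwoSidedIdeal (GroupCStar Γ)}
    (h : ∀ a ∈ M, φ.1 a = 0) {a : GroupCStar Γ} (ha : a ∈ M) : φ.gns.toCStar a = 0 := by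
  refine φ.isCyclic.toCStar_eq_zero fun g k => ?_
  rw [← inner_conj_symm, ← URep.toCStar_gElt, ← URep.toCStar_gElt, ← mul_apply_eq_comp, ← map_mul,
    φ.inner_toCStar_vec, h _ (M.mul_mem_left _ _ (M.mul_mem_right _ _ ha)), map_zero]

/-- The GNS representation of an extreme point of the set of states which vanish on an ideal is
irreducible. -/
lemma State.isIrreducible_gns {φ : State Γ} {M : TwoSidedIdeal (GroupCStar Γ)}
    (hφ : (φ.1 : GroupCStar Γ → ℂ) ∈ (stateSet M).extremePoints ℝ) : φ.gns.IsIrreducible := by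
  have hM : ∀ a ∈ M, φ.1 a = 0 := by
    obtain ⟨φ', h1, h2⟩ := hφ.1
    intro a ha; rw [h2]; exact h1 a ha
  have hv := φ.norm_vec
  have hinv : ∀ V : Submodule ℂ φ.GNSSpace, IsClosed (V : Set φ.GNSSpace) →
      (∀ g : Γ, ∀ ξ ∈ V, (φ.gns g : φ.GNSSpace →L[ℂ] φ.GNSSpace) ξ ∈ V) →
      ∀ (a : GroupCStar Γ), ∀ ξ ∈ V, φ.gns.toCStar a ξ ∈ V := by
    intro V hV hg a ξ hξ
    refine groupCStar_induction (p := fun a => φ.gns.toCStar a ξ ∈ V) a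
      (hV.preimage ((ContinuousLinearMap.apply ℂ _ ξ).continuous.comp φ.gns.continuous_toCStar))
      fun c => ?_
    rw [URep.toCStar_groupSum]
    induction c using Finsupp.induction_linear with
    | zero => simp
    | add f g hf hg => rw [map_add]; exact V.add_mem hf hg
    | single g z => rw [URep.sum_single]; exact V.smul_mem _ (hg g ξ hξ)
  refine ⟨⟨φ.vec, 0, fun h => by simp [h] at hv⟩, fun V hVc hV => ?_⟩
  have : CompleteSpace V := hVc.completeSpace_coe
  -- the orthogonal complement is invariant as well
  have hVo : ∀ g : Γ, ∀ ξ ∈ Vᗮ, (φ.gns g : φ.GNSSpace →L[ℂ] φ.GNSSpace) ξ ∈ Vᗮ := by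
    intro g ξ hξ η hη
    rw [← inner_conj_symm, φ.gns.adjoint_apply, inner_conj_symm]
    exact hξ _ (hV _ _ hη)
  obtain ⟨p, hp, q, hq, hpq⟩ := V.exists_add_mem_mem_orthogonal φ.vec
  have horth : ∀ a, ⟪p, φ.gns.toCStar a q⟫_ℂ = 0 := fun a =>
    hinv Vᗮ V.isClosed_orthogonal hVo a q hq p hp
  have horth' : ∀ a, ⟪q, φ.gns.toCStar a p⟫_ℂ = 0 := fun a => by
    rw [← inner_conj_symm, hq _ (hinv V hVc hV a p hp), map_zero]
  rcases eq_or_ne p 0 with rfl | hp0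
  · left
    refine (Submodule.eq_bot_iff _).2 fun ξ hξ => φ.isCyclic ξ fun g => ?_
    rw [zero_add] at hpq
    rw [hpq]
    exact hVo g q hq ξ hξ
  rcases eq_or_ne q 0 with rfl | hq0
  · right
    rw [add_zero] at hpq
    rw [← Submodule.orthogonal_eq_bot_iff]
    refine (Submodule.eq_bot_iff _).2 fun ξ hξ => φ.isCyclic ξ fun g => ?_
    rw [hpq, ← inner_conj_symm, hξ _ (hV g p hp), map_zero]
  exfalso
  have hpn : 0 < ‖p‖ := norm_pos_iff.2 hp0
  have hqn : 0 < ‖q‖ := norm_pos_iff.2 hq0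
  have hpq0 : ⟪p, q⟫_ℂ = 0 := hq p hp
  have hsum : ‖p‖ * ‖p‖ + ‖q‖ * ‖q‖ = 1 := by
    rw [← norm_add_sq_eq_norm_sq_add_norm_sq_of_inner_eq_zero p q hpq0, ← hpq, hv, one_mul]
  have hunit : ∀ {w : φ.GNSSpace}, 0 < ‖w‖ → ‖((‖w‖⁻¹ : ℝ) : ℂ) • w‖ = 1 := fun {w} hw => by
    rw [norm_smul, Complex.norm_real, norm_inv, norm_norm, inv_mul_cancel₀ hw.ne']
  have hval : ∀ {w : φ.GNSSpace} (hw : 0 < ‖w‖) (a : GroupCStar Γ),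
      ((‖w‖ * ‖w‖ : ℝ) : ℂ) * (φ.gns.vectorState _ (hunit hw)).1 a = ⟪w, φ.gns.toCStar a w⟫_ℂ := by
    intro w hw a
    rw [URep.vectorState_apply, map_smul, inner_smul_left, inner_smul_right, Complex.conj_ofReal,
      ← mul_assoc, ← mul_assoc, ← Complex.ofReal_mul, ← Complex.ofReal_mul]
    have : ‖w‖ * ‖w‖ * ‖w‖⁻¹ * ‖w‖⁻¹ = 1 := by field_simp
    rw [this, Complex.ofReal_one, one_mul]
  have hmem : ∀ {w : φ.GNSSpace} (hw : 0 < ‖w‖),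
      ((φ.gns.vectorState _ (hunit hw)).1 : GroupCStar Γ → ℂ) ∈ stateSet M := fun {w} hw =>
    ⟨_, fun a ha => by
      rw [URep.vectorState_apply, State.toCStar_eq_zero_of_mem hM ha, zero_apply,
        inner_zero_right], rfl⟩
  have hex := hφ.2 (hmem hpn) (hmem hqn) ⟨‖p‖ * ‖p‖, ‖q‖ * ‖q‖, by positivity, by positivity, hsum, by
    funext a
    have h1 := hval hpn a
    have h2 := hval hqn a
    rw [← φ.inner_vec a]
    conv_rhs => rw [hpq]
    rw [map_add, inner_add_left, inner_add_right, inner_add_right, horth, horth', add_zero, zero_add,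
      ← h1, ← h2]
    simp [Pi.add_apply]⟩
  have h3 : p - ((‖p‖ * ‖p‖ : ℝ) : ℂ) • φ.vec = 0 := by
    refine φ.isCyclic _ fun g => ?_
    have h1 := hval hpn (gElt g)
    rw [hex, ← φ.inner_vec, URep.toCStar_gElt] at h1
    rw [inner_sub_left, inner_smul_left, Complex.conj_ofReal, h1, sub_eq_zero]
    have h4 := horth (gElt g)
    rw [URep.toCStar_gElt] at h4
    conv_lhs => rw [hpq]
    rw [map_add, inner_add_right, h4, add_zero]
  have h4 : ⟪q, p - ((‖p‖ * ‖p‖ : ℝ) : ℂ) • φ.vec⟫_ℂ = 0 := by rw [h3, inner_zero_right]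
  have h5 : ⟪q, p⟫_ℂ = 0 := by rw [← inner_conj_symm, hpq0, map_zero]
  rw [hpq, inner_sub_right, inner_smul_right, inner_add_right, h5, zero_add, zero_sub,
    neg_eq_zero, mul_eq_zero, inner_self_eq_zero, Complex.ofReal_eq_zero] at h4
  rcases h4 with h4 | h4
  · exact (mul_pos hpn hpn).ne' h4
  · exact hq0 h4

/-- Every maximal ideal of `C*(Γ)` is the kernel of an irreducible representation. -/
theorem IsMaximalIdeal.exists_irreducible {M : TwoSidedIdeal (GroupCStar Γ)} (hM : IsMaximalIdeal M) :
    ∃ φ : State Γ, φ.gns.IsIrreducible ∧ φ.gns.ker = M := by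
  obtain ⟨φ₀, hφ₀⟩ := exists_state_vanishing hM.1 hM.2.1
  obtain ⟨f, hf⟩ := (isCompact_stateSet M).extremePoints_nonempty ⟨_, φ₀, hφ₀, rfl⟩
  obtain ⟨φ, h1, rfl⟩ := hf.1
  refine ⟨φ, State.isIrreducible_gns hf, ?_⟩
  have hle : M ≤ φ.gns.ker := fun a ha => (URep.mem_ker _ _).2 (State.toCStar_eq_zero_of_mem h1 ha)
  by_contra hne
  have h2 := hM.2.2 _ φ.gns.isClosed_ker (lt_of_le_of_ne hle (Ne.symm hne))
  have h3 : gElt 1 ∈ φ.gns.ker := by rw [h2]; trivial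
  have h4 := φ.isOn_gns _ h3
  rw [φ.apply_one] at h4
  exact one_ne_zero h4

section extension

variable {H : Type v} [NormedAddCommGroup H] [InnerProductSpace ℂ H] [CompleteSpace H]

/-- A state on `C*_{π|S}(S)` extends to a state on `C*_π(Γ)`. -/
theorem State.exists_extension (π : URep Γ H) {S : Subgroup Γ} {ω : State S}
    (hω : ω.IsOn (π.res S)) : ∃ φ : State Γ, φ.IsOn π ∧ ∀ s : S, φ.evalAt s = ω.evalAt s := by
  let σ : GroupCStar S →ₗ[ℂ] (H →L[ℂ] H) := ((π.res S).toCStar : GroupCStar S →ₗ[ℂ] (H →L[ℂ] H))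
  have hker : LinearMap.ker σ ≤ LinearMap.ker ω.1.toLinearMap := fun a ha => by
    refine hω a ((URep.mem_ker _ _).2 ?_)
    exact ha
  let e := σ.quotKerEquivRange
  let f₀ : LinearMap.range σ →ₗ[ℂ] ℂ :=
    (LinearMap.ker σ).liftQ ω.1.toLinearMap hker ∘ₗ e.symm.toLinearMap
  have hf₀ : ∀ a, f₀ ⟨σ a, a, rfl⟩ = ω.1 a := fun a => by
    have : e.symm ⟨σ a, a, rfl⟩ = Submodule.Quotient.mk a := by
      rw [LinearEquiv.symm_apply_eq]; rfl
    change (LinearMap.ker σ).liftQ ω.1.toLinearMap hker (e.symm ⟨σ a, a, rfl⟩) = _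
    rw [this]; rfl
  let f : LinearMap.range σ →L[ℂ] ℂ := f₀.mkContinuous 1 (by
    rintro ⟨_, a, rfl⟩
    rw [hf₀, one_mul]
    exact State.norm_apply_le_of_isOn hω a)
  obtain ⟨F, hF, hFn⟩ := exists_extension_norm_eq (LinearMap.range σ) f
  have hFn1 : ‖F‖ ≤ 1 := hFn ▸ LinearMap.mkContinuous_norm_le _ zero_le_one _
  have hFs : ∀ a, F (σ a) = ω.1 a := fun a => (hF ⟨σ a, a, rfl⟩).trans (hf₀ a)
  let G : GroupCStar Γ →L[ℂ] ℂ := (F.toLinearMap ∘ₗ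
    (π.toCStar : GroupCStar Γ →ₗ[ℂ] (H →L[ℂ] H))).mkContinuous 1 fun a => by
      refine (F.le_opNorm _).trans ?_
      gcongr
      exact π.norm_toCStar_le a
  have hGs : ∀ s : S, G (gElt (s : Γ)) = ω.1 (gElt s) := fun s => by
    rw [← hFs]
    change F (π.toCStar (gElt (s : Γ))) = F ((π.res S).toCStar (gElt s))
    rw [URep.toCStar_gElt, URep.toCStar_gElt]; rfl
  refine ⟨⟨G, isState_of_norm_le_one (LinearMap.mkContinuous_norm_le _ zero_le_one _) ?_⟩,
    fun a ha => ?_, hGs⟩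
  · exact (hGs 1).trans ω.apply_one
  · change F (π.toCStar a) = 0
    rw [(URep.mem_ker _ _).1 ha, map_zero]

end extension

end maximal

/-! ### Almost invariant vectors for amenable groups -/

section almostInvariant

variable {Γ : Type v} [Group Γ]

/-- If the numerical value of a symmetric operator at `x` is at least `v`, then its powers satisfy
`‖Tⁿ x‖ ≥ vⁿ ‖x‖`, as the sequence `‖Tⁿ x‖` is logarithmically convex. -/
lemma pow_mul_norm_le_of_isSymmetric {E : Type*} [SeminormedAddCommGroup E] [InnerProductSpace ℂ E]
    {T : E →ₗ[ℂ] E} (hT : T.IsSymmetric) {x : E} {v : ℝ} (hv : 0 ≤ v)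
    (h : v * ‖x‖ ^ 2 ≤ RCLike.re ⟪T x, x⟫_ℂ) (n : ℕ) : v ^ n * ‖x‖ ≤ ‖(T ^ n) x‖ := by
  have step : ∀ n, v * ‖(T ^ n) x‖ ≤ ‖(T ^ (n + 1)) x‖ := by
    intro n
    induction n with
    | zero =>
      have h1 := h.trans ((RCLike.re_le_norm _).trans (norm_inner_le_norm _ _))
      rw [pow_zero, zero_add, pow_one, Module.End.one_apply]
      rcases (norm_nonneg x).eq_or_lt with h0 | h0
      · rw [← h0, mul_zero]; exact norm_nonneg _
      · exact le_of_mul_le_mul_right (by nlinarith) h0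
    | succ n ih =>
      have h1 : ‖(T ^ (n + 1)) x‖ ^ 2 ≤ ‖(T ^ (n + 2)) x‖ * ‖(T ^ n) x‖ := by
        have e1 : RCLike.re ⟪(T ^ (n + 2)) x, (T ^ n) x⟫_ℂ = ‖(T ^ (n + 1)) x‖ ^ 2 := by
          rw [← @inner_self_eq_norm_sq ℂ]
          rw [pow_succ' T (n + 1), Module.End.mul_apply, hT, ← Module.End.mul_apply, ← pow_succ']
        rw [← e1]
        exact (RCLike.re_le_norm _).trans (norm_inner_le_norm _ _)
      rcases (norm_nonneg ((T ^ (n + 1)) x)).eq_or_lt with h0 | h0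
      · rw [← h0, mul_zero]; exact norm_nonneg _
      · have h2 : 0 < ‖(T ^ n) x‖ := by
          refine (norm_nonneg _).lt_of_ne fun h2 => ?_
          rw [← h2, mul_zero] at h1
          nlinarith
        refine le_of_mul_le_mul_right ?_ h2
        calc v * ‖(T ^ (n + 1)) x‖ * ‖(T ^ n) x‖ = ‖(T ^ (n + 1)) x‖ * (v * ‖(T ^ n) x‖) := by ring
          _ ≤ ‖(T ^ (n + 1)) x‖ * ‖(T ^ (n + 1)) x‖ := by gcongr
          _ ≤ _ := by rw [← sq]; exact h1
  induction n with
  | zero => simp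
  | succ n ih =>
    calc v ^ (n + 1) * ‖x‖ = v * (v ^ n * ‖x‖) := by ring
      _ ≤ v * ‖(T ^ n) x‖ := by gcongr
      _ ≤ _ := step n

/-- The coefficients of an element of the space of finitely supported functions. -/
def PosDefSpace.coeff {ω : Γ → ℂ} {hω : IsPosDefFun ω} (c : PosDefSpace hω) : Γ →₀ ℂ := c

open IsPosDefFun (form)

open scoped Classical in
/-- The positive definite function which gives the regular representation. -/
lemma isPosDefFun_single : IsPosDefFun (Pi.single (1 : Γ) (1 : ℂ) : Γ → ℂ) where
  map_one := by simp
  map_inv g := by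
    by_cases h : g = 1
    · subst h; simp
    · rw [Pi.single_eq_of_ne h, Pi.single_eq_of_ne (inv_ne_one.2 h), map_zero]
  nonneg c := by
    refine Finset.sum_nonneg fun s hs => ?_
    rw [Finset.sum_eq_single s]
    · rw [inv_mul_cancel, Pi.single_eq_same, mul_one, mul_comm]
      exact mul_star_self_nonneg (c s)
    · intro t _ hts
      rw [Pi.single_eq_of_ne, mul_zero]
      rwa [Ne, inv_mul_eq_one, eq_comm]
    · intro h; exact absurd hs h

open scoped Classical in
lemma form_single_left (c d : Γ →₀ ℂ) :
    form (Pi.single (1 : Γ) (1 : ℂ)) c d = c.sum fun s z => starRingEnd ℂ z * d s := by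
  unfold form
  refine Finsupp.sum_congr fun s _ => ?_
  rw [Finsupp.sum, Finset.sum_eq_single s]
  · rw [inv_mul_cancel, Pi.single_eq_same, mul_one]
  · intro t _ hts
    rw [Pi.single_eq_of_ne, mul_zero]
    rwa [Ne, inv_mul_eq_one, eq_comm]
  · intro h
    rw [Finsupp.notMem_support_iff.1 h, mul_zero, zero_mul]

open scoped Pointwise in
open scoped Classical in
/-- **Kesten's criterion**: a unitary representation of an amenable group on an inner product space that
has a unit vector with nonnegative matrix coefficients has almost invariant vectors. Otherwise the
average `T` of a finite symmetric set of unitaries has norm `r < 1`. The matrix coefficients of the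
powers of `T` dominate those of the corresponding average in the regular representation, whose powers
do not decay faster than `(1 - ε)ⁿ` on the indicator function of a Følner set. -/
theorem IsAmenable.exists_almost_invariant (hΓ : IsAmenable Γ) {E : Type*} [NormedAddCommGroup E]
    [InnerProductSpace ℂ E] (U : Γ →* (E →ₗ[ℂ] E)) (hU : ∀ g x y, ⟪U g x, y⟫_ℂ = ⟪x, U g⁻¹ y⟫_ℂ)
    {V₀ : E} (hV₀ : ‖V₀‖ = 1) (hpos : ∀ g, 0 ≤ ⟪V₀, U g V₀⟫_ℂ) (E₀ : Finset Γ) {ε : ℝ} (hε : 0 < ε) :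
    ∃ V : E, V ≠ 0 ∧ ∀ g ∈ E₀, ‖U g V - V‖ ≤ ε * ‖V‖ := by
  by_contra! hcon
  have hUn : ∀ g x, ‖U g x‖ = ‖x‖ := fun g x => by
    have : ⟪U g x, U g x⟫_ℂ = ⟪x, x⟫_ℂ := by
      rw [hU, ← Module.End.mul_apply, ← map_mul, inv_mul_cancel, map_one, Module.End.one_apply]
    rw [@norm_eq_sqrt_re_inner ℂ, this, ← @norm_eq_sqrt_re_inner ℂ]
  let E₁ : Finset Γ := insert 1 (E₀ ∪ E₀⁻¹)
  have hE₁ : E₁⁻¹ = E₁ := by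
    ext g
    simp only [E₁, Finset.mem_inv', Finset.mem_insert, Finset.mem_union, inv_eq_one, inv_inv]
    tauto
  have h1E : (1 : Γ) ∈ E₁ := Finset.mem_insert_self _ _
  let m : ℝ := E₁.card
  have hm : 0 < m := by
    have : 0 < E₁.card := Finset.card_pos.2 ⟨1, h1E⟩
    exact Nat.cast_pos.2 this
  let T : E →ₗ[ℂ] E := ((m⁻¹ : ℝ) : ℂ) • ∑ g ∈ E₁, U g
  let κ : ℝ := Real.sqrt (4 - ε ^ 2)
  have hκ : κ < 2 := by
    rw [Real.sqrt_lt' two_pos]; nlinarith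
  have hκ0 : 0 ≤ κ := Real.sqrt_nonneg _
  let r : ℝ := max 0 ((m - 2 + κ) / m)
  have hr0 : 0 ≤ r := le_max_left _ _
  have hr : r < 1 := max_lt one_pos (by rw [div_lt_one hm]; linarith)
  have hT : ∀ V, ‖T V‖ ≤ r * ‖V‖ := by
    intro V
    rcases eq_or_ne V 0 with rfl | hV
    · simp
    obtain ⟨g, hg, hgV⟩ := hcon V hV
    have hg1 : g ≠ 1 := by
      rintro rfl
      rw [map_one, Module.End.one_apply, sub_self, norm_zero] at hgV
      exact absurd hgV (not_lt.2 (by positivity))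
    have hgE : g ∈ E₁.erase 1 :=
      Finset.mem_erase.2 ⟨hg1, Finset.mem_insert_of_mem (Finset.mem_union_left _ hg)⟩
    have h1 : ‖V + U g V‖ ≤ κ * ‖V‖ := by
      have hpar := parallelogram_law_with_norm ℂ V (U g V)
      rw [hUn, norm_sub_rev V] at hpar
      have h2 : ‖V + U g V‖ ^ 2 ≤ (4 - ε ^ 2) * ‖V‖ ^ 2 := by
        nlinarith [norm_nonneg V, norm_nonneg (U g V - V), mul_nonneg hε.le (norm_nonneg V)]
      rw [← Real.sqrt_sq (norm_nonneg V), ← Real.sqrt_mul' _ (sq_nonneg _)]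
      exact Real.le_sqrt_of_sq_le h2
    have h2 : ‖∑ g ∈ E₁, U g V‖ ≤ (m - 2 + κ) * ‖V‖ := by
      rw [← Finset.add_sum_erase _ _ h1E, ← Finset.add_sum_erase _ _ hgE, map_one,
        Module.End.one_apply, ← add_assoc]
      have h3 : ‖∑ g ∈ (E₁.erase 1).erase g, U g V‖ ≤ (m - 2) * ‖V‖ := by
        refine (norm_sum_le _ _).trans ?_
        simp only [hUn]
        rw [Finset.sum_const, nsmul_eq_mul, Finset.card_erase_of_mem hgE,
          Finset.card_erase_of_mem h1E]
        have h4 : 2 ≤ E₁.card := by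
          have := Finset.card_pos.2 ⟨g, hgE⟩
          rw [Finset.card_erase_of_mem h1E] at this
          omega
        rw [Nat.sub_sub, Nat.cast_sub h4]
        rfl
      refine (norm_add_le _ _).trans ?_
      linarith
    have h3 : T V = ((m⁻¹ : ℝ) : ℂ) • ∑ g ∈ E₁, U g V := by
      simp only [T, LinearMap.smul_apply, LinearMap.sum_apply]
    rw [h3, norm_smul, Complex.norm_real, norm_inv, Real.norm_of_nonneg hm.le]
    calc m⁻¹ * ‖∑ g ∈ E₁, U g V‖ ≤ m⁻¹ * ((m - 2 + κ) * ‖V‖) := by gcongr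
      _ = (m - 2 + κ) / m * ‖V‖ := by ring
      _ ≤ r * ‖V‖ := by gcongr; exact le_max_right _ _
  have hTn : ∀ n V, ‖(T ^ n) V‖ ≤ r ^ n * ‖V‖ := by
    intro n V
    induction n with
    | zero => simp
    | succ n ih =>
      rw [pow_succ', Module.End.mul_apply]
      refine (hT _).trans ?_
      calc r * ‖(T ^ n) V‖ ≤ r * (r ^ n * ‖V‖) := by gcongr
        _ = _ := by ring
  -- the same average in the regular representation
  let P := PosDefSpace (isPosDefFun_single (Γ := Γ))
  let L : P →ₗ[ℂ] P := ((m⁻¹ : ℝ) : ℂ) • ∑ g ∈ E₁, isPosDefFun_single.translate g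
  have hLapply : ∀ c : P, L c = ((m⁻¹ : ℝ) : ℂ) • ∑ g ∈ E₁, isPosDefFun_single.translate g c := by
    intro c
    simp only [L, LinearMap.smul_apply, LinearMap.sum_apply]
  have hLsymm : L.IsSymmetric := by
    intro c d
    rw [hLapply, hLapply, inner_smul_left, inner_smul_right, Complex.conj_ofReal, sum_inner,
      inner_sum]
    congr 1
    conv_rhs => rw [← hE₁, Finset.sum_inv_index]
    exact Finset.sum_congr rfl fun g _ => isPosDefFun_single.inner_translate g c d
  have hLnonneg : ∀ c : P, (∀ s : Γ, 0 ≤ c.coeff s) →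
      ∀ s : Γ, 0 ≤ (PosDefSpace.coeff (L c)) s := by
    intro c hc s
    have e1 : (PosDefSpace.coeff (L c)) s =
        ((m⁻¹ : ℝ) : ℂ) * ∑ g ∈ E₁, c.coeff (g⁻¹ * s) := by
      rw [hLapply]
      refine (Finsupp.smul_apply _ (PosDefSpace.coeff _) s).trans ?_
      rw [smul_eq_mul]
      congr 1
      refine (Finsupp.finsetSum_apply _ (fun g => (PosDefSpace.coeff
        (isPosDefFun_single.translate g c))) s).trans (Finset.sum_congr rfl fun g _ => ?_)
      have := Finsupp.mapDomain_apply (mul_right_injective g) c.coeff (g⁻¹ * s)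
      rwa [mul_inv_cancel_left] at this
    rw [e1]
    refine mul_nonneg ?_ (Finset.sum_nonneg fun g _ => hc _)
    exact_mod_cast inv_nonneg.2 hm.le
  let Φ : P →ₗ[ℂ] E := Finsupp.linearCombination ℂ fun t => U t V₀
  have hΦsingle : ∀ t z, Φ (Finsupp.single t z) = z • U t V₀ := fun t z =>
    Finsupp.linearCombination_single ..
  have hΦL : ∀ c, Φ (L c) = T (Φ c) := by
    have hΦt : ∀ g c, Φ (isPosDefFun_single.translate g c) = U g (Φ c) := by
      intro g c
      refine (Finsupp.linearCombination_mapDomain ℂ (g * ·) c.coeff).trans ?_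
      change _ = U g (Finsupp.linearCombination ℂ (fun t => U t V₀) c.coeff)
      rw [Finsupp.linearCombination_apply, Finsupp.linearCombination_apply, map_finsuppSum]
      refine Finsupp.sum_congr fun t _ => ?_
      rw [map_smul, Function.comp_apply, map_mul, Module.End.mul_apply]
    intro c
    rw [hLapply, map_smul, map_sum]
    simp only [T, LinearMap.smul_apply, LinearMap.sum_apply, hΦt]
  have hΦn : ∀ n c, Φ ((L ^ n) c) = (T ^ n) (Φ c) := by
    intro n c
    induction n with
    | zero => rfl
    | succ n ih => rw [pow_succ', pow_succ', Module.End.mul_apply, Module.End.mul_apply, hΦL, ih]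
  -- nonnegativity of the coefficients makes the norm of `Φ c` at least that of `c`
  have hΦnorm : ∀ c : P, (∀ s : Γ, 0 ≤ c.coeff s) → ‖c‖ ≤ ‖Φ c‖ := by
    intro c hc
    have h1 : ⟪c, c⟫_ℂ ≤ ⟪Φ c, Φ c⟫_ℂ := by
      have e2 : ⟪Φ c, Φ c⟫_ℂ = form (fun g => ⟪V₀, U g V₀⟫_ℂ) c c := by
        change ⟪Finsupp.linearCombination ℂ (fun t => U t V₀) c.coeff,
          Finsupp.linearCombination ℂ (fun t => U t V₀) c.coeff⟫_ℂ = form _ c.coeff c.coeff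
        generalize c.coeff = c
        rw [Finsupp.linearCombination_apply, Finsupp.sum_inner]
        unfold form
        refine Finsupp.sum_congr fun s _ => ?_
        rw [Finsupp.inner_sum]
        refine Finsupp.sum_congr fun t _ => ?_
        rw [inner_smul_left, inner_smul_right, hU, ← Module.End.mul_apply, ← map_mul]
        ring
      rw [e2, isPosDefFun_single.inner_def]
      refine Finset.sum_le_sum fun s _ => Finset.sum_le_sum fun t _ => ?_
      refine mul_le_mul_of_nonneg_left ?_ (mul_nonneg ?_ (hc t))
      · by_cases h : s⁻¹ * t = 1
        · rw [h, Pi.single_eq_same]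
          change 1 ≤ ⟪V₀, U 1 V₀⟫_ℂ
          rw [map_one, Module.End.one_apply, inner_self_eq_norm_sq_to_K, hV₀]
          simp
        · rw [Pi.single_eq_of_ne h]; exact hpos _
      · exact star_nonneg_iff.2 (hc s)
    have h2 := (Complex.le_def.1 h1).1
    rw [@norm_eq_sqrt_re_inner ℂ, @norm_eq_sqrt_re_inner ℂ _ _ _ _ (Φ c)]
    exact Real.sqrt_le_sqrt h2
  -- a Følner set
  let δ : ℝ := (1 - r) / 2
  have hδ : 0 < δ := by simp only [δ]; linarith
  obtain ⟨F, hFne, hF⟩ := hΓ E₁ δ hδ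
  have hFc : (0 : ℝ) < F.card := by exact_mod_cast hFne.card_pos
  let one : Γ →₀ ℂ := Finsupp.indicator F fun _ _ => 1
  have hone : ∀ s, one s = if s ∈ F then 1 else 0 := fun s => by
    simp [one, Finsupp.indicator_apply]
  have hone0 : ∀ s, 0 ≤ one s := fun s => by rw [hone]; split_ifs <;> simp
  let c₀ : P := one
  have hsupp : one.support = F := by ext s; simp [hone]
  have hnonneg : ∀ n, ∀ s : Γ, 0 ≤ (PosDefSpace.coeff ((L ^ n) c₀)) s := by
    intro n
    induction n with
    | zero => exact hone0
    | succ n ih => rw [pow_succ', Module.End.mul_apply]; exact hLnonneg _ ih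
  have hform : ∀ d : Γ →₀ ℂ, form (Pi.single (1 : Γ) (1 : ℂ)) one d = ∑ s ∈ F, d s := by
    intro d
    rw [form_single_left, Finsupp.sum, hsupp]
    refine Finset.sum_congr rfl fun s hs => ?_
    rw [hone, if_pos hs, map_one, one_mul]
  have hc₀ : ‖c₀‖ ^ 2 = F.card := by
    rw [← @inner_self_eq_norm_sq ℂ, isPosDefFun_single.inner_def, hform,
      Finset.sum_congr rfl fun s hs => (hone s).trans (if_pos hs)]
    simp
  have hLc₀ : (1 - δ) * ‖c₀‖ ^ 2 ≤ RCLike.re ⟪L c₀, c₀⟫_ℂ := by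
    have hg : ∀ g ∈ E₁, (1 - δ) * F.card ≤ RCLike.re ⟪isPosDefFun_single.translate g c₀, c₀⟫_ℂ := by
      intro g hg
      have e1 : ⟪isPosDefFun_single.translate g c₀, c₀⟫_ℂ =
          ((F.filter fun s => g⁻¹⁻¹ * s ∈ F).card : ℂ) := by
        rw [isPosDefFun_single.inner_translate, isPosDefFun_single.inner_def]
        refine (hform (Finsupp.mapDomain (g⁻¹ * ·) one)).trans ?_
        rw [Finset.card_filter, Nat.cast_sum]
        refine Finset.sum_congr rfl fun s _ => ?_
        have := Finsupp.mapDomain_apply (mul_right_injective g⁻¹) one (g⁻¹⁻¹ * s)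
        rw [mul_inv_cancel_left] at this
        rw [this, hone]
        split_ifs <;> simp
      have e2 : (F.filter fun s => g⁻¹⁻¹ * s ∉ F).card ≤ (symmDiff (g • F) F).card := by
        rw [← Finset.card_image_of_injective _ (mul_right_injective g)]
        refine Finset.card_le_card fun t ht => ?_
        obtain ⟨s, hs, rfl⟩ := Finset.mem_image.1 ht
        rw [Finset.mem_filter, inv_inv] at hs
        rw [Finset.mem_symmDiff]
        exact Or.inl ⟨Finset.smul_mem_smul_finset hs.1, hs.2⟩
      have e3 := Finset.card_filter_add_card_filter_not (s := F) fun s => g⁻¹⁻¹ * s ∈ F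
      have e4 : ((F.filter fun s => g⁻¹⁻¹ * s ∈ F).card : ℝ) +
          (F.filter fun s => g⁻¹⁻¹ * s ∉ F).card = F.card := by exact_mod_cast e3
      have e5 : ((F.filter fun s => g⁻¹⁻¹ * s ∉ F).card : ℝ) ≤ δ * F.card :=
        (Nat.cast_le.2 e2).trans (hF g hg)
      rw [e1, RCLike.natCast_re]
      linarith
    rw [hLapply, inner_smul_left, Complex.conj_ofReal, sum_inner, hc₀]
    have e6 : RCLike.re (((m⁻¹ : ℝ) : ℂ) * ∑ g ∈ E₁, ⟪isPosDefFun_single.translate g c₀, c₀⟫_ℂ) =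
        m⁻¹ * ∑ g ∈ E₁, RCLike.re ⟪isPosDefFun_single.translate g c₀, c₀⟫_ℂ := by
      rw [← map_sum]; exact Complex.re_ofReal_mul _ _
    rw [e6, ← div_eq_inv_mul, le_div_iff₀ hm]
    have := Finset.card_nsmul_le_sum E₁ _ _ hg
    rw [nsmul_eq_mul] at this
    calc _ = m * ((1 - δ) * F.card) := by ring
      _ ≤ _ := this
  have hrδ : r < 1 - δ := by simp only [δ]; linarith
  have h1δ : 0 < 1 - δ := hr0.trans_lt hrδ
  have hkey : ∀ n, (1 - δ) ^ n * ‖c₀‖ ≤ r ^ n * ‖Φ c₀‖ := fun n =>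
    calc _ ≤ ‖(L ^ n) c₀‖ := pow_mul_norm_le_of_isSymmetric hLsymm h1δ.le hLc₀ n
      _ ≤ ‖Φ ((L ^ n) c₀)‖ := hΦnorm _ (hnonneg n)
      _ = ‖(T ^ n) (Φ c₀)‖ := by rw [hΦn]
      _ ≤ _ := hTn n _
  have hc₀pos : 0 < ‖c₀‖ := by
    refine (norm_nonneg _).lt_of_ne fun h => ?_
    rw [← h] at hc₀
    rw [zero_pow two_ne_zero] at hc₀
    exact hFc.ne hc₀
  have hlim : Tendsto (fun n => (r / (1 - δ)) ^ n * ‖Φ c₀‖) atTop (𝓝 (0 * ‖Φ c₀‖)) :=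
    (tendsto_pow_atTop_nhds_zero_of_lt_one (by positivity) ((div_lt_one h1δ).2 hrδ)).mul_const _
  rw [zero_mul] at hlim
  refine absurd (ge_of_tendsto' hlim fun n => ?_) (not_le.2 hc₀pos)
  rw [div_pow, div_mul_eq_mul_div, le_div_iff₀ (pow_pos h1δ n), mul_comm]
  exact hkey n

end almostInvariant

section keyLemma

variable {Γ : Type v} [Group Γ]

open scoped TensorProduct

/-- Every Hilbert space has a conjugation `J`, and `A ↦ J A J` is a conjugate linear multiplicative
contraction. -/
lemma exists_conjugation (H : Type*) [NormedAddCommGroup H] [InnerProductSpace ℂ H]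
    [CompleteSpace H] : ∃ (J : H → H) (κ : (H →L[ℂ] H) →ₗ⋆[ℂ] (H →L[ℂ] H)),
      (∀ x y, ⟪J x, J y⟫_ℂ = ⟪y, x⟫_ℂ) ∧ (∀ A x, κ A (J x) = J (A x)) ∧
      (∀ A B, κ (A * B) = κ A * κ B) ∧ κ 1 = 1 ∧ ∀ A, ‖κ A‖ ≤ ‖A‖ := by
  obtain ⟨w, b, -⟩ := exists_hilbertBasis (𝕜 := ℂ) (E := H)
  let J : H → H := fun x => b.repr.symm (star (b.repr x))
  have hadd : ∀ x y, J (x + y) = J x + J y := fun x y => by simp [J, star_add]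
  have hsmul : ∀ (z : ℂ) x, J (z • x) = starRingEnd ℂ z • J x := fun z x => by simp [J, star_smul]
  have hJJ : ∀ x, J (J x) = x := fun x => by simp [J]
  have hn : ∀ x, ‖J x‖ = ‖x‖ := fun x => by simp [J]
  have hin : ∀ x y, ⟪J x, J y⟫_ℂ = ⟪y, x⟫_ℂ := fun x y => by
    simp only [J]
    rw [LinearIsometryEquiv.inner_map_map, ← b.repr.inner_map_map y x, lp.inner_eq_tsum,
      lp.inner_eq_tsum]
    refine tsum_congr fun i => ?_
    simp [mul_comm]
  have hb : ∀ (A : H →L[ℂ] H) x, ‖J (A (J x))‖ ≤ ‖A‖ * ‖x‖ := fun A x => by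
    rw [hn, ← hn x]; exact A.le_opNorm _
  let κ₀ : (H →L[ℂ] H) → (H →L[ℂ] H) := fun A =>
    LinearMap.mkContinuous
      { toFun := fun x => J (A (J x))
        map_add' := fun x y => by rw [hadd, map_add, hadd]
        map_smul' := fun z x => by rw [hsmul, map_smul, hsmul, Complex.conj_conj]; rfl } ‖A‖ (hb A)
  have hκ₀ : ∀ A x, κ₀ A x = J (A (J x)) := fun A x => rfl
  refine ⟨J, ⟨⟨κ₀, fun A B => ?_⟩, fun z A => ?_⟩, hin, fun A x => ?_, fun A B => ?_, ?_, fun A => ?_⟩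
  · ext x
    rw [add_apply, hκ₀, hκ₀, hκ₀, add_apply, hadd]
  · ext x
    change κ₀ (z • A) x = starRingEnd ℂ z • κ₀ A x
    rw [hκ₀, hκ₀, smul_apply, hsmul]
  · change κ₀ A (J x) = _
    rw [hκ₀, hJJ]
  · ext x
    change κ₀ (A * B) x = κ₀ A (κ₀ B x)
    rw [hκ₀, hκ₀, hκ₀, hJJ]; rfl
  · ext x
    change κ₀ 1 x = x
    rw [hκ₀, one_apply_eq_self, hJJ]
  · exact ContinuousLinearMap.opNorm_le_bound _ (norm_nonneg _) (hb A)

variable {H K : Type*} [NormedAddCommGroup H] [InnerProductSpace ℂ H] [CompleteSpace H]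
  [NormedAddCommGroup K] [InnerProductSpace ℂ K] [CompleteSpace K]

lemma URep.norm_le_one (π : URep Γ H) (g : Γ) : ‖(π g : H →L[ℂ] H)‖ ≤ 1 :=
  ContinuousLinearMap.opNorm_le_bound _ zero_le_one fun ξ => by
    rw [one_mul, ContinuousLinearMap.norm_map_of_mem_unitary (π g).2]

/-- If the product of a matrix coefficient of `σ` and a conjugate matrix coefficient of `ρ` is
nonnegative, then, for an amenable group, no finitely supported element is close to zero in `σ` and close
to the identity in `ρ`: on an almost invariant vector for `σ ⊗ ρ̄` both operators agree approximately. -/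
theorem IsAmenable.not_norm_sum_le (hΓ : IsAmenable Γ) (σ : URep Γ H) (ρ : URep Γ K) {e : H} {v : K}
    (he : ‖e‖ = 1) (hv : ‖v‖ = 1)
    (hpos : ∀ g, 0 ≤ ⟪e, (σ g : H →L[ℂ] H) e⟫_ℂ * starRingEnd ℂ ⟪v, (ρ g : K →L[ℂ] K) v⟫_ℂ)
    (c : Γ →₀ ℂ) (h₁ : ‖σ.sum c‖ ≤ 1 / 4) (h₂ : ‖ρ.sum c - 1‖ ≤ 1 / 4) : False := by
  obtain ⟨J, κ, hJ, hκJ, hκmul, hκone, hκn⟩ := exists_conjugation K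
  let A : Γ → (H →L[ℂ] H) := fun g => σ g
  let B : Γ → (K →L[ℂ] K) := fun g => κ (ρ g)
  have hBn : ∀ g, ‖B g‖ ≤ 1 := fun g => (hκn _).trans (ρ.norm_le_one g)
  have hA1 : A 1 = 1 := by simp only [A, map_one]; rfl
  have hB1 : B 1 = 1 := by
    simp only [B, map_one]; exact hκone
  have hAm : ∀ g h, A (g * h) = A g * A h := fun g h => by simp only [A, map_mul]; rfl
  have hBm : ∀ g h, B (g * h) = B g * B h := fun g h => by
    simp only [B, map_mul]; exact hκmul _ _
  let U : Γ →* ((H ⊗[ℂ] K) →ₗ[ℂ] (H ⊗[ℂ] K)) :=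
    { toFun := fun g => (TensorProduct.mapL (A g) (B g)).toLinearMap
      map_one' := by
        rw [hA1, hB1]
        exact congrArg ContinuousLinearMap.toLinearMap TensorProduct.mapL_id_id
      map_mul' := fun g h => by
        rw [hAm, hBm, TensorProduct.mapL_mul]; rfl }
  have hUapply : ∀ g x, U g x = TensorProduct.mapL (A g) (B g) x := fun g x => rfl
  have hUle : ∀ g x, ‖U g x‖ ≤ ‖x‖ := fun g x => by
    rw [hUapply]
    refine (ContinuousLinearMap.le_opNorm _ _).trans (mul_le_of_le_one_left (norm_nonneg _) ?_)
    exact (TensorProduct.norm_mapL_le _ _).trans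
      (mul_le_one₀ (σ.norm_le_one g) (norm_nonneg _) (hBn g))
  have hUinv : ∀ g x, U g⁻¹ (U g x) = x := fun g x => by
    rw [← Module.End.mul_apply, ← map_mul, inv_mul_cancel, map_one, Module.End.one_apply]
  have hUn : ∀ g x, ‖U g x‖ = ‖x‖ := fun g x =>
    le_antisymm (hUle g x) (by simpa only [hUinv] using hUle g⁻¹ (U g x))
  have hUin : ∀ g x y, ⟪U g x, y⟫_ℂ = ⟪x, U g⁻¹ y⟫_ℂ := fun g x y => by
    have := (LinearIsometry.mk (U g) (hUn g)).inner_map_map x (U g⁻¹ y)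
    rw [← this]
    change _ = ⟪U g x, U g (U g⁻¹ y)⟫_ℂ
    rw [← Module.End.mul_apply, ← map_mul, mul_inv_cancel, map_one, Module.End.one_apply]
  have hJv : ‖J v‖ = 1 := by
    rw [@norm_eq_sqrt_re_inner ℂ, hJ, ← @norm_eq_sqrt_re_inner ℂ, hv]
  let C : ℝ := ∑ g ∈ c.support, ‖c g‖
  have hC : 0 ≤ C := Finset.sum_nonneg fun g _ => norm_nonneg _
  obtain ⟨V, hV0, hV⟩ := hΓ.exists_almost_invariant U hUin (V₀ := e ⊗ₜ J v)
    (by rw [TensorProduct.norm_tmul, he, hJv, one_mul])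
    (fun g => by
      rw [hUapply, TensorProduct.mapL_tmul, TensorProduct.inner_tmul, hκJ, hJ, ← inner_conj_symm (_) v]
      exact hpos g) c.support (ε := 1 / (4 * (C + 1))) (by positivity)
  have hV1 : 0 < ‖V‖ := norm_pos_iff.2 hV0
  let R : (H →L[ℂ] H) →ₗ[ℂ] (H ⊗[ℂ] K →L[ℂ] H ⊗[ℂ] K) :=
    ⟨⟨fun T => T.rTensor K, ContinuousLinearMap.rTensor_add K⟩, ContinuousLinearMap.rTensor_smul K⟩
  let L : (K →L[ℂ] K) →ₗ[ℂ] (H ⊗[ℂ] K →L[ℂ] H ⊗[ℂ] K) :=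
    ⟨⟨fun T => T.lTensor H, ContinuousLinearMap.lTensor_add H⟩, ContinuousLinearMap.lTensor_smul H⟩
  have hR : ∀ T, ‖R T V‖ ≤ ‖T‖ * ‖V‖ := fun T => ((R T).le_opNorm V).trans
    (by gcongr; exact ContinuousLinearMap.norm_rTensor_le K T)
  have hL : ∀ T x, ‖L T x‖ ≤ ‖T‖ * ‖x‖ := fun T x => ((L T).le_opNorm x).trans
    (by gcongr; exact ContinuousLinearMap.norm_lTensor_le H T)
  let B' : K →L[ℂ] K := κ (star (ρ.sum c))
  have hB' : B' = ∑ g ∈ c.support, c g • B g⁻¹ := by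
    simp only [B', URep.sum, Finsupp.linearCombination_apply, Finsupp.sum, star_sum, map_sum, star_smul]
    refine Finset.sum_congr rfl fun g _ => ?_
    rw [LinearMap.map_smulₛₗ, Complex.star_def, Complex.conj_conj]
    simp only [B, map_inv]
    rfl
  have hdiff : ‖R (σ.sum c) V - L B' V‖ ≤ 1 / 4 * ‖V‖ := by
    have e1 : R (σ.sum c) V - L B' V =
        ∑ g ∈ c.support, c g • L (B g⁻¹) (U g V - V) := by
      rw [hB', URep.sum, Finsupp.linearCombination_apply, Finsupp.sum, map_sum, map_sum,
        sum_apply, sum_apply, ← Finset.sum_sub_distrib]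
      refine Finset.sum_congr rfl fun g _ => ?_
      rw [map_smul, map_smul, smul_apply, smul_apply, ← smul_sub, map_sub]
      congr 2
      rw [hUapply, ← ContinuousLinearMap.lTensor_comp_rTensor]
      change _ = (ContinuousLinearMap.lTensor H (B g⁻¹) * ContinuousLinearMap.lTensor H (B g))
        (ContinuousLinearMap.rTensor K (A g) V)
      rw [← ContinuousLinearMap.lTensor_mul, ← hBm, inv_mul_cancel, hB1,
        ContinuousLinearMap.lTensor_one]
      rfl
    rw [e1]
    refine (norm_sum_le _ _).trans ?_
    have h3 : ∀ g ∈ c.support, ‖c g • L (B g⁻¹) (U g V - V)‖ ≤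
        ‖c g‖ * (1 / (4 * (C + 1)) * ‖V‖) := fun g hg => by
      rw [norm_smul]
      gcongr
      refine (hL _ _).trans ?_
      refine (mul_le_of_le_one_left (norm_nonneg _) (hBn _)).trans (hV g hg)
    refine (Finset.sum_le_sum h3).trans ?_
    rw [← Finset.sum_mul, ← mul_assoc]
    gcongr
    change C * _ ≤ _
    rw [mul_one_div, div_le_div_iff₀ (by positivity) (by norm_num)]
    linarith
  have h3 : ‖R (σ.sum c) V‖ ≤ 1 / 4 * ‖V‖ := (hR _).trans (by gcongr)
  have h4 : ‖L B' V - V‖ ≤ 1 / 4 * ‖V‖ := by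
    have e1 : L B' V - V = L (κ (star (ρ.sum c - 1))) V := by
      rw [star_sub, star_one, map_sub, map_sub, hκone, sub_apply]
      congr 1
      change _ = ContinuousLinearMap.lTensor H 1 V
      rw [ContinuousLinearMap.lTensor_one]; rfl
    rw [e1]
    refine (hL _ _).trans ?_
    gcongr
    exact (hκn _).trans (by rwa [norm_star])
  have h5 : ‖V‖ ≤ ‖R (σ.sum c) V‖ + ‖R (σ.sum c) V - L B' V‖ + ‖L B' V - V‖ := by
    have : V = R (σ.sum c) V - (R (σ.sum c) V - L B' V) - (L B' V - V) := by abel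
    calc ‖V‖ = ‖R (σ.sum c) V - (R (σ.sum c) V - L B' V) - (L B' V - V)‖ := by rw [← this]
      _ ≤ _ := (norm_sub_le _ _).trans (by gcongr; exact norm_sub_le _ _)
  linarith

end keyLemma

section maximalKernel

variable {Γ : Type v} [Group Γ]

open scoped Pointwise in
open scoped Classical in
/-- Subgroups of amenable groups are amenable: one of the intersections of a Følner set with the right
cosets of the subgroup is a Følner set up to translation. -/
theorem IsAmenable.subgroup (hΓ : IsAmenable Γ) (Δ : Subgroup Γ) : IsAmenable Δ := by
  intro E ε hε
  let s : Γ → Quotient (QuotientGroup.rightRel Δ) := Quotient.mk _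
  have hs : ∀ x, x * (s x).out⁻¹ ∈ Δ := fun x =>
    QuotientGroup.rightRel_apply.1 (Quotient.mk_out (s := QuotientGroup.rightRel Δ) x)
  let D : Γ → Δ := fun x => ⟨x * (s x).out⁻¹, hs x⟩
  have hsmul : ∀ (g : Δ) x, s (g * x) = s x := fun g x => by
    refine Quotient.sound (s := QuotientGroup.rightRel Δ) (QuotientGroup.rightRel_apply.2 ?_)
    rw [mul_inv_rev, mul_inv_cancel_left]
    exact Δ.inv_mem g.2
  have hD : ∀ (g : Δ) x, D (g * x) = g * D x := fun g x => by
    refine Subtype.ext ?_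
    simp only [D, hsmul, Subgroup.coe_mul, mul_assoc]
  have hinj : ∀ x y, s x = s y → D x = D y → x = y := fun x y h1 h2 => by
    have h3 := congrArg Subtype.val h2
    simp only [D, h1] at h3
    exact mul_right_cancel h3
  obtain ⟨F, hFne, hF⟩ := hΓ (E.image Subtype.val) (ε / (E.card + 1)) (by positivity)
  let Fs : Quotient (QuotientGroup.rightRel Δ) → Finset Δ := fun t => (F.filter fun x => s x = t).image D
  have hFs : ∀ t, (Fs t).card = (F.filter fun x => s x = t).card := fun t =>
    Finset.card_image_of_injOn fun x hx y hy h => by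
      have hx := Finset.mem_coe.1 hx
      have hy := Finset.mem_coe.1 hy
      rw [Finset.mem_filter] at hx hy
      exact hinj x y (hx.2.trans hy.2.symm) h
  by_contra! hcon
  have hle : ∀ (g : Δ) t, (symmDiff (g • Fs t) (Fs t)).card ≤
      ((symmDiff ((g : Γ) • F) F).filter fun x => s x = t).card := by
    intro g t
    refine (Finset.card_le_card ?_).trans (Finset.card_image_le (f := D))
    intro d hd
    rw [Finset.mem_image]
    rcases Finset.mem_symmDiff.1 hd with ⟨h1, h2⟩ | ⟨h1, h2⟩
    · obtain ⟨d', hd', rfl⟩ := Finset.mem_smul_finset.1 h1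
      obtain ⟨x, hx, rfl⟩ := Finset.mem_image.1 hd'
      rw [Finset.mem_filter] at hx
      refine ⟨g * x, Finset.mem_filter.2 ⟨Finset.mem_symmDiff.2 (Or.inl ⟨?_, fun h => h2 ?_⟩),
        (hsmul g x).trans hx.2⟩, hD g x⟩
      · exact Finset.smul_mem_smul_finset hx.1
      · rw [smul_eq_mul, ← hD]
        exact Finset.mem_image_of_mem _ (Finset.mem_filter.2 ⟨h, (hsmul g x).trans hx.2⟩)
    · obtain ⟨x, hx, rfl⟩ := Finset.mem_image.1 h1
      rw [Finset.mem_filter] at hx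
      refine ⟨x, Finset.mem_filter.2 ⟨Finset.mem_symmDiff.2 (Or.inr ⟨hx.1, fun h => h2 ?_⟩), hx.2⟩, rfl⟩
      obtain ⟨y, hy, rfl⟩ := Finset.mem_smul_finset.1 h
      rw [smul_eq_mul, hD]
      refine Finset.smul_mem_smul_finset (Finset.mem_image_of_mem _ (Finset.mem_filter.2 ⟨hy, ?_⟩))
      rw [← hx.2]; exact (hsmul g y).symm
  have hlt : ∀ t ∈ F.image s, ε * ((F.filter fun x => s x = t).card : ℝ) <
      ∑ g ∈ E, (((symmDiff ((g : Γ) • F) F).filter fun x => s x = t).card : ℝ) := by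
    intro t ht
    obtain ⟨x, hx, hxt⟩ := Finset.mem_image.1 ht
    obtain ⟨g, hg, h1⟩ := hcon (Fs t)
      ⟨D x, Finset.mem_image_of_mem _ (Finset.mem_filter.2 ⟨hx, hxt⟩)⟩
    rw [hFs] at h1
    have h2 : ((symmDiff (g • Fs t) (Fs t)).card : ℝ) ≤
        (((symmDiff ((g : Γ) • F) F).filter fun x => s x = t).card : ℝ) := Nat.cast_le.2 (hle g t)
    have h3 : ε * ((F.filter fun x => s x = t).card : ℝ) < ((symmDiff (g • Fs t) (Fs t)).card : ℝ) := by
      refine lt_of_lt_of_eq h1 ?_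
      congr!
    refine h3.trans_le (h2.trans ?_)
    exact Finset.single_le_sum (f := fun g : Δ =>
      (((symmDiff ((g : Γ) • F) F).filter fun x => s x = t).card : ℝ)) (fun _ _ => Nat.cast_nonneg _) hg
  have hsum := Finset.sum_lt_sum_of_nonempty (hFne.image s) hlt
  rw [← Finset.mul_sum, Finset.sum_comm, ← Nat.cast_sum,
    ← Finset.card_eq_sum_card_fiberwise fun x hx => Finset.mem_coe.2 (Finset.mem_image_of_mem s
      (Finset.mem_coe.1 hx))] at hsum
  have h2 : ∀ g ∈ E, ∑ t ∈ F.image s, (((symmDiff ((g : Γ) • F) F).filter fun x => s x = t).card : ℝ) ≤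
      ε / (E.card + 1) * F.card := by
    intro g hg
    rw [← Nat.cast_sum, ← Finset.card_eq_sum_card_fiberwise]
    · exact hF g (Finset.mem_image_of_mem _ hg)
    · intro x hx
      rcases Finset.mem_symmDiff.1 (Finset.mem_coe.1 hx) with ⟨h1, -⟩ | ⟨h1, -⟩
      · obtain ⟨y, hy, rfl⟩ := Finset.mem_smul_finset.1 h1
        rw [smul_eq_mul, Finset.mem_coe, hsmul]
        exact Finset.mem_image_of_mem s hy
      · exact Finset.mem_coe.2 (Finset.mem_image_of_mem s h1)
  have h3 := hsum.trans_le (Finset.sum_le_sum h2)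
  rw [Finset.sum_const, nsmul_eq_mul] at h3
  have h4 : (E.card : ℝ) * (ε / (E.card + 1) * F.card) ≤ ε * F.card := by
    rw [← mul_assoc]
    gcongr
    rw [mul_div_assoc', div_le_iff₀ (by positivity)]
    nlinarith
  exact absurd h3 (not_lt.2 h4)

/-- The closure of the sum of two ideals. -/
lemma exists_ideal_closure_sup (I J : TwoSidedIdeal (GroupCStar Γ)) :
    ∃ N : TwoSidedIdeal (GroupCStar Γ), (N : Set (GroupCStar Γ)) =
      closure {a | ∃ i ∈ I, ∃ j ∈ J, a = i + j} := by
  let N₀ : Submodule ℂ (GroupCStar Γ) := idealSubmodule I ⊔ idealSubmodule J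
  have hN₀ : (N₀ : Set (GroupCStar Γ)) = {a | ∃ i ∈ I, ∃ j ∈ J, a = i + j} := by
    ext a
    constructor
    · intro h
      obtain ⟨i, hi, j, hj, rfl⟩ := Submodule.mem_sup.1 h
      exact ⟨i, hi, j, hj, rfl⟩
    · rintro ⟨i, hi, j, hj, rfl⟩
      exact Submodule.mem_sup.2 ⟨i, hi, j, hj, rfl⟩
  refine ⟨TwoSidedIdeal.mk' (closure (N₀ : Set (GroupCStar Γ)))
    N₀.topologicalClosure.zero_mem N₀.topologicalClosure.add_mem N₀.topologicalClosure.neg_mem (fun {a b} hb => ?_) (fun {a b} ha => ?_), ?_⟩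
  · refine map_mem_closure (s := (N₀ : Set (GroupCStar Γ))) (t := (N₀ : Set (GroupCStar Γ)))
      (f := fun b => a * b) (by fun_prop) hb fun b hb => ?_
    rw [hN₀] at hb ⊢
    obtain ⟨i, hi, j, hj, rfl⟩ := hb
    exact ⟨a * i, I.mul_mem_left _ _ hi, a * j, J.mul_mem_left _ _ hj, mul_add _ _ _⟩
  · refine map_mem_closure (s := (N₀ : Set (GroupCStar Γ))) (t := (N₀ : Set (GroupCStar Γ)))
      (f := fun a => a * b) (by fun_prop) ha fun a ha => ?_
    rw [hN₀] at ha ⊢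
    obtain ⟨i, hi, j, hj, rfl⟩ := ha
    exact ⟨i * b, I.mul_mem_right _ _ hi, j * b, J.mul_mem_right _ _ hj, add_mul _ _ _⟩
  · refine Eq.trans (TwoSidedIdeal.coe_mk' _ _ _ _ _ _) ?_
    rw [hN₀]

variable {H K : Type v} [NormedAddCommGroup H] [InnerProductSpace ℂ H] [CompleteSpace H]
  [NormedAddCommGroup K] [InnerProductSpace ℂ K] [CompleteSpace K]

/-- Let `φ` be a state on `C*_ρ(Γ)`, where `Γ` is amenable and the kernel of `ρ` is maximal. A representation
with a vector state whose product with `φ̄` is a nonnegative function weakly contains `ρ`. -/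
theorem IsAmenable.ker_le_of_isMaximalIdeal (hΓ : IsAmenable Γ) {ρ : URep Γ K}
    (hρ : IsMaximalIdeal ρ.ker) {φ : State Γ} (hφ : φ.IsOn ρ) (σ : URep Γ H) {e : H} (he : ‖e‖ = 1)
    (hpos : ∀ g, 0 ≤ ⟪e, (σ g : H →L[ℂ] H) e⟫_ℂ * starRingEnd ℂ (φ.evalAt g)) : σ.ker ≤ ρ.ker := by
  by_contra hle
  obtain ⟨N, hN⟩ := exists_ideal_closure_sup σ.ker ρ.ker
  have hclosed : IsClosed (N : Set (GroupCStar Γ)) := by rw [hN]; exact isClosed_closure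
  have hsub : ∀ i ∈ σ.ker, ∀ j ∈ ρ.ker, i + j ∈ N := fun i hi j hj => by
    rw [← SetLike.mem_coe, hN]
    exact subset_closure ⟨i, hi, j, hj, rfl⟩
  have hlt : ρ.ker < N := by
    refine lt_of_le_of_ne (fun j hj => ?_) fun h => hle fun i hi => ?_
    · have := hsub 0 (TwoSidedIdeal.zero_mem _) j hj
      rwa [zero_add] at this
    · rw [h]
      have := hsub i hi 0 (TwoSidedIdeal.zero_mem _)
      rwa [add_zero] at this
  have h1 : gElt 1 ∈ (N : Set (GroupCStar Γ)) := by
    rw [hρ.2.2 N hclosed hlt]; trivial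
  rw [hN] at h1
  obtain ⟨_, ⟨i, hi, j, hj, rfl⟩, hij⟩ := Metric.mem_closure_iff.1 h1 (1 / 8) (by norm_num)
  obtain ⟨_, ⟨c, rfl⟩, hc⟩ := Metric.mem_closure_iff.1 (denseRange_groupSum (Γ := Γ) i) (1 / 8) (by norm_num)
  rw [dist_eq_norm] at hij hc
  refine hΓ.not_norm_sum_le σ φ.gns he φ.norm_vec (fun g => ?_) c ?_ ?_
  · rw [φ.inner_vec_apply]; exact hpos g
  · have e1 : σ.sum c = -σ.toCStar (i - groupSum c) := by
      rw [map_sub, (URep.mem_ker _ _).1 hi, zero_sub, neg_neg, URep.toCStar_groupSum]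
    rw [e1, norm_neg]
    linarith [σ.norm_toCStar_le (i - groupSum c)]
  · have hj' : φ.gns.toCStar j = 0 := (URep.mem_ker _ _).1 (State.ker_le_of_isOn hφ hj)
    have e1 : φ.gns.sum c - 1 = -φ.gns.toCStar (i - groupSum c) - φ.gns.toCStar (gElt 1 - (i + j)) := by
      rw [map_sub, map_sub, map_add, hj', URep.toCStar_one, URep.toCStar_groupSum]
      abel
    rw [e1]
    have := norm_sub_le (-φ.gns.toCStar (i - groupSum c)) (φ.gns.toCStar (gElt 1 - (i + j)))
    rw [norm_neg] at this
    linarith [φ.gns.norm_toCStar_le (i - groupSum c), φ.gns.norm_toCStar_le (gElt 1 - (i + j))]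

end maximalKernel

/-! ### Vectors supported on a single coset in an induced representation -/

section pointVectors

namespace IndSpace

section algebra

variable {X : Type w} [Groupoid.{v} X] {x : X} {S : Type*} [Group S] {ι : S →* End x}
  {hι : Function.Injective ι} {H : Type*} [NormedAddCommGroup H] [InnerProductSpace ℂ H]
  [CompleteSpace H] {π : URep S H}

open scoped Classical in
/-- The function on `𝒢_x` which is supported on the coset of `g` and takes the value `ζ` at `g`. -/
def pointFn (ι : S →* End x) (π : URep S H) (g : SrcFib x) (ζ : H) (k : SrcFib x) : H :=
  if h : ∃ s : S, k = rmul g (ι s) then star (π h.choose : H →L[ℂ] H) ζ else 0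

lemma pointFn_rmul (hι : Function.Injective ι) (g : SrcFib x) (ζ : H) (s : S) :
    pointFn ι π g ζ (rmul g (ι s)) = star (π s : H →L[ℂ] H) ζ := by
  have h : ∃ t : S, rmul g (ι s) = rmul g (ι t) := ⟨s, rfl⟩
  rw [pointFn, dif_pos h]
  have : h.choose = s := (hι (rmul_injective g h.choose_spec)).symm
  rw [this]

lemma pointFn_of_forall_ne (g : SrcFib x) (ζ : H) (k : SrcFib x) (h : ∀ s, k ≠ rmul g (ι s)) :
    pointFn ι π g ζ k = 0 := dif_neg fun ⟨s, hs⟩ => h s hs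

lemma pointFn_mem (hι : Function.Injective ι) (g : SrcFib x) (ζ : H) :
    pointFn ι π g ζ ∈ indFun ι π := by
  refine ⟨fun k s => ?_, ?_⟩
  · by_cases h : ∃ t : S, k = rmul g (ι t)
    · obtain ⟨t, rfl⟩ := h
      rw [← rmul_mul, ← map_mul, pointFn_rmul hι, pointFn_rmul hι, star_unitary_mul]
      rfl
    · rw [pointFn_of_forall_ne, pointFn_of_forall_ne, map_zero]
      · exact fun t ht => h ⟨t, ht⟩
      · intro t ht
        refine h ⟨t * s⁻¹, ?_⟩
        rw [map_mul, rmul_mul, ← ht, ← rmul_mul, ← map_mul, mul_inv_cancel, map_one, rmul_one]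
  · refine memℓp_gen ?_
    refine summable_of_hasFiniteSupport ((Set.finite_singleton
      (Quotient.mk (cosetSetoid ι) g)).subset fun q hq => ?_)
    by_contra hne
    refine hq ?_
    change ‖pointFn ι π g ζ q.out‖ ^ _ = 0
    rw [pointFn_of_forall_ne]
    · simp
    · intro s hs
      refine hne ?_
      rw [Set.mem_singleton_iff, ← Quotient.out_eq q, hs]
      exact (Quotient.sound ⟨s, rfl⟩ : Quotient.mk (cosetSetoid ι) g = _).symm

/-- The vector of the induced representation which is supported on the coset of `g` and takes the
value `ζ` at `g`. -/
def point (g : SrcFib x) (ζ : H) : IndSpace ι π hι := ⟨pointFn ι π g ζ, pointFn_mem hι g ζ⟩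

lemma point_fn_rmul (g : SrcFib x) (ζ : H) (s : S) :
    (point g ζ : IndSpace ι π hι).fn (rmul g (ι s)) = star (π s : H →L[ℂ] H) ζ :=
  pointFn_rmul hι g ζ s

lemma point_fn_of_forall_ne (g : SrcFib x) (ζ : H) (k : SrcFib x) (h : ∀ s, k ≠ rmul g (ι s)) :
    (point g ζ : IndSpace ι π hι).fn k = 0 := pointFn_of_forall_ne g ζ k h

lemma point_fn_self (g : SrcFib x) (ζ : H) : (point g ζ : IndSpace ι π hι).fn g = ζ := by
  have := point_fn_rmul (hι := hι) (π := π) g ζ 1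
  rw [map_one, rmul_one, map_one] at this
  simpa using this

end algebra

section topology

variable {X : Type w} [Groupoid.{v} X] [TopologicalSpace X] [TopologicalSpace (Arr X)]
  [EtaleGroupoid X] [T2Space (Arr X)] [LocallyCompactSpace (Arr X)]
  {x : X} {S : Type*} [Group S] {ι : S →* End x} {hι : Function.Injective ι}
  {H : Type*} [NormedAddCommGroup H] [InnerProductSpace ℂ H] [CompleteSpace H] {π : URep S H}

lemma inner_point (ξ : IndSpace ι π hι) (g : SrcFib x) (ζ : H) :
    ⟪ξ, point g ζ⟫_ℂ = ⟪ξ.fn g, ζ⟫_ℂ := by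
  rw [inner_eq, tsum_eq_single (Quotient.mk (cosetSetoid ι) g), inner_coset, point_fn_self]
  intro q hq
  rw [point_fn_of_forall_ne, inner_zero_right]
  intro s hs
  refine hq ?_
  rw [← Quotient.out_eq q, hs]
  exact (Quotient.sound ⟨s, rfl⟩ : Quotient.mk (cosetSetoid ι) g = _).symm

lemma inner_point_point (g : SrcFib x) (ζ ζ' : H) :
    ⟪(point g ζ : IndSpace ι π hι), point g ζ'⟫_ℂ = ⟪ζ, ζ'⟫_ℂ := by
  rw [inner_point, point_fn_self]

lemma norm_point (g : SrcFib x) (ζ : H) : ‖(point g ζ : IndSpace ι π hι)‖ = ‖ζ‖ := by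
  rw [@norm_eq_sqrt_re_inner ℂ, inner_point_point, ← @norm_eq_sqrt_re_inner ℂ]

lemma eq_zero_of_inner_point (ξ : IndSpace ι π hι)
    (h : ∀ g ζ, ⟪ξ, point g ζ⟫_ℂ = 0) : ξ = 0 := by
  refine fn_injective (funext fun g => ?_)
  refine (inner_self_eq_zero (𝕜 := ℂ)).1 ?_
  rw [← inner_point]; exact h g _

/-- The vectors `point g ζ` are total, so that an operator is determined by its matrix coefficients at
these vectors. -/
lemma op_eq_zero (T : IndSpace ι π hι →L[ℂ] IndSpace ι π hι)
    (h : ∀ g ζ g' ζ', ⟪T (point g ζ), point g' ζ'⟫_ℂ = 0) : T = 0 := by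
  have h1 : ∀ g ζ, T (point g ζ) = 0 := fun g ζ => eq_zero_of_inner_point _ fun g' ζ' => h g ζ g' ζ'
  ext ξ
  have h2 : ContinuousLinearMap.adjoint T (T ξ) = 0 := eq_zero_of_inner_point _ fun g ζ => by
    rw [ContinuousLinearMap.adjoint_inner_left, h1, inner_zero_right]
  have h3 : ⟪T ξ, T ξ⟫_ℂ = 0 := by
    rw [← ContinuousLinearMap.adjoint_inner_left, h2, inner_zero_left]
  rw [inner_self_eq_zero.1 h3]; rfl

/-- The unit at `x` as an arrow with source `x`. -/
def _root_.SrcFib.one (x : X) : SrcFib x := ⟨x, 𝟙 x⟩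

/-- A function supported in an open bisection, with the value one at an arrow `g`, moves the vector
`ζ` at the unit to the vector `ζ` at `g`. -/
lemma op_point_one (q : ConvAlg X) {W : Set (Arr X)} (hW : Arr.IsBisection W)
    (hq : Function.support q.fn ⊆ W) (g : SrcFib x) (hg : q.fn g.arr = 1) (ζ : H) :
    (op q (point (SrcFib.one x) ζ) : IndSpace ι π hι) = point g ζ := by
  refine fn_injective (funext fun k => ?_)
  rw [op_fn]
  have hgW : g.arr ∈ W := hq (by rw [Function.mem_support, hg]; exact one_ne_zero)
  by_cases hk : ∃ s : S, k = rmul g (ι s)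
  · obtain ⟨s, rfl⟩ := hk
    obtain ⟨z, g⟩ := g
    have h1 := convAct_eq_single hW hq (point (SrcFib.one x) ζ : IndSpace ι π hι).fn
      (rmul ⟨z, g⟩ (ι s)) ⟨x, g⟩ hgW
    rw [h1, point_fn_rmul]
    have h2 : q.fn (RngFib.arr (y := z) ⟨x, g⟩) = 1 := hg
    have h3 : ldiv (rmul ⟨z, g⟩ (ι s)) (⟨x, g⟩ : RngFib z) = rmul (SrcFib.one x) (ι s) := by
      simp [ldiv, rmul, SrcFib.one]
    refine Eq.trans (congrArg₂ (fun a b => a • b) h2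
      (congrArg (point (SrcFib.one x) ζ : IndSpace ι π hι).fn h3)) ?_
    rw [one_smul, point_fn_rmul]
  · rw [point_fn_of_forall_ne _ _ _ fun s hs => hk ⟨s, hs⟩]
    refine (tsum_congr fun h => ?_).trans tsum_zero
    by_contra h0
    obtain ⟨h1, h2⟩ := smul_ne_zero_iff.1 h0
    have h3 : ∃ s : S, ldiv k h = rmul (SrcFib.one x) (ι s) := by
      by_contra! h4
      exact h2 (point_fn_of_forall_ne _ _ _ h4)
    obtain ⟨s, hs⟩ := h3
    have h4 : h.1 = x := congrArg Sigma.fst hs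
    have h5 : h.arr = g.arr := hW.1 (hq h1) hgW h4
    refine hk ⟨s, ?_⟩
    obtain ⟨z, g⟩ := g
    obtain ⟨z', k⟩ := k
    obtain ⟨y, h⟩ := h
    simp only [RngFib.arr, SrcFib.arr, Arr.mk.injEq] at h5
    obtain ⟨rfl, rfl, h5⟩ := h5
    have h5 := eq_of_heq h5
    subst h5
    simp only [ldiv, rmul, SrcFib.one, Sigma.mk.injEq, heq_eq_eq, true_and] at hs ⊢
    rw [Category.comp_id] at hs
    rw [← hs]; simp

end topology

end IndSpace

end pointVectors

/-! ### Restriction of functions to isotropy groups -/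

section restriction

section group

variable {Γ : Type v} [Group Γ]

lemma groupSum_eq_toCompl (c : Γ →₀ ℂ) :
    groupSum c = PreCStarAlg.toCompl (c.sum fun g z => z • delta g) := by
  let T : ConvAlg (SingleObj Γ) →ₗ[ℂ] GroupCStar Γ := ⟨⟨PreCStarAlg.toCompl,
    PreCStarAlg.toCompl_add⟩, PreCStarAlg.toCompl_smul⟩
  change _ = T _
  rw [map_finsuppSum]
  simp only [map_smul]
  rfl

/-- The norm of a finitely supported element is determined by the unitary representations: a
representation of the convolution algebra becomes unital after adding a multiple of the trivial
representation on the orthogonal complement of its essential subspace. -/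
lemma norm_groupSum_le_of_urep (c : Γ →₀ ℂ) {C : ℝ} (hC : 0 ≤ C)
    (h : ∀ (H : Type v) [NormedAddCommGroup H] [InnerProductSpace ℂ H] [CompleteSpace H]
      (κ : URep Γ H), ‖κ.sum c‖ ≤ C) : ‖groupSum c‖ ≤ C := by
  rw [groupSum_eq_toCompl, PreCStarAlg.norm_toCompl, ConvAlg.norm_eq_repNorm]
  refine ConvAlg.repNorm_le hC fun H _ _ _ σ => ?_
  let p : H →L[ℂ] H := σ (delta (1 : Γ))
  let s : Γ → (H →L[ℂ] H) := fun g => σ (delta g)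
  have hs : ∀ g h, s g * s h = s (g * h) := fun g h => by
    simp only [s]; rw [← map_mul, delta_mul]
  have hp1 : ∀ g, s g * p = s g := fun g => by
    have := hs g 1; rwa [mul_one] at this
  have hp2 : ∀ g, p * s g = s g := fun g => by
    have := hs 1 g; rwa [one_mul] at this
  have hpp : p * p = p := hp1 1
  have hstar : ∀ g, star (s g) = s g⁻¹ := fun g => by
    simp only [s]; rw [← map_star, star_delta]
  let u : Γ →* (H →L[ℂ] H) :=
    { toFun := fun g => s g + (1 - p)
      map_one' := add_sub_cancel _ _
      map_mul' := fun g h => by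
        have e : (s g + (1 - p)) * (s h + (1 - p)) = s g * s h + (s g - s g * p) +
          (s h - p * s h) + (1 - p - p + p * p) := by noncomm_ring
        rw [e, hs, hp1, hp2, hpp]; abel }
  let κ : URep Γ H := URep.ofHom u fun g ξ η => by
    have e : star (s g + (1 - p)) = s g⁻¹ + (1 - p) := by
      have h1 : star p = p := by
        have := hstar 1; rwa [inv_one] at this
      rw [star_add, star_sub, star_one, h1, hstar]
    have e2 := ContinuousLinearMap.adjoint_inner_right (u g) ξ η
    rw [← e2, ← ContinuousLinearMap.star_eq_adjoint]
    exact congrArg (fun T : H →L[ℂ] H => ⟪ξ, T η⟫_ℂ) e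
  have hκ : ∀ g, (κ g : H →L[ℂ] H) * p = s g := fun g => by
    change (s g + (1 - p)) * p = s g
    rw [add_mul, sub_mul, one_mul, hpp, sub_self, add_zero, hp1]
  have hsum : σ (c.sum fun g z => z • delta g) = κ.sum c * p := by
    rw [map_finsuppSum, URep.sum, Finsupp.linearCombination_apply, Finsupp.sum_mul]
    refine Finsupp.sum_congr fun g _ => ?_
    rw [map_smul, smul_mul_assoc, hκ]
  have hp : ‖p‖ ≤ 1 := by
    have h1 : ‖p‖ * ‖p‖ = ‖p‖ := by
      rw [← CStarRing.norm_star_mul_self]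
      have : star p = p := by
        have := hstar 1; rwa [inv_one] at this
      rw [this, hpp]
    nlinarith [norm_nonneg p]
  rw [hsum]
  refine (norm_mul_le _ _).trans ((mul_le_of_le_one_right (norm_nonneg _) hp).trans (h H κ))

end group

variable {X : Type u} [Groupoid.{u} X] [TopologicalSpace X] [TopologicalSpace (Arr X)]
  [EtaleGroupoid X] [T2Space (Arr X)] [LocallyCompactSpace (Arr X)]

/-- The restriction of a function on the groupoid to an isotropy group. -/
def isoCoeff (z : X) (f : ConvAlg X) : End z →₀ ℂ :=
  Finsupp.ofSupportFinite (fun a => f.fn (isoArr a)) <| by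
    refine Set.Finite.of_finite_image (f := fun a : End z => (⟨z, a⟩ : RngFib z))
      ((f.fibFin z).subset ?_) ?_
    · rintro _ ⟨a, ha, rfl⟩; exact ha
    · intro a _ b _ h
      simpa using h

lemma isoCoeff_apply (z : X) (f : ConvAlg X) (a : End z) : isoCoeff z f a = f.fn (isoArr a) := rfl

lemma conjRep_one {z : X} {H : Type u} [NormedAddCommGroup H] [InnerProductSpace ℂ H]
    [CompleteSpace H] (π : URep (End z) H) : conjRep (𝟙 z) π = π := by
  ext1 a
  refine congrArg π ?_
  change 𝟙 z ≫ (show z ⟶ z from a) ≫ Groupoid.inv (𝟙 z) = a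
  simp

open IndSpace in
/-- At an arrow `g : y ⟶ z`, a function on the groupoid acts on a function on `𝒢_y` through the restriction
to the isotropy group at `z`, provided that no other arrows contribute. -/
lemma op_fn_eq_sum {y z : X} (g : y ⟶ z) {H : Type u} [NormedAddCommGroup H]
    [InnerProductSpace ℂ H] [CompleteSpace H] {π : URep (End y) H} (f : ConvAlg X)
    (ξ : IndSpace (MonoidHom.id (End y)) π Function.injective_id)
    (hs : ∀ h : RngFib z, f.fn h.arr • ξ.fn (ldiv (⟨z, g⟩ : SrcFib y) h) ≠ 0 → h.1 = z) :
    (op f ξ).fn ⟨z, g⟩ = (conjRep g π).sum (isoCoeff z f) (ξ.fn ⟨z, g⟩) := by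
  rw [op_fn]
  let i : End z → RngFib z := fun a => ⟨z, a⟩
  have hi : Function.Injective i := fun a b h => by simpa [i] using h
  let F : RngFib z → H := fun h => f.fn h.arr • ξ.fn (ldiv (⟨z, g⟩ : SrcFib y) h)
  have hF : ∀ a, F (i a) = isoCoeff z f a • ((conjRep g π) a : H →L[ℂ] H) (ξ.fn ⟨z, g⟩) := by
    intro a
    let s : End y := g ≫ Groupoid.inv (show z ⟶ z from a) ≫ Groupoid.inv g
    let t : End y := g ≫ (show z ⟶ z from a) ≫ Groupoid.inv g
    have hst : s⁻¹ = t := by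
      refine inv_eq_of_mul_eq_one_right ?_
      change t ≫ s = 𝟙 y
      simp [s, t]
    have h1 : ldiv (⟨z, g⟩ : SrcFib y) (i a) = rmul (⟨z, g⟩ : SrcFib y) (MonoidHom.id (End y) s) := by
      simp [ldiv, rmul, i, s]
    have h2 : star (π s : H →L[ℂ] H) = π t := by
      rw [← hst, map_inv]; rfl
    simp only [F]
    rw [h1, equivariant, h2]
    rfl
  have hsupp : Function.support F ⊆ Set.range i := by
    intro h hh
    have h4 := hs h hh
    obtain ⟨z', h⟩ := h
    obtain rfl : z' = z := h4
    exact ⟨h, rfl⟩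
  change ∑' h, F h = _
  rw [← hi.tsum_eq hsupp]
  simp only [hF]
  rw [tsum_eq_sum (s := (isoCoeff z f).support), URep.sum, Finsupp.linearCombination_apply,
    Finsupp.sum, sum_apply]
  · rfl
  · intro a ha
    rw [Finsupp.notMem_support_iff.1 ha, zero_smul]

open IndSpace in
/-- The matrix coefficients of an induced representation at vectors supported at an arrow `g` are
those of the conjugate representation on the restriction to the isotropy group. -/
lemma inner_op_point {y z : X} (g : y ⟶ z) {H : Type u} [NormedAddCommGroup H]
    [InnerProductSpace ℂ H] [CompleteSpace H] (π : URep (End y) H) (f : ConvAlg X) (ζ ζ' : H) :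
    ⟪op f (point ⟨z, g⟩ ζ : IndSpace (MonoidHom.id (End y)) π Function.injective_id),
      point ⟨z, g⟩ ζ'⟫_ℂ = ⟪(conjRep g π).sum (isoCoeff z f) ζ, ζ'⟫_ℂ := by
  rw [inner_point, op_fn_eq_sum, point_fn_self]
  intro h hh
  by_contra hne
  refine hh ?_
  rw [point_fn_of_forall_ne, smul_zero]
  exact fun s hs => hne (congrArg Sigma.fst hs)

lemma norm_groupSum_isoCoeff_le (z : X) (f : ConvAlg X) : ‖groupSum (isoCoeff z f)‖ ≤ ‖f‖ := by
  refine norm_groupSum_le_of_urep _ (norm_nonneg f) fun H _ _ _ κ => ?_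
  have hle : ‖indConv (MonoidHom.id (End z)) Function.injective_id κ f‖ ≤ ‖f‖ := ConvAlg.le_repNorm f _
  have h1 : ∀ ζ ζ', ‖⟪κ.sum (isoCoeff z f) ζ, ζ'⟫_ℂ‖ ≤ ‖f‖ * ‖ζ‖ * ‖ζ'‖ := by
    intro ζ ζ'
    have h2 := inner_op_point (𝟙 z) κ f ζ ζ'
    rw [conjRep_one] at h2
    rw [← h2]
    refine (norm_inner_le_norm _ _).trans ?_
    rw [IndSpace.norm_point]
    gcongr
    refine (ContinuousLinearMap.le_opNorm _ _).trans ?_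
    rw [IndSpace.norm_point]
    gcongr
    exact hle
  refine ContinuousLinearMap.opNorm_le_bound _ (norm_nonneg _) fun ζ => ?_
  have h2 := h1 ζ (κ.sum (isoCoeff z f) ζ)
  rw [inner_self_eq_norm_sq_to_K] at h2
  rcases (norm_nonneg (κ.sum (isoCoeff z f) ζ)).eq_or_lt with h0 | h0
  · rw [← h0]; positivity
  · rw [norm_pow, RCLike.norm_ofReal, abs_norm, sq] at h2
    exact le_of_mul_le_mul_right h2 h0

/-- The restriction of functions to an isotropy group, as a linear map on `C_c(𝒢)`. -/
def resConv (z : X) : ConvAlg X →L[ℂ] GroupCStar (End z) :=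
  LinearMap.mkContinuous
    { toFun := fun f => groupSum (isoCoeff z f)
      map_add' := fun f g => by
        rw [← map_add]; congr 1; ext a; simp [isoCoeff_apply]
      map_smul' := fun c f => by
        rw [RingHom.id_apply, ← map_smul]; congr 1; ext a; simp [isoCoeff_apply] } 1
    fun f => by rw [one_mul]; exact norm_groupSum_isoCoeff_le z f

/-- The contraction `C*(𝒢) → C*(𝒢^z_z)` which extends the restriction of functions to the isotropy group. -/
def resCStar (z : X) : GpdCStar X →L[ℂ] GroupCStar (End z) :=
  (resConv z).extend (UniformSpace.Completion.toComplL : ConvAlg X →L[ℂ] GpdCStar X)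

lemma resCStar_toCompl (z : X) (f : ConvAlg X) :
    resCStar z (PreCStarAlg.toCompl f) = groupSum (isoCoeff z f) :=
  ContinuousLinearMap.extend_eq _ PreCStarAlg.denseRange_toCompl
    (UniformSpace.Completion.isUniformInducing_coe _) f

lemma toCStar_toCompl {X : Type w} [Groupoid.{v} X] [TopologicalSpace X] [TopologicalSpace (Arr X)]
    [EtaleGroupoid X] [T2Space (Arr X)] [LocallyCompactSpace (Arr X)] {H : Type max v w}
    [NormedAddCommGroup H] [InnerProductSpace ℂ H] [CompleteSpace H]
    (σ : ConvRep X H) (f : ConvAlg X) : σ.toCStar (PreCStarAlg.toCompl f) = σ f :=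
  PreCStarAlg.extend_toCompl _ _ f

lemma isoIndRep_toCompl {y : X} {H : Type u} [NormedAddCommGroup H] [InnerProductSpace ℂ H]
    [CompleteSpace H] (π : URep (End y) H) (f : ConvAlg X) :
    isoIndRep π (PreCStarAlg.toCompl f) = IndSpace.op f := toCStar_toCompl _ f

lemma continuous_isoIndRep {y : X} {H : Type u} [NormedAddCommGroup H] [InnerProductSpace ℂ H]
    [CompleteSpace H] (π : URep (End y) H) : Continuous (isoIndRep π) := continuous_rep _

lemma inner_isoIndRep_point {y z : X} (g : y ⟶ z) {H : Type u} [NormedAddCommGroup H]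
    [InnerProductSpace ℂ H] [CompleteSpace H] (π : URep (End y) H) (a : GpdCStar X) (ζ ζ' : H) :
    ⟪isoIndRep π a (IndSpace.point ⟨z, g⟩ ζ), IndSpace.point ⟨z, g⟩ ζ'⟫_ℂ =
      ⟪(conjRep g π).toCStar (resCStar z a) ζ, ζ'⟫_ℂ := by
  refine PreCStarAlg.compl_induction (p := fun a => ⟪isoIndRep π a (IndSpace.point ⟨z, g⟩ ζ),
    IndSpace.point ⟨z, g⟩ ζ'⟫_ℂ = ⟪(conjRep g π).toCStar (resCStar z a) ζ, ζ'⟫_ℂ) a ?_ fun f => ?_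
  · have h1 := continuous_isoIndRep π
    have h2 := (conjRep g π).continuous_toCStar
    exact isClosed_eq ((h1.clm_apply continuous_const).inner continuous_const)
      (((h2.comp (resCStar z).continuous).clm_apply continuous_const).inner continuous_const)
  · rw [isoIndRep_toCompl, resCStar_toCompl, URep.toCStar_groupSum]
    exact inner_op_point g π f ζ ζ'

/-- An element which vanishes in an induced representation restricts to an element which vanishes in
the conjugate representations. -/
lemma toCStar_resCStar_eq_zero {y z : X} (g : y ⟶ z) {H : Type u} [NormedAddCommGroup H]
    [InnerProductSpace ℂ H] [CompleteSpace H] (π : URep (End y) H) {a : GpdCStar X}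
    (ha : isoIndRep π a = 0) : (conjRep g π).toCStar (resCStar z a) = 0 := by
  ext ζ
  refine ext_inner_right ℂ fun ζ' => ?_
  rw [← inner_isoIndRep_point, ha]
  simp

/-! ### Functions supported in bisections -/

lemma isBisection_inv {W : Set (Arr X)} (hW : Arr.IsBisection W) :
    Arr.IsBisection (Arr.inv ⁻¹' W) :=
  ⟨fun a ha b hb h => by
    have := hW.2 ha hb h
    rw [← a.inv_inv, this, b.inv_inv],
  fun a ha b hb h => by
    have := hW.1 ha hb h
    rw [← a.inv_inv, this, b.inv_inv]⟩

/-- A continuous function with compact support in a given open set which is equal to one near a given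
point, with values in `[0, 1]`. -/
lemma exists_bump {W : Set (Arr X)} (hW : IsOpen W) {g : Arr X} (hg : g ∈ W) :
    ∃ q : ConvAlg X, tsupport q.fn ⊆ W ∧ (∃ V, IsOpen V ∧ g ∈ V ∧ ∀ a ∈ V, q.fn a = 1) ∧
      (∀ a, ‖q.fn a‖ ≤ 1) := by
  obtain ⟨K, hK, hgK, hKW⟩ := exists_compact_subset hW hg
  obtain ⟨L, hL, hKL, hLW⟩ := exists_compact_between hK hW hKW
  obtain ⟨f, hf1, hf0, hfc, hf01⟩ := exists_continuous_one_zero_of_isCompact hK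
    isOpen_interior.isClosed_compl (Set.disjoint_compl_right_iff_subset.2 hKL)
  let F : C_c(Arr X, ℂ) :=
    { toFun := fun a => (f a : ℂ)
      continuous_toFun := Complex.continuous_ofReal.comp f.continuous
      hasCompactSupport' := hfc.comp_left (g := fun t : ℝ => (t : ℂ)) Complex.ofReal_zero }
  refine ⟨F, ?_, ⟨interior K, isOpen_interior, hgK, fun a ha => ?_⟩, fun a => ?_⟩
  · refine (closure_minimal ?_ hL.isClosed).trans hLW
    intro a ha
    by_contra h
    refine ha ?_
    change ((f a : ℝ) : ℂ) = 0
    rw [hf0 fun h' => h (interior_subset h')]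
    simp
  · change ((f a : ℝ) : ℂ) = 1
    rw [hf1 (interior_subset ha)]
    simp
  · change ‖((f a : ℝ) : ℂ)‖ ≤ 1
    rw [Complex.norm_real, Real.norm_eq_abs, abs_of_nonneg (hf01 a).1]
    exact (hf01 a).2


end restriction

section conjugation

variable {X : Type u} [Groupoid.{u} X] [TopologicalSpace X] [TopologicalSpace (Arr X)]
  [EtaleGroupoid X] [T2Space (Arr X)] [LocallyCompactSpace (Arr X)] {x : X}

lemma gElt_mul_groupSum {Γ : Type v} [Group Γ] (t : Γ) (c : Γ →₀ ℂ) :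
    gElt t * groupSum c = groupSum (c.mapDomain (t * ·)) := by
  rw [groupSum, Finsupp.linearCombination_mapDomain, Finsupp.linearCombination_apply,
    Finsupp.linearCombination_apply, Finsupp.mul_sum]
  refine Finsupp.sum_congr fun g _ => ?_
  rw [mul_smul_comm, gElt_mul]
  rfl

lemma star_groupSum {Γ : Type v} [Group Γ] (c c' : Γ →₀ ℂ)
    (h : ∀ g, c' g = starRingEnd ℂ (c g⁻¹)) : groupSum c' = star (groupSum c) := by
  rw [groupSum, Finsupp.linearCombination_apply, Finsupp.linearCombination_apply, Finsupp.sum,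
    Finsupp.sum, star_sum]
  refine Finset.sum_nbij' (fun g => g⁻¹) (fun g => g⁻¹) ?_ ?_ ?_ ?_ ?_
  · intro g hg
    rw [Finsupp.mem_support_iff, h] at hg
    rw [Finsupp.mem_support_iff]
    exact fun h0 => hg (by rw [h0, map_zero])
  · intro g hg
    rw [Finsupp.mem_support_iff] at hg
    rw [Finsupp.mem_support_iff, h, inv_inv]
    exact fun h0 => hg ((map_eq_zero _).1 h0)
  · intro g _; exact inv_inv g
  · intro g _; exact inv_inv g
  · intro g _
    rw [star_smul, star_gElt, inv_inv, h]
    rfl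

lemma resCStar_star (a : GpdCStar X) : resCStar x (star a) = star (resCStar x a) := by
  refine PreCStarAlg.compl_induction (p := fun a => resCStar x (star a) = star (resCStar x a)) a
    (isClosed_eq ((resCStar x).continuous.comp continuous_star)
      (continuous_star.comp (resCStar x).continuous)) fun f => ?_
  rw [← PreCStarAlg.toCompl_star, resCStar_toCompl, resCStar_toCompl]
  exact star_groupSum _ _ fun g => rfl

lemma mul_fn_isoArr {q : ConvAlg X} {V : Set (Arr X)} (hV : Arr.IsBisection V)
    (hq : Function.support q.fn ⊆ V) {t : End x} (ht : q.fn (isoArr t) = 1) (f : ConvAlg X)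
    (s : End x) : (q * f).fn (isoArr s) = f.fn (isoArr (t⁻¹ * s)) := by
  have htV : isoArr t ∈ V := hq (by rw [Function.mem_support, ht]; exact one_ne_zero)
  rw [ConvAlg.mul_fn, conv_eq_single hV hq (a := isoArr s) (b := isoArr t) rfl htV, ht, one_mul]
  refine congrArg f.fn ?_
  change (⟨x, x, (show x ⟶ x from s) ≫ 𝟙 x ≫ Groupoid.inv (show x ⟶ x from t)⟩ : Arr X) = ⟨x, x, _⟩
  rw [Category.id_comp]
  rfl

/-- Multiplication by a function supported in a bisection through `t`, with the value one at `t`,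
becomes multiplication by `t` after restriction to the isotropy group. -/
lemma resCStar_mul_left {q : ConvAlg X} {V : Set (Arr X)} (hV : Arr.IsBisection V)
    (hq : Function.support q.fn ⊆ V) {t : End x} (ht : q.fn (isoArr t) = 1) (a : GpdCStar X) :
    resCStar x (PreCStarAlg.toCompl q * a) = gElt t * resCStar x a := by
  refine PreCStarAlg.compl_induction
    (p := fun a => resCStar x (PreCStarAlg.toCompl q * a) = gElt t * resCStar x a) a
    (isClosed_eq ((resCStar x).continuous.comp (continuous_const.mul continuous_id))
      (continuous_const.mul (resCStar x).continuous)) fun f => ?_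
  rw [← PreCStarAlg.toCompl_mul, resCStar_toCompl, resCStar_toCompl, gElt_mul_groupSum]
  congr 1
  ext s
  have h1 : s = t * (t⁻¹ * s) := by rw [mul_inv_cancel_left]
  rw [isoCoeff_apply, mul_fn_isoArr hV hq ht]
  conv_rhs => rw [h1]
  rw [Finsupp.mapDomain_apply (mul_right_injective t)]
  rfl

lemma resCStar_mul_right {q : ConvAlg X} {V : Set (Arr X)} (hV : Arr.IsBisection V)
    (hq : Function.support q.fn ⊆ V) {t : End x} (ht : q.fn (isoArr t) = 1) (a : GpdCStar X) :
    resCStar x (a * PreCStarAlg.toCompl q) = resCStar x a * gElt t := by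
  have h1 : Function.support (star q).fn ⊆ Arr.inv ⁻¹' V := fun b hb =>
    hq fun h => hb (by rw [ConvAlg.star_fn, h, map_zero])
  have h2 : (star q).fn (isoArr t⁻¹) = 1 := by
    have : (isoArr t⁻¹).inv = isoArr t := congrArg isoArr (inv_inv t)
    rw [ConvAlg.star_fn, this, ht, map_one]
  have h3 := resCStar_mul_left (isBisection_inv hV) h1 h2 (star a)
  have h4 := congrArg star h3
  rw [← resCStar_star, star_mul, star_mul, PreCStarAlg.toCompl_star, star_star, star_star,
    resCStar_star, star_star, star_gElt, inv_inv] at h4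
  exact h4

end conjugation

/-! ### Representations of a discrete group induced from the GNS representation of a state -/

section groupInduction

variable {Γ : Type v} [Group Γ] {S : Subgroup Γ} (ω : State S)

/-- A group element as an arrow of the one-object groupoid, with source the unique unit. -/
def srcOf (g : Γ) : SrcFib (SingleObj.star Γ) := ⟨SingleObj.star Γ, g⟩

lemma groupIndRep_gElt_point_one {H : Type v} [NormedAddCommGroup H] [InnerProductSpace ℂ H]
    [CompleteSpace H] (π : URep S H) (g : Γ) (ζ : H) :
    groupIndRep S π (gElt g) (IndSpace.point (SrcFib.one (SingleObj.star Γ)) ζ) =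
      IndSpace.point (srcOf g) ζ := by
  refine Eq.trans ?_ (IndSpace.op_point_one (delta g) (isBisection_singleton (arrOf g))
    (delta_support g) (srcOf g) (if_pos rfl) ζ)
  exact congrArg (fun T : IndSpace (groupIncl S) π (groupIncl_injective S) →L[ℂ] _ =>
    T (IndSpace.point (SrcFib.one (SingleObj.star Γ)) ζ)) 
    (toCStar_toCompl (indConv (groupIncl S) (groupIncl_injective S) π) (delta g))

lemma groupIndRep_gElt_one {H : Type v} [NormedAddCommGroup H] [InnerProductSpace ℂ H]
    [CompleteSpace H] (π : URep S H) : groupIndRep S π (gElt 1) = 1 := by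
  rw [← sub_eq_zero]
  refine IndSpace.op_eq_zero _ fun g ζ g' ζ' => ?_
  obtain ⟨⟨⟩, g⟩ := g
  have h1 := groupIndRep_gElt_point_one π g ζ
  have h2 : groupIndRep S π (gElt 1) (IndSpace.point (srcOf g) ζ) = IndSpace.point (srcOf g) ζ := by
    rw [← h1, ← mul_apply_eq_comp, ← map_mul, gElt_mul, one_mul]
  have h3 : (groupIndRep S π (gElt 1) - 1) (IndSpace.point (srcOf g) ζ) = 0 := by
    rw [sub_apply, h2, one_apply_eq_self, sub_self]
  change ⟪(groupIndRep S π (gElt 1) - 1) (IndSpace.point (srcOf g) ζ), _⟫_ℂ = 0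
  rw [h3, inner_zero_left]

/-- The Hilbert space of the representation induced from the GNS representation of `ω`. -/
abbrev State.IndGNS (ω : State S) : Type v := IndSpace (groupIncl S) ω.gns (groupIncl_injective S)

/-- The unitary representation of `Γ` induced from the GNS representation of a state on a subgroup. -/
def State.ind (ω : State S) : URep Γ ω.IndGNS :=
  urepOf (groupIndRep S ω.gns) (groupIndRep_gElt_one ω.gns)

lemma State.toCStar_ind (a : GroupCStar Γ) : ω.ind.toCStar a = groupIndRep S ω.gns a :=
  toCStar_urepOf _ _ a

/-- The canonical cyclic vector of the representation induced from the GNS representation of `ω`. -/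
def State.indVec (ω : State S) : ω.IndGNS := IndSpace.point (SrcFib.one (SingleObj.star Γ)) ω.vec

lemma State.norm_indVec : ‖ω.indVec‖ = 1 := by
  rw [State.indVec, IndSpace.norm_point, State.norm_vec]

lemma State.ind_indVec (g : Γ) :
    (ω.ind g : ω.IndGNS →L[ℂ] ω.IndGNS) ω.indVec = IndSpace.point (srcOf g) ω.vec :=
  groupIndRep_gElt_point_one ω.gns g ω.vec

lemma State.indVec_fn (s : S) :
    ω.indVec.fn (srcOf (s : Γ)) = star (ω.gns s : ω.GNSSpace →L[ℂ] ω.GNSSpace) ω.vec := by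
  have h : srcOf (s : Γ) = rmul (SrcFib.one (SingleObj.star Γ)) (groupIncl S s) := by
    refine congrArg (Sigma.mk _) ?_
    exact (one_mul (s : Γ)).symm
  rw [h]
  exact IndSpace.point_fn_rmul _ _ _

lemma State.inner_indVec_of_mem (s : S) :
    ⟪ω.indVec, (ω.ind (s : Γ) : ω.IndGNS →L[ℂ] ω.IndGNS) ω.indVec⟫_ℂ = ω.evalAt s := by
  rw [State.ind_indVec, IndSpace.inner_point, State.indVec_fn,
    ContinuousLinearMap.star_eq_adjoint, ContinuousLinearMap.adjoint_inner_left,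
    State.inner_vec_apply]

lemma State.inner_indVec_of_notMem {g : Γ} (hg : g ∉ S) :
    ⟪ω.indVec, (ω.ind g : ω.IndGNS →L[ℂ] ω.IndGNS) ω.indVec⟫_ℂ = 0 := by
  rw [State.ind_indVec, IndSpace.inner_point]
  have : ω.indVec.fn (srcOf g) = 0 := by
    refine IndSpace.point_fn_of_forall_ne _ _ _ fun s hs => hg ?_
    have h1 : (g : Γ) = (1 : Γ) * (s : Γ) := eq_of_heq (Sigma.mk.inj hs).2
    rw [h1, one_mul]; exact s.2
  rw [this, inner_zero_left]

/-- The canonical vector of the induced representation is cyclic. -/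
lemma State.isCyclic_ind : ω.ind.IsCyclic ω.indVec := by
  intro ξ hξ
  refine IndSpace.fn_injective (funext fun g => ?_)
  obtain ⟨⟨⟩, g⟩ := g
  refine ω.isCyclic _ fun s => ?_
  have h1 := hξ (g * s)
  rw [State.ind_indVec, IndSpace.inner_point] at h1
  have h2 : srcOf (g * (s : Γ)) = rmul (srcOf g) (groupIncl S s) := rfl
  rw [h2, IndSpace.equivariant, ContinuousLinearMap.star_eq_adjoint,
    ContinuousLinearMap.adjoint_inner_left] at h1
  exact h1

end groupInduction

/-! ### Isotropy groups near a point, and limits of states along ultrafilters -/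

section limits

section nets

variable {J : Type u} (F : Filter J)

/-- The index set of the net associated with a filter: pairs of a set of the filter and a point in it,
ordered by reverse inclusion of the sets. -/
def NetIndex := {p : Set J × J // p.1 ∈ F ∧ p.2 ∈ p.1}

instance : Preorder (NetIndex F) where
  le p q := q.1.1 ⊆ p.1.1
  le_refl p := subset_rfl
  le_trans p q r h h' := h'.trans h

instance [F.NeBot] : IsDirected (NetIndex F) (· ≤ ·) where
  directed p q := by
    have h := inter_mem p.2.1 q.2.1
    obtain ⟨j, hj⟩ := F.nonempty_of_mem h
    exact ⟨⟨(_, j), h, hj⟩, Set.inter_subset_left, Set.inter_subset_right⟩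

instance [F.NeBot] : Nonempty (NetIndex F) := by
  obtain ⟨j, hj⟩ := F.nonempty_of_mem univ_mem
  exact ⟨⟨(_, j), univ_mem, hj⟩⟩

lemma NetIndex.tendsto [F.NeBot] : Tendsto (fun p : NetIndex F => p.1.2) atTop F := by
  intro A hA
  obtain ⟨j, hj⟩ := F.nonempty_of_mem hA
  refine mem_map.2 (mem_atTop_sets.2 ⟨⟨(A, j), hA, hj⟩, fun p hp => hp p.2.2⟩)

end nets

variable {X : Type u} [Groupoid.{u} X]

open scoped Classical in
/-- The element of the isotropy group at `z` which lies in the bisection `V`, if there is one (and the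
unit otherwise). -/
def isoPt (V : Set (Arr X)) (z : X) : End z := if h : ∃ h : End z, isoArr h ∈ V then h.choose else 1

lemma isoPt_mem {V : Set (Arr X)} {z : X} (h : ∃ h : End z, isoArr h ∈ V) :
    isoArr (isoPt V z) ∈ V := by
  rw [isoPt, dif_pos h]; exact h.choose_spec

lemma isoArr_injective {z : X} : Function.Injective (isoArr : End z → Arr X) := by
  intro a b h
  simpa [isoArr] using h

lemma isoPt_eq {V : Set (Arr X)} (hV : Arr.IsBisection V) {z : X} {h : End z} (hh : isoArr h ∈ V) :
    isoPt V z = h := isoArr_injective (hV.1 (isoPt_mem ⟨h, hh⟩) hh rfl)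

lemma mem_arrows_isotropy {z : X} {a : Arr X} :
    a ∈ (GpdSub.isotropy z).arrows ↔ ∃ h : End z, a = isoArr h :=
  ⟨fun ⟨h, _, e⟩ => ⟨h, e⟩, fun ⟨h, e⟩ => ⟨h, Subgroup.mem_top _, e⟩⟩

lemma inter_arrows_eq_singleton {V : Set (Arr X)} (hV : Arr.IsBisection V) {z : X} {h : End z}
    (hh : isoArr h ∈ V) : V ∩ (GpdSub.isotropy z).arrows = {isoArr h} := by
  ext a
  constructor
  · rintro ⟨ha, ha'⟩
    obtain ⟨k, rfl⟩ := mem_arrows_isotropy.1 ha'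
    exact hV.1 ha hh rfl
  · rintro rfl
    exact ⟨hh, mem_arrows_isotropy.2 ⟨h, rfl⟩⟩

lemma inter_arrows_eq_empty {V : Set (Arr X)} {z : X} :
    V ∩ (GpdSub.isotropy z).arrows = ∅ ↔ ¬∃ h : End z, isoArr h ∈ V := by
  rw [Set.eq_empty_iff_forall_notMem]
  constructor
  · rintro h ⟨k, hk⟩
    exact h _ ⟨hk, mem_arrows_isotropy.2 ⟨k, rfl⟩⟩
  · rintro h a ⟨ha, ha'⟩
    obtain ⟨k, rfl⟩ := mem_arrows_isotropy.1 ha'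
    exact h ⟨k, ha⟩

lemma isoArr_mem_of_inter_eq {V : Set (Arr X)} {z : X} {h : End z}
    (hh : V ∩ (GpdSub.isotropy z).arrows = {isoArr h}) : isoArr h ∈ V :=
  (hh.symm ▸ Set.mem_singleton _ : isoArr h ∈ V ∩ _).1

variable [TopologicalSpace X] [TopologicalSpace (Arr X)] [EtaleGroupoid X] {x : X}

/-- In a bisection through an isotropy element `g`, the elements with source close to `x` are close
to `g`. -/
lemma eventually_mem_of_isBisection {V : Set (Arr X)} (hVo : IsOpen V) (hV : Arr.IsBisection V)
    {g : End x} (hg : isoArr g ∈ V) {N : Set (Arr X)} (hN : N ∈ 𝓝 (isoArr g)) :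
    ∀ᶠ z in 𝓝 x, ∀ a ∈ V, a.src = z → a ∈ N := by
  have h1 : Arr.src '' (N ∩ V) ∈ 𝓝 x :=
    (EtaleGroupoid.isLocalHomeomorph_src (X := X)).isOpenMap.image_mem_nhds (x := isoArr g)
      (inter_mem hN (hVo.mem_nhds hg))
  filter_upwards [h1] with z hz a ha haz
  obtain ⟨b, hb, rfl⟩ := hz
  rw [hV.1 ha hb.2 haz]
  exact hb.1

variable {J : Type*} {F : Filter J} {z : J → X}

lemma tendsto_isoPt (hz : Tendsto z F (𝓝 x)) {V : Set (Arr X)} (hVo : IsOpen V)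
    (hV : Arr.IsBisection V) {g : End x} (hg : isoArr g ∈ V)
    (hm : ∀ᶠ i in F, ∃ h : End (z i), isoArr h ∈ V) :
    Tendsto (fun i => isoArr (isoPt V (z i))) F (𝓝 (isoArr g)) := by
  intro N hN
  change ∀ᶠ i in F, isoArr (isoPt V (z i)) ∈ N
  filter_upwards [hm, hz.eventually (eventually_mem_of_isBisection hVo hV hg hN)] with i h1 h2
  exact h2 _ (isoPt_mem h1) rfl

lemma tendsto_isoArr_one (hz : Tendsto z F (𝓝 x)) :
    Tendsto (fun i => isoArr (1 : End (z i))) F (𝓝 (isoArr (1 : End x))) :=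
  (EtaleGroupoid.continuous_unit (X := X)).continuousAt.tendsto.comp hz

lemma tendsto_isoArr_inv {a : ∀ i, End (z i)} {g : End x}
    (ha : Tendsto (fun i => isoArr (a i)) F (𝓝 (isoArr g))) :
    Tendsto (fun i => isoArr (a i)⁻¹) F (𝓝 (isoArr g⁻¹)) :=
  (EtaleGroupoid.continuous_inv (X := X)).continuousAt.tendsto.comp ha

lemma tendsto_isoArr_mul {a b : ∀ i, End (z i)} {g k : End x}
    (ha : Tendsto (fun i => isoArr (a i)) F (𝓝 (isoArr g)))
    (hb : Tendsto (fun i => isoArr (b i)) F (𝓝 (isoArr k))) :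
    Tendsto (fun i => isoArr (a i * b i)) F (𝓝 (isoArr (g * k))) := by
  have e : ∀ (w : X) (p q : End w), isoArr (p * q) = Arr.mul ⟨(isoArr p, isoArr q), rfl⟩ := by
    intro w p q
    change (⟨w, w, _⟩ : Arr X) = ⟨w, w, (show w ⟶ w from q) ≫ 𝟙 w ≫ (show w ⟶ w from p)⟩
    rw [Category.id_comp]
    rfl
  simp only [e]
  refine (EtaleGroupoid.continuous_mul (X := X)).continuousAt.tendsto.comp ?_
  exact tendsto_subtype_rng.2 (ha.prodMk_nhds hb)

lemma State.nonneg_sum {Γ : Type v} [Group Γ] (φ : State Γ) {ι : Type*} (s : Finset ι) (c : ι → ℂ)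
    (h : ι → Γ) :
    0 ≤ ∑ i ∈ s, ∑ j ∈ s, starRingEnd ℂ (c i) * c j * φ.evalAt ((h i)⁻¹ * h j) := by
  refine (φ.nonneg (∑ i ∈ s, c i • gElt (h i))).trans_eq ?_
  rw [star_sum, Finset.sum_mul_sum, map_sum]
  refine Finset.sum_congr rfl fun i _ => ?_
  rw [map_sum]
  refine Finset.sum_congr rfl fun j _ => ?_
  rw [star_smul, star_gElt, smul_mul_smul_comm, gElt_mul, map_smul, smul_eq_mul]
  rfl

lemma State.norm_evalAt_le {Γ : Type v} [Group Γ] (φ : State Γ) (g : Γ) : ‖φ.evalAt g‖ ≤ 1 :=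
  (φ.norm_le _).trans (norm_gElt_le g)

variable {W : End x → Set (Arr X)}

/-- Along an ultrafilter, the isotropy groups at points which converge to `x` converge to a subgroup `S`
of the isotropy group at `x`, and states on them converge to a state on `S`. -/
lemma exists_limit_state [T2Space (Arr X)] [LocallyCompactSpace (Arr X)] (hWo : ∀ g, IsOpen (W g)) (hWb : ∀ g, Arr.IsBisection (W g))
    (hWg : ∀ g, isoArr g ∈ W g) (𝒰 : Ultrafilter J) (hz : Tendsto z 𝒰 (𝓝 x))
    (ν : ∀ i, State (End (z i))) :
    ∃ (S : Subgroup (End x)) (ω : State S),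
      (∀ g, g ∈ S ↔ ∀ᶠ i in 𝒰, ∃ h : End (z i), isoArr h ∈ W g) ∧
      Tendsto (fun i => GpdSub.isotropy (z i)) 𝒰 (𝓝 (⟨x, S⟩ : GpdSub X)) ∧
      ∀ s : S, Tendsto (fun i => (ν i).evalAt (isoPt (W s) (z i))) 𝒰 (𝓝 (ω.evalAt s)) := by
  have : T2Space X := Arr.t2_units
  have htend : ∀ {a : ∀ i, End (z i)} {g : End x},
      Tendsto (fun i => isoArr (a i)) 𝒰 (𝓝 (isoArr g)) →
        ∀ᶠ i in 𝒰, isoArr (a i) ∈ W g := fun {a g} h =>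
    h ((hWo g).mem_nhds (hWg g))
  have hpt : ∀ {g : End x}, (∀ᶠ i in 𝒰, ∃ h : End (z i), isoArr h ∈ W g) →
      Tendsto (fun i => isoArr (isoPt (W g) (z i))) 𝒰 (𝓝 (isoArr g)) := fun {g} h =>
    tendsto_isoPt hz (hWo g) (hWb g) (hWg g) h
  let S : Subgroup (End x) :=
    { carrier := {g | ∀ᶠ i in 𝒰, ∃ h : End (z i), isoArr h ∈ W g}
      one_mem' := (htend (tendsto_isoArr_one hz)).mono fun i hi => ⟨_, hi⟩
      mul_mem' := fun {g k} hg hk =>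
        (htend (tendsto_isoArr_mul (hpt hg) (hpt hk))).mono fun i hi => ⟨_, hi⟩
      inv_mem' := fun {g} hg => (htend (tendsto_isoArr_inv (hpt hg))).mono fun i hi => ⟨_, hi⟩ }
  have hS : ∀ g, g ∈ S ↔ ∀ᶠ i in 𝒰, ∃ h : End (z i), isoArr h ∈ W g := fun g => Iff.rfl
  have hlim : ∀ s : S, ∃ l : ℂ,
      Tendsto (fun i => (ν i).evalAt (isoPt (W s) (z i))) 𝒰 (𝓝 l) := by
    intro s
    obtain ⟨l, -, hl⟩ := (isCompact_closedBall (0 : ℂ) 1).ultrafilter_le_nhds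
      (𝒰.map fun i => (ν i).evalAt (isoPt (W s) (z i))) (by
        rw [le_principal_iff]
        exact mem_map.2 (univ_mem' fun i => mem_closedBall_zero_iff.2 ((ν i).norm_evalAt_le _)))
    exact ⟨l, hl⟩
  choose l hl using hlim
  have heq : ∀ {a : ∀ i, End (z i)} {g : End x},
      Tendsto (fun i => isoArr (a i)) 𝒰 (𝓝 (isoArr g)) →
        ∀ᶠ i in 𝒰, isoPt (W g) (z i) = a i := fun {a g} h =>
    (htend h).mono fun i hi => isoPt_eq (hWb g) hi
  have hpd : IsPosDefFun l :=
    { map_one := by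
        refine tendsto_nhds_unique (hl 1) (tendsto_const_nhds.congr' ?_)
        filter_upwards [heq (g := ((1 : S) : End x)) (tendsto_isoArr_one hz)] with i hi
        rw [hi]
        exact (ν i).apply_one.symm
      map_inv := fun s => by
        refine tendsto_nhds_unique (hl s⁻¹) (((Complex.continuous_conj.tendsto _).comp
          (hl s)).congr' ?_)
        filter_upwards [heq (tendsto_isoArr_inv (hpt s.2))] with i hi
        rw [Function.comp_apply, ← (ν i).isPosDefFun.map_inv, ← hi]
        rfl
      nonneg := fun c => by
        have h1 : Tendsto (fun i => ∑ s ∈ c.support, ∑ t ∈ c.support,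
            starRingEnd ℂ (c s) * c t * (ν i).evalAt ((isoPt (W s) (z i))⁻¹ * isoPt (W t) (z i))) 𝒰
            (𝓝 (∑ s ∈ c.support, ∑ t ∈ c.support, starRingEnd ℂ (c s) * c t * l (s⁻¹ * t))) := by
          refine tendsto_finsetSum _ fun s _ => tendsto_finsetSum _ fun t _ =>
            Tendsto.const_mul _ ((hl (s⁻¹ * t)).congr' ?_)
          filter_upwards [heq (tendsto_isoArr_mul (tendsto_isoArr_inv (hpt s.2)) (hpt t.2))]
            with i hi
          rw [← hi]
          rfl
        exact ge_of_tendsto' h1 fun i => (ν i).nonneg_sum _ _ _ }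
  obtain ⟨ω, hω⟩ := hpd.exists_state
  refine ⟨S, ω, hS, ?_, fun s => by rw [hω]; exact hl s⟩
  rw [TopologicalSpace.tendsto_nhds_generateFrom_iff]
  rintro _ ⟨K, 𝓥, hK, hfin, hopen, rfl⟩ ⟨hSK, hSU⟩
  have h1 : ∀ᶠ i in 𝒰, (GpdSub.isotropy (z i)).arrows ∩ K = ∅ := by
    by_contra hcon
    rw [← Ultrafilter.eventually_not] at hcon
    have hcon' : ∀ᶠ i in 𝒰, ∃ h : End (z i), isoArr h ∈ K := hcon.mono fun i hi => by
      by_contra h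
      exact hi (by rw [Set.inter_comm]; exact inter_arrows_eq_empty.2 h)
    obtain ⟨a, haK, ha⟩ := hK.ultrafilter_le_nhds (𝒰.map fun i => isoArr (isoPt K (z i))) (by
      rw [le_principal_iff]
      exact mem_map.2 (hcon'.mono fun i hi => isoPt_mem hi))
    have ha : Tendsto (fun i => isoArr (isoPt K (z i))) 𝒰 (𝓝 a) := ha
    have hs : a.src = x := tendsto_nhds_unique ((Arr.continuous_src.tendsto a).comp ha) hz
    have hr : a.rng = x := tendsto_nhds_unique ((Arr.continuous_rng.tendsto a).comp ha) hz
    obtain ⟨s, r, a⟩ := a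
    obtain rfl : s = x := hs
    obtain rfl : r = s := hr
    have haS : (a : End r) ∈ S := (htend (g := a) ha).mono fun i hi => ⟨_, hi⟩
    exact (Set.eq_empty_iff_forall_notMem.1 hSK) _ ⟨⟨a, haS, rfl⟩, haK⟩
  have h2 : ∀ᶠ i in 𝒰, ∀ U ∈ 𝓥, ((GpdSub.isotropy (z i)).arrows ∩ U).Nonempty := by
    refine (eventually_all_finite hfin).2 fun U hU => ?_
    obtain ⟨_, ⟨g, hg, rfl⟩, hgU⟩ := hSU U hU
    have h3 := hpt ((hS g).1 hg) ((hopen U hU).mem_nhds hgU)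
    filter_upwards [h3] with i hi
    exact ⟨_, mem_arrows_isotropy.2 ⟨_, rfl⟩, hi⟩
  filter_upwards [h1, h2] with i h3 h4
  exact ⟨h3, h4⟩

variable {Y : Set X} {HY : Y → Type u}
  [∀ y, NormedAddCommGroup (HY y)] [∀ y, InnerProductSpace ℂ (HY y)] [∀ y, CompleteSpace (HY y)]
  {πY : ∀ y : Y, URep (End (y : X)) (HY y)}

lemma isStateLimit_of_filter (hWb : ∀ g, Arr.IsBisection (W g)) {J : Type u} (F : Filter J) [F.NeBot]
    (y : J → Y) (z : J → X) (g : ∀ i, (y i : X) ⟶ z i) (ν : ∀ i, State (End (z i)))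
    (hν : ∀ i, (ν i).IsOn (conjRep (g i) (πY (y i)))) (hz : Tendsto z F (𝓝 x))
    {S : Subgroup (End x)} {ω : State S}
    (hS : Tendsto (fun i => GpdSub.isotropy (z i)) F (𝓝 (⟨x, S⟩ : GpdSub X)))
    (hm : ∀ s : S, ∀ᶠ i in F, ∃ h : End (z i), isoArr h ∈ W s)
    (hω : ∀ s : S, Tendsto (fun i => (ν i).evalAt (isoPt (W s) (z i))) F (𝓝 (ω.evalAt s))) :
    IsStateLimit W πY S ω := by
  have ht := NetIndex.tendsto F
  refine ⟨NetIndex F, inferInstance, inferInstance, inferInstance, fun p => y p.1.2,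
    fun p => z p.1.2, fun p => g p.1.2, fun p => ν p.1.2, fun p => hν _, hz.comp ht, hS.comp ht,
    fun s ε hε => ?_⟩
  filter_upwards [ht.eventually (hm s), ht.eventually (Metric.tendsto_nhds.1 (hω s) ε hε)]
    with p h1 h2
  exact ⟨_, inter_arrows_eq_singleton (hWb s) (isoPt_mem h1), by rwa [← dist_eq_norm]⟩

lemma hasStateApproximation_of_filter (hWb : ∀ g, Arr.IsBisection (W g)) {J : Type u} (F : Filter J)
    [F.NeBot] (y : J → Y) (z : J → X) (g : ∀ i, (y i : X) ⟶ z i) (ν : ∀ i, State (End (z i)))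
    (hν : ∀ i, (ν i).IsOn (conjRep (g i) (πY (y i)))) (hz : Tendsto z F (𝓝 x))
    {Δ : Subgroup (End x)} {L : Type u} [NormedAddCommGroup L] [InnerProductSpace ℂ L]
    [CompleteSpace L] {ρ : URep Δ L} (φ : State Δ) (hφ : φ.IsOn ρ)
    (h : ∀ ε : ℝ, 0 < ε → ∀ s : Δ, ∀ᶠ i in F, ∀ h : End (z i), isoArr h ∈ W s →
      ‖φ.evalAt s - (ν i).evalAt h‖ < ε) :
    HasStateApproximation W πY Δ ρ := by
  have ht := NetIndex.tendsto F
  refine ⟨φ, hφ, NetIndex F, inferInstance, inferInstance, inferInstance, fun p => y p.1.2,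
    fun p => z p.1.2, fun p => g p.1.2, fun p => ν p.1.2, fun p => hν _, hz.comp ht,
    fun ε hε s => ?_⟩
  obtain ⟨i₀, hi₀⟩ := eventually_atTop.1 (ht.eventually (h ε hε s))
  refine ⟨i₀, fun i hi => ?_⟩
  by_cases hm : ∃ h : End (z i.1.2), isoArr h ∈ W s
  · obtain ⟨k, hk⟩ := hm
    exact Or.inr ⟨k, inter_arrows_eq_singleton (hWb s) hk, hi₀ i hi k hk⟩
  · exact Or.inl (inter_arrows_eq_empty.2 hm)

/-- A state approximation of a representation of a subgroup `Δ` can be refined to a state limit which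
agrees on `S ∩ Δ` with a state on the representation. -/
lemma HasStateApproximation.exists_isStateLimit [T2Space (Arr X)] [LocallyCompactSpace (Arr X)]
    (hWo : ∀ g, IsOpen (W g))
    (hWb : ∀ g, Arr.IsBisection (W g)) (hWg : ∀ g, isoArr g ∈ W g) {Δ : Subgroup (End x)}
    {L : Type u} [NormedAddCommGroup L] [InnerProductSpace ℂ L] [CompleteSpace L] {ρ : URep Δ L}
    (h : HasStateApproximation W πY Δ ρ) :
    ∃ φ : State Δ, φ.IsOn ρ ∧ ∃ (S : Subgroup (End x)) (ω : State S), IsStateLimit W πY S ω ∧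
      ∀ (g : End x) (hS : g ∈ S) (hΔ : g ∈ Δ), ω.evalAt ⟨g, hS⟩ = φ.evalAt ⟨g, hΔ⟩ := by
  obtain ⟨φ, hφ, I, _, _, _, y, z, g, ν, hν, hz, happ⟩ := h
  let 𝒰 : Ultrafilter I := Ultrafilter.of atTop
  have h𝒰 : (𝒰 : Filter I) ≤ atTop := Ultrafilter.of_le _
  obtain ⟨S, ω, hS, hSt, hω⟩ := exists_limit_state hWo hWb hWg 𝒰 (hz.mono_left h𝒰) ν
  refine ⟨φ, hφ, S, ω, isStateLimit_of_filter hWb (𝒰 : Filter I) y z g ν hν (hz.mono_left h𝒰) hSt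
    (fun s => (hS s).1 s.2) hω, fun t htS htΔ => ?_⟩
  refine tendsto_nhds_unique (hω ⟨t, htS⟩) (Metric.tendsto_nhds.2 fun ε hε => ?_)
  obtain ⟨i₀, hi₀⟩ := happ ε hε ⟨t, htΔ⟩
  filter_upwards [(hS t).1 htS, h𝒰 (mem_atTop i₀)] with i h1 h2
  rcases hi₀ i h2 with h3 | ⟨k, hk, h3⟩
  · exact absurd h1 (inter_arrows_eq_empty.1 h3)
  · rw [dist_comm, dist_eq_norm, isoPt_eq (hWb t) (isoArr_mem_of_inter_eq hk)]
    exact h3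

end limits

/-! ### State limits and induced representations -/

section stateLimits

variable {X : Type u} [Groupoid.{u} X] [TopologicalSpace X] [TopologicalSpace (Arr X)]
  [EtaleGroupoid X] [T2Space (Arr X)] [LocallyCompactSpace (Arr X)] {x : X}

lemma norm_resCStar_le (z : X) (a : GpdCStar X) : ‖resCStar z a‖ ≤ ‖a‖ := by
  refine PreCStarAlg.compl_induction (p := fun a => ‖resCStar z a‖ ≤ ‖a‖) a
    (isClosed_le (resCStar z).continuous.norm continuous_norm) fun f => ?_
  rw [resCStar_toCompl, PreCStarAlg.norm_toCompl]
  exact norm_groupSum_isoCoeff_le z f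

lemma exists_bump_isBisection (g : Arr X) : ∃ (q : ConvAlg X) (V : Set (Arr X)), Arr.IsBisection V ∧
    Function.support q.fn ⊆ V ∧ q.fn g = 1 := by
  obtain ⟨V, hVo, hV, hg⟩ := Arr.exists_bisection g
  obtain ⟨q, hq, ⟨N, -, hgN, hN⟩, -⟩ := exists_bump hVo hg
  exact ⟨q, V, hV, (subset_tsupport _).trans hq, hN g hgN⟩

lemma isoCoeff_eq_single {f : ConvAlg X} {V : Set (Arr X)} (hV : Arr.IsBisection V)
    (hf : Function.support f.fn ⊆ V) {z : X} {h : End z} (hh : isoArr h ∈ V) :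
    isoCoeff z f = Finsupp.single h (f.fn (isoArr h)) := by
  classical
  ext a
  rw [isoCoeff_apply, Finsupp.single_apply]
  split_ifs with hha
  · rw [hha]
  · by_contra h0
    exact hha (isoArr_injective (hV.1 hh (hf h0) rfl))

lemma isoCoeff_eq_zero {f : ConvAlg X} {z : X}
    (h : (GpdSub.isotropy z).arrows ∩ tsupport f.fn = ∅) : isoCoeff z f = 0 := by
  ext a
  by_contra h0
  exact Set.eq_empty_iff_forall_notMem.1 h _
    ⟨mem_arrows_isotropy.2 ⟨a, rfl⟩, subset_tsupport _ h0⟩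

lemma eventually_inter_eq_empty {J : Type*} {F : Filter J} {z : J → X} {T : GpdSub X}
    (hT : Tendsto (fun i => GpdSub.isotropy (z i)) F (𝓝 T)) {K : Set (Arr X)} (hK : IsCompact K)
    (h : T.arrows ∩ K = ∅) : ∀ᶠ i in F, (GpdSub.isotropy (z i)).arrows ∩ K = ∅ := by
  have ho : IsOpen {T : GpdSub X | T.arrows ∩ K = ∅ ∧ ∀ U ∈ (∅ : Set (Set (Arr X))),
      (T.arrows ∩ U).Nonempty} :=
    TopologicalSpace.isOpen_generateFrom_of_mem
      ⟨K, ∅, hK, Set.finite_empty, fun U hU => absurd hU (Set.notMem_empty U), rfl⟩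
  exact (hT.eventually (ho.mem_nhds ⟨h, fun U hU => absurd hU (Set.notMem_empty U)⟩)).mono
    fun i hi => hi.1

/-- The diagonal matrix coefficient at the canonical vector of the representation induced from `ω`, as
a functional on `C*(𝒢)`: on functions it is `f ↦ ∑_{s ∈ S} f(s) ω(s)`. -/
def State.indCoeff {S : Subgroup (End x)} (ω : State S) (a : GpdCStar X) : ℂ :=
  ⟪ω.indVec, ω.ind.toCStar (resCStar x a) ω.indVec⟫_ℂ

lemma State.continuous_indCoeff {S : Subgroup (End x)} (ω : State S) :
    Continuous (ω.indCoeff : GpdCStar X → ℂ) :=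
  continuous_const.inner (((ω.ind.continuous_toCStar).comp (resCStar x).continuous).clm_apply
    continuous_const)

lemma State.indCoeff_add {S : Subgroup (End x)} (ω : State S) (a b : GpdCStar X) :
    ω.indCoeff (a + b) = ω.indCoeff a + ω.indCoeff b := by
  simp only [State.indCoeff, map_add, add_apply, inner_add_right]

variable {Y : Set X} {HY : Y → Type u}
  [∀ y, NormedAddCommGroup (HY y)] [∀ y, InnerProductSpace ℂ (HY y)] [∀ y, CompleteSpace (HY y)]
  {πY : ∀ y : Y, URep (End (y : X)) (HY y)} {W : End x → Set (Arr X)}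

/-- Along a net defining a state limit, the values of the states on the restrictions of a function
converge. -/
lemma tendsto_apply_resCStar (hWo : ∀ g, IsOpen (W g)) (hWb : ∀ g, Arr.IsBisection (W g))
    (hWg : ∀ g, isoArr g ∈ W g) {J : Type*} {F : Filter J} {z : J → X} {ν : ∀ i, State (End (z i))}
    (hz : Tendsto z F (𝓝 x)) {S : Subgroup (End x)} {ω : State S}
    (hS : Tendsto (fun i => GpdSub.isotropy (z i)) F (𝓝 (⟨x, S⟩ : GpdSub X)))
    (hω : ∀ s : S, ∀ ε : ℝ, 0 < ε → ∀ᶠ i in F, ∃ h : End (z i),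
      W s ∩ (GpdSub.isotropy (z i)).arrows = {isoArr h} ∧ ‖(ν i).evalAt h - ω.evalAt s‖ < ε)
    (f : ConvAlg X) :
    Tendsto (fun i => (ν i).1 (resCStar (z i) (PreCStarAlg.toCompl f))) F
      (𝓝 (ω.indCoeff (PreCStarAlg.toCompl f))) := by
  refine ConvAlg.induction (p := fun f => Tendsto (fun i => (ν i).1 (resCStar (z i)
    (PreCStarAlg.toCompl f))) F (𝓝 (ω.indCoeff (PreCStarAlg.toCompl f)))) ?_ ?_ ?_ f
  · have h0 : ω.indCoeff (PreCStarAlg.toCompl (0 : ConvAlg X)) = 0 := by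
      simp [State.indCoeff, PreCStarAlg.toCompl_zero]
    rw [h0]
    refine tendsto_const_nhds.congr fun i => ?_
    rw [PreCStarAlg.toCompl_zero, map_zero, map_zero]
  · intro f g hf hg
    rw [PreCStarAlg.toCompl_add, State.indCoeff_add]
    refine (hf.add hg).congr fun i => ?_
    rw [map_add, map_add]
  · rintro f ⟨V, hVo, hV, hfV⟩
    have hf := (subset_tsupport f.fn).trans hfV
    have hcomp : ∀ i, resCStar (z i) (PreCStarAlg.toCompl f) = groupSum (isoCoeff (z i) f) :=
      fun i => resCStar_toCompl _ _
    by_cases hgS : ∃ g ∈ S, isoArr g ∈ V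
    · obtain ⟨g, hgS, hgV⟩ := hgS
      have hm : ∀ᶠ i in F, ∃ h : End (z i), isoArr h ∈ W g :=
        (hω ⟨g, hgS⟩ 1 one_pos).mono fun i ⟨h, hh, _⟩ => ⟨h, isoArr_mem_of_inter_eq hh⟩
      have hlim := tendsto_isoPt hz (hWo g) (hWb g) (hWg g) hm
      have hν : Tendsto (fun i => (ν i).evalAt (isoPt (W g) (z i))) F (𝓝 (ω.evalAt ⟨g, hgS⟩)) := by
        refine Metric.tendsto_nhds.2 fun ε hε => (hω ⟨g, hgS⟩ ε hε).mono fun i ⟨h, hh, h'⟩ => ?_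
        rw [isoPt_eq (hWb g) (isoArr_mem_of_inter_eq hh), dist_eq_norm]
        exact h'
      have hval : ω.indCoeff (PreCStarAlg.toCompl f) = f.fn (isoArr g) * ω.evalAt ⟨g, hgS⟩ := by
        rw [State.indCoeff, resCStar_toCompl, isoCoeff_eq_single hV hf hgV, groupSum_single, map_smul,
          smul_apply, inner_smul_right, URep.toCStar_gElt]
        rw [State.inner_indVec_of_mem ω ⟨g, hgS⟩]
      rw [hval]
      refine (((f.fn.continuous.tendsto _).comp hlim).mul hν).congr' ?_
      filter_upwards [hlim (hVo.mem_nhds hgV)] with i hi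
      rw [hcomp, isoCoeff_eq_single hV hf hi, groupSum_single, map_smul, smul_eq_mul]
      rfl
    · have hempty : (⟨x, S⟩ : GpdSub X).arrows ∩ tsupport f.fn = ∅ := by
        rw [Set.eq_empty_iff_forall_notMem]
        rintro _ ⟨⟨g, hg, rfl⟩, hgf⟩
        exact hgS ⟨g, hg, hfV hgf⟩
      have hval : ω.indCoeff (PreCStarAlg.toCompl f) = 0 := by
        rw [State.indCoeff, resCStar_toCompl, URep.toCStar_groupSum, URep.sum,
          Finsupp.linearCombination_apply, Finsupp.sum, sum_apply, inner_sum]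
        refine Finset.sum_eq_zero fun g hg => ?_
        have hgS' : g ∉ S := fun h => hgS ⟨g, h, hf (Finsupp.mem_support_iff.1 hg)⟩
        rw [smul_apply, inner_smul_right, State.inner_indVec_of_notMem ω hgS', mul_zero]
      rw [hval]
      refine tendsto_const_nhds.congr' ?_
      filter_upwards [eventually_inter_eq_empty hS f.fn.hasCompactSupport hempty] with i hi
      rw [hcomp, isoCoeff_eq_zero hi, map_zero, map_zero]

/-- The elements of `C*(𝒢)` which vanish in all the representations induced from the `π_y` restrict to
elements of `C*(𝒢^x_x)` which vanish in the representation induced from a state limit. -/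
theorem IsStateLimit.toCStar_ind_eq_zero (hWo : ∀ g, IsOpen (W g))
    (hWb : ∀ g, Arr.IsBisection (W g)) (hWg : ∀ g, isoArr g ∈ W g) {S : Subgroup (End x)}
    {ω : State S} (h : IsStateLimit W πY S ω) {a : GpdCStar X}
    (ha : ∀ y : Y, isoIndRep (πY y) a = 0) : ω.ind.toCStar (resCStar x a) = 0 := by
  obtain ⟨I, _, _, _, y, z, g, ν, hν, hz, hS, hω⟩ := h
  have key : ∀ b : GpdCStar X, (∀ y : Y, isoIndRep (πY y) b = 0) → ω.indCoeff b = 0 := by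
    intro b hb
    have hb0 : ∀ i, (ν i).1 (resCStar (z i) b) = 0 := fun i => by
      refine hν i _ ((URep.mem_ker _ _).2 ?_)
      exact toCStar_resCStar_eq_zero (g i) (πY (y i)) (hb (y i))
    have hle : ∀ c : GpdCStar X, ‖ω.indCoeff c‖ ≤ ‖c - b‖ := fun c => by
      refine PreCStarAlg.compl_induction (p := fun c => ‖ω.indCoeff c‖ ≤ ‖c - b‖) c
        (isClosed_le ω.continuous_indCoeff.norm (by fun_prop)) fun f => ?_
      refine le_of_tendsto (tendsto_apply_resCStar hWo hWb hWg hz hS hω f).norm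
        (Eventually.of_forall fun i => ?_)
      have h1 : (ν i).1 (resCStar (z i) (PreCStarAlg.toCompl f)) =
          (ν i).1 (resCStar (z i) (PreCStarAlg.toCompl f - b)) := by
        rw [map_sub, map_sub, hb0, sub_zero]
      rw [h1]
      exact ((ν i).norm_le _).trans (norm_resCStar_le _ _)
    have := hle b
    rwa [sub_self, norm_zero, norm_le_zero_iff] at this
  refine ω.isCyclic_ind.toCStar_eq_zero fun t t' => ?_
  obtain ⟨q, V, hV, hqV, hq⟩ := exists_bump_isBisection (isoArr t)
  obtain ⟨q', V', hV', hqV', hq'⟩ := exists_bump_isBisection (isoArr t'⁻¹)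
  have h1 := key (PreCStarAlg.toCompl q' * (a * PreCStarAlg.toCompl q)) fun y => by
    rw [map_mul, map_mul, ha, zero_mul, mul_zero]
  rw [State.indCoeff, resCStar_mul_left hV' hqV' hq', resCStar_mul_right hV hqV hq, map_mul, map_mul,
    URep.toCStar_gElt, URep.toCStar_gElt, mul_apply_eq_comp, mul_apply_eq_comp,
    ← ω.ind.adjoint_apply] at h1
  rw [← inner_conj_symm, h1, map_zero]

/-- An element of `C*(𝒢)` vanishes in the induced representation as soon as its two-sided multiples
restrict to elements of `C*(𝒢^x_x)` which vanish in the original representation. -/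
lemma isoIndRep_eq_zero {H : Type u} [NormedAddCommGroup H] [InnerProductSpace ℂ H] [CompleteSpace H]
    (π : URep (End x) H) (a : GpdCStar X)
    (h : ∀ q q' : GpdCStar X, π.toCStar (resCStar x (q' * a * q)) = 0) : isoIndRep π a = 0 := by
  refine IndSpace.op_eq_zero _ fun g ζ g' ζ' => ?_
  obtain ⟨q, V, hV, hqV, hq⟩ := exists_bump_isBisection g.arr
  obtain ⟨q', V', hV', hqV', hq'⟩ := exists_bump_isBisection g'.arr
  rw [← IndSpace.op_point_one q hV hqV g hq, ← IndSpace.op_point_one q' hV' hqV' g' hq',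
    ← isoIndRep_toCompl, ← isoIndRep_toCompl, ← ContinuousLinearMap.adjoint_inner_left,
    ← ContinuousLinearMap.star_eq_adjoint, ← map_star, ← mul_apply_eq_comp, ← mul_apply_eq_comp,
    ← map_mul, ← map_mul]
  refine (inner_isoIndRep_point (𝟙 x) π _ ζ ζ').trans ?_
  rw [conjRep_one, h, zero_apply, inner_zero_left]

/-- If `π` is weakly contained in the sum of the representations of `𝒢^x_x` induced from the state
limits, then the representation of the groupoid induced from `π` is weakly contained in the sum of the
representations induced from the `π_y`. -/
theorem weaklyContained_isoIndRep (hWo : ∀ g, IsOpen (W g))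
    (hWb : ∀ g, Arr.IsBisection (W g)) (hWg : ∀ g, isoArr g ∈ W g) {H : Type u}
    [NormedAddCommGroup H] [InnerProductSpace ℂ H] [CompleteSpace H] (π : URep (End x) H)
    (h : WeaklyContained π.toCStar
      (dirSum fun p : {p : Σ S : Subgroup (End x), State S // IsStateLimit W πY p.1 p.2} =>
        groupIndRep p.1.1 p.1.2.gns)) :
    WeaklyContained (isoIndRep π) (dirSum fun y : Y => isoIndRep (πY y)) := by
  refine weaklyContained_of_forall fun a ha => isoIndRep_eq_zero π a fun q q' => ?_
  rw [dirSum_eq_zero_iff] at ha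
  refine h.apply_eq_zero _ ((dirSum_eq_zero_iff _ _).2 fun p => ?_)
  rw [← State.toCStar_ind]
  refine p.2.toCStar_ind_eq_zero hWo hWb hWg fun y => ?_
  rw [map_mul, map_mul, ha, mul_zero, zero_mul]

end stateLimits

/-! ### Separation of families of values from the values of states -/

section separation

variable {Γ : Type v} [Group Γ]

lemma convex_stateSet (M : TwoSidedIdeal (GroupCStar Γ)) : Convex ℝ (stateSet M) := by
  rw [stateSet_eq]
  rintro f ⟨h1, h2, h3, h4, h5⟩ g ⟨k1, k2, k3, k4, k5⟩ s t hs ht hst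
  have e : ∀ a, (s • f + t • g) a = (s : ℂ) * f a + (t : ℂ) * g a := fun a => by simp
  refine ⟨fun a b => ?_, fun c a => ?_, fun a => ?_, ?_, fun a ha => ?_⟩
  · rw [e, e, e, h1, k1]; ring
  · rw [e, e, h2, k2, smul_eq_mul, smul_eq_mul, smul_eq_mul]; ring
  · rw [e]
    refine (norm_add_le _ _).trans ?_
    rw [norm_mul, norm_mul, Complex.norm_of_nonneg hs, Complex.norm_of_nonneg ht]
    calc s * ‖f a‖ + t * ‖g a‖ ≤ s * ‖a‖ + t * ‖a‖ := by gcongr <;> [exact h3 a; exact k3 a]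
      _ = ‖a‖ := by rw [← add_mul, hst, one_mul]
  · rw [e, h4, k4, mul_one, mul_one]
    exact_mod_cast hst
  · rw [e, h5 a ha, k5 a ha, mul_zero, mul_zero, add_zero]

lemma exists_lt_one_of_finset {ι : Type*} (t : Finset ι) (f : ι → ℝ) (h : ∀ i ∈ t, f i < 1) :
    ∃ r : ℝ, 0 ≤ r ∧ r < 1 ∧ ∀ i ∈ t, f i ≤ r := by
  classical
  induction t using Finset.induction with
  | empty => exact ⟨0, le_rfl, one_pos, by simp⟩
  | insert a t _ ih =>
    obtain ⟨r, h0, h1, h2⟩ := ih fun i hi => h i (Finset.mem_insert_of_mem hi)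
    refine ⟨max (f a) r, le_max_of_le_right h0, max_lt (h a (Finset.mem_insert_self a t)) h1,
      fun i hi => ?_⟩
    rcases Finset.mem_insert.1 hi with rfl | hi
    · exact le_max_left _ _
    · exact (h2 i hi).trans (le_max_right _ _)

open scoped Classical in
/-- The values on a finite set `E` of the states which vanish on an ideal `M` form a compact convex
set, so a finite number of linear functionals suffices to separate from it all the families of values
which have distance at least `ε` to it. After an affine change the functionals take values in an interval
`[0, r]`, with `r < 1`, on the states, and one of them is at least one on each given family. -/
theorem exists_separating_family (M : TwoSidedIdeal (GroupCStar Γ)) (E : Finset Γ) (hE : 1 ∈ E) {ε : ℝ} (hε : 0 < ε) :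
    ∃ (T : Finset (Γ →₀ ℂ)) (r : ℝ), 0 ≤ r ∧ r < 1 ∧
      (∀ c ∈ T, c.support ⊆ E ∧ ∀ φ : State Γ, (∀ a ∈ M, φ.1 a = 0) →
        0 ≤ (φ.1 (groupSum c)).re ∧ (φ.1 (groupSum c)).re ≤ r) ∧
      ∀ w : Γ → ℂ, w 1 = 1 → (∀ s, ‖w s‖ ≤ 1) →
        (∀ φ : State Γ, (∀ a ∈ M, φ.1 a = 0) → ∃ s ∈ E, ε ≤ ‖φ.evalAt s - w s‖) →
        ∃ c ∈ T, 1 ≤ (c.sum fun s z => z * w s).re := by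
  let R : (GroupCStar Γ → ℂ) →ₗ[ℝ] (E → ℂ) :=
    { toFun := fun f s => f (gElt (s : Γ))
      map_add' := fun _ _ => rfl
      map_smul' := fun _ _ => rfl }
  have hR : Continuous R := continuous_pi fun s => continuous_apply _
  let K : Set (E → ℂ) := R '' stateSet M
  have hKc : Convex ℝ K := (convex_stateSet M).linear_image R
  have hKk : IsCompact K := (isCompact_stateSet M).image hR
  have hKmem : ∀ φ : State Γ, (∀ a ∈ M, φ.1 a = 0) → (fun s : E => φ.evalAt s) ∈ K :=
    fun φ hφ => ⟨φ.1, ⟨φ, hφ, rfl⟩, rfl⟩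
  have hKval : ∀ k ∈ K, ‖k‖ ≤ 1 ∧ k ⟨1, hE⟩ = 1 := by
    rintro _ ⟨_, ⟨φ, hφ, rfl⟩, rfl⟩
    exact ⟨(pi_norm_le_iff_of_nonneg zero_le_one).2 fun s => φ.norm_evalAt_le _, φ.apply_one⟩
  let B : Set (E → ℂ) :=
    Metric.closedBall 0 1 ∩ ({w | w ⟨1, hE⟩ = 1} ∩ ⋂ k ∈ K, {w | ε ≤ dist k w})
  have hBk : IsCompact B := by
    refine (isCompact_closedBall _ _).inter_right (IsClosed.inter ?_ ?_)
    · exact isClosed_eq (continuous_apply _) continuous_const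
    · exact isClosed_biInter fun k _ => isClosed_le continuous_const (by fun_prop)
  have hBK : ∀ w ∈ B, w ∉ K := fun w hw hwK => by
    have := Set.mem_iInter₂.1 hw.2.2 w hwK
    rw [Set.mem_ofPred_eq, dist_self] at this
    linarith
  -- the linear functional given by a finitely supported function
  let ℓ : (Γ →₀ ℂ) → (E → ℂ) → ℂ := fun c w => ∑ s : E, c s * w s
  have hℓ : ∀ c, Continuous (ℓ c) := fun c => by fun_prop
  have sep : ∀ w : B, ∃ (c : Γ →₀ ℂ) (r : ℝ), c.support ⊆ E ∧ r < 1 ∧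
      (∀ k ∈ K, 0 ≤ (ℓ c k).re ∧ (ℓ c k).re ≤ r) ∧ 1 < (ℓ c w).re := by
    rintro ⟨w, hw⟩
    obtain ⟨f, u, v, hu, huv, hv⟩ := RCLike.geometric_hahn_banach_closed_compact (𝕜 := ℂ) hKc
      hKk.isClosed (convex_singleton w) isCompact_singleton
      (Set.disjoint_singleton_right.2 (hBK w hw))
    have hv := hv w rfl
    let N : ℝ := ‖f‖ + |v| + 1
    have hN : 0 < v + N := by
      have := neg_abs_le v
      have := norm_nonneg f
      simp only [N]; linarith
    let c : Γ →₀ ℂ := ((v + N : ℝ) : ℂ)⁻¹ • (∑ s : E, Finsupp.single (s : Γ) (f (Pi.single s 1)) +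
      Finsupp.single 1 (N : ℂ))
    have hcsupp : c.support ⊆ E := by
      refine Finsupp.support_smul.trans (Finsupp.support_add.trans (Finset.union_subset ?_ ?_))
      · refine Finsupp.support_finsetSum.trans (Finset.biUnion_subset.2 fun s _ => ?_)
        exact Finsupp.support_single_subset.trans (Finset.singleton_subset_iff.2 s.2)
      · exact Finsupp.support_single_subset.trans (Finset.singleton_subset_iff.2 hE)
    have hval : ∀ k : E → ℂ, k ⟨1, hE⟩ = 1 → (ℓ c k).re = ((f k).re + N) / (v + N) := by
      intro k hk
      have h1 : ∀ s : E, c s = ((v + N : ℝ) : ℂ)⁻¹ * (f (Pi.single s 1) +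
          if s = ⟨1, hE⟩ then (N : ℂ) else 0) := by
        intro s
        simp only [c, Finsupp.smul_apply, Finsupp.add_apply, smul_eq_mul, Finsupp.finsetSum_apply]
        congr 2
        · rw [Finset.sum_eq_single s]
          · rw [Finsupp.single_eq_same]
          · intro t _ hts
            rw [Finsupp.single_apply, if_neg fun h => hts (Subtype.ext h)]
          · intro h; exact absurd (Finset.mem_univ s) h
        · rw [Finsupp.single_apply]
          congr 1
          rw [eq_iff_iff, eq_comm, Subtype.ext_iff]
      have h2 : f k = ∑ s : E, f (Pi.single s 1) * k s := by
        conv_lhs => rw [pi_eq_sum_univ' k]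
        rw [map_sum]
        refine Finset.sum_congr rfl fun s _ => ?_
        rw [map_smul, smul_eq_mul, mul_comm]
      have h3 : ℓ c k = ((v + N : ℝ) : ℂ)⁻¹ * (f k + N) := by
        simp only [ℓ, h1]
        rw [h2, ← Finset.sum_congr rfl fun s _ => (mul_assoc _ _ _).symm, ← Finset.mul_sum]
        congr 1
        simp only [add_mul, ite_mul, zero_mul, Finset.sum_add_distrib]
        rw [Finset.sum_ite_eq' Finset.univ, if_pos (Finset.mem_univ _), hk, mul_one]
      rw [h3, ← Complex.ofReal_inv, Complex.re_ofReal_mul, Complex.add_re, Complex.ofReal_re,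
        div_eq_inv_mul]
    refine ⟨c, (u + N) / (v + N), hcsupp, (div_lt_one hN).2 (by linarith), fun k hk => ?_, ?_⟩
    · rw [hval k (hKval k hk).2]
      refine ⟨div_nonneg ?_ hN.le, by gcongr; exact (hu k hk).le⟩
      have h1 : |(f k).re| ≤ ‖f‖ := (Complex.abs_re_le_norm _).trans ((f.le_opNorm k).trans
        (mul_le_of_le_one_right (norm_nonneg _) (hKval k hk).1))
      have := (abs_le.1 h1).1
      have := abs_nonneg v
      simp only [N]; linarith
    · rw [hval w hw.2.1, lt_div_iff₀ hN, one_mul]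
      exact add_lt_add_left hv N
  choose c r hcs hr hck hcw using sep
  obtain ⟨t, ht⟩ := hBk.elim_finite_subcover (fun w : B => {w' | 1 < (ℓ (c w) w').re})
    (fun w => isOpen_lt continuous_const (Complex.continuous_re.comp (hℓ _)))
    fun w hw => Set.mem_iUnion.2 ⟨⟨w, hw⟩, hcw ⟨w, hw⟩⟩
  obtain ⟨r₀, h0, h1, hr₀⟩ := exists_lt_one_of_finset t r fun w _ => hr w
  have hℓsum : ∀ (w : B) (k : Γ → ℂ), ((c w).sum fun s z => z * k s) = ℓ (c w) fun s => k s := by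
    intro w k
    rw [Finsupp.sum_of_support_subset (c w) (hcs w) (fun s z => z * k s) fun s _ => zero_mul _]
    exact (Finset.sum_coe_sort E fun s => c w s * k s).symm
  refine ⟨t.image c, r₀, h0, h1, fun d hd => ?_, fun w hw1 hw hbad => ?_⟩
  · obtain ⟨w, hw, rfl⟩ := Finset.mem_image.1 hd
    refine ⟨hcs w, fun φ hφ => ?_⟩
    have h2 : φ.1 (groupSum (c w)) = ℓ (c w) fun s => φ.evalAt s := by
      rw [← hℓsum, groupSum, Finsupp.linearCombination_apply, map_finsuppSum]
      exact Finsupp.sum_congr fun s _ => by rw [map_smul]; rfl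
    rw [h2]
    exact ⟨(hck w _ (hKmem φ hφ)).1, (hck w _ (hKmem φ hφ)).2.trans (hr₀ w hw)⟩
  · have hwB : (fun s : E => w s) ∈ B := by
      refine ⟨mem_closedBall_zero_iff.2 ((pi_norm_le_iff_of_nonneg zero_le_one).2 fun s => hw s), hw1,
        Set.mem_iInter₂.2 ?_⟩
      rintro _ ⟨_, ⟨φ, hφ, rfl⟩, rfl⟩
      obtain ⟨s, hs, h⟩ := hbad φ hφ
      rw [Set.mem_ofPred_eq, dist_eq_norm]
      exact h.trans (norm_le_pi_norm (fun s : E => φ.evalAt s - w s) ⟨s, hs⟩)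
    obtain ⟨w', hw't, hw'⟩ := Set.mem_iUnion₂.1 (ht hwB)
    refine ⟨c w', Finset.mem_image_of_mem c hw't, ?_⟩
    rw [hℓsum]
    exact le_of_lt hw'

end separation

/-! ### Norm inequalities in induced representations -/

section inequalities

lemma re_inner_star_mul_self {H : Type*} [NormedAddCommGroup H] [InnerProductSpace ℂ H]
    [CompleteSpace H] (T : H →L[ℂ] H) (ξ : H) : (⟪(star T * T) ξ, ξ⟫_ℂ).re = ‖T ξ‖ ^ 2 := by
  rw [mul_apply_eq_comp, ContinuousLinearMap.star_eq_adjoint, ContinuousLinearMap.adjoint_inner_left,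
    inner_self_eq_norm_sq_to_K]
  norm_cast

lemma re_inner_sum_sub {A : Type*} [NonUnitalCStarAlgebra A] {H : Type*} [NormedAddCommGroup H]
    [InnerProductSpace ℂ H] [CompleteSpace H] (κ : A →⋆ₙₐ[ℂ] (H →L[ℂ] H)) {ι : Type*} (T : Finset ι)
    (b : ι → A) (q : A) (ξ : H) :
    (⟪κ (∑ i ∈ T, star (b i) * b i - star q * q) ξ, ξ⟫_ℂ).re =
      ∑ i ∈ T, ‖κ (b i) ξ‖ ^ 2 - ‖κ q ξ‖ ^ 2 := by
  simp only [map_sub, map_sum, map_mul, map_star]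
  rw [sub_apply, inner_sub_left, Complex.sub_re, re_inner_star_mul_self, sum_apply, sum_inner,
    Complex.re_sum]
  simp only [re_inner_star_mul_self]

/-- Inequalities between sums of squares of norms are inherited by weakly contained representations. -/
lemma norm_sq_le_sum_of_ker_le {A : Type*} [NonUnitalCStarAlgebra A] {H₁ H₂ : Type*}
    [NormedAddCommGroup H₁] [InnerProductSpace ℂ H₁] [CompleteSpace H₁] [NormedAddCommGroup H₂]
    [InnerProductSpace ℂ H₂] [CompleteSpace H₂] {σ : A →⋆ₙₐ[ℂ] (H₁ →L[ℂ] H₁)}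
    {τ : A →⋆ₙₐ[ℂ] (H₂ →L[ℂ] H₂)} (h : WeaklyContained σ τ) {ι : Type*} (T : Finset ι) (b : ι → A)
    (q : A) (hτ : ∀ ξ, ‖τ q ξ‖ ^ 2 ≤ ∑ i ∈ T, ‖τ (b i) ξ‖ ^ 2) (ξ : H₁) :
    ‖σ q ξ‖ ^ 2 ≤ ∑ i ∈ T, ‖σ (b i) ξ‖ ^ 2 := by
  let D : A := ∑ i ∈ T, star (b i) * b i - star q * q
  have hD : IsSelfAdjoint D := by
    refine IsSelfAdjoint.sub ?_ (IsSelfAdjoint.star_mul_self q)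
    exact isSelfAdjoint_sum T fun i _ => IsSelfAdjoint.star_mul_self _
  have h0 : 0 ≤ τ D := by
    rw [ContinuousLinearMap.nonneg_iff_isPositive, ContinuousLinearMap.isPositive_def']
    refine ⟨hD.map τ, fun ξ => ?_⟩
    rw [ContinuousLinearMap.reApplyInnerSelf_apply]
    change 0 ≤ (⟪τ D ξ, ξ⟫_ℂ).re
    rw [re_inner_sum_sub, sub_nonneg]
    exact hτ ξ
  have h1 := nonneg_of_ker_le σ τ (fun a ha => h.apply_eq_zero a ha) hD h0
  rw [ContinuousLinearMap.nonneg_iff_isPositive, ContinuousLinearMap.isPositive_def'] at h1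
  have h2 := h1.2 ξ
  rw [ContinuousLinearMap.reApplyInnerSelf_apply] at h2
  change 0 ≤ (⟪σ D ξ, ξ⟫_ℂ).re at h2
  rwa [re_inner_sum_sub, sub_nonneg] at h2

lemma norm_sq_dirSum {A : Type*} [NonUnitalCStarAlgebra A] {J : Type*} {H : J → Type*}
    [∀ j, NormedAddCommGroup (H j)] [∀ j, InnerProductSpace ℂ (H j)] [∀ j, CompleteSpace (H j)]
    (ξ : lp H 2) : HasSum (fun j => ‖ξ j‖ ^ 2) (‖ξ‖ ^ 2) := by
  have h := lp.hasSum_norm (p := 2) (by norm_num) ξ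
  simpa using h

lemma norm_sq_le_sum_dirSum {A : Type*} [NonUnitalCStarAlgebra A] {J : Type*} {H : J → Type*}
    [∀ j, NormedAddCommGroup (H j)] [∀ j, InnerProductSpace ℂ (H j)] [∀ j, CompleteSpace (H j)]
    (σ : ∀ j, A →⋆ₙₐ[ℂ] (H j →L[ℂ] H j)) {ι : Type*} (T : Finset ι) (b : ι → A)
    (q : A) (h : ∀ j ξ, ‖σ j q ξ‖ ^ 2 ≤ ∑ i ∈ T, ‖σ j (b i) ξ‖ ^ 2) (ξ : lp H 2) :
    ‖dirSum σ q ξ‖ ^ 2 ≤ ∑ i ∈ T, ‖dirSum σ (b i) ξ‖ ^ 2 :=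
  hasSum_le (fun j => h j (ξ j)) (norm_sq_dirSum (A := A) (dirSum σ q ξ))
    (hasSum_sum fun i _ => norm_sq_dirSum (A := A) (dirSum σ (b i) ξ))

/-- The self-adjoint part of an element of a complex star-algebra. -/
def herm {A : Type*} [AddCommGroup A] [Module ℂ A] [Star A] (a : A) : A := (2⁻¹ : ℂ) • (a + star a)

lemma star_herm {A : Type*} [NonUnitalRing A] [Module ℂ A] [StarRing A] [StarModule ℂ A] (a : A) :
    star (herm a) = herm a := by
  rw [herm, star_smul, star_add, star_star, add_comm]
  simp

lemma re_inner_herm {H : Type*} [NormedAddCommGroup H] [InnerProductSpace ℂ H]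
    [CompleteSpace H] (T : H →L[ℂ] H) (ξ : H) : (⟪herm T ξ, ξ⟫_ℂ).re = (⟪ξ, T ξ⟫_ℂ).re := by
  have h1 : (⟪T ξ, ξ⟫_ℂ).re = (⟪ξ, T ξ⟫_ℂ).re := by
    rw [← inner_conj_symm, Complex.conj_re]
  rw [herm, smul_apply, inner_smul_left, add_apply, inner_add_left,
    ContinuousLinearMap.star_eq_adjoint, ContinuousLinearMap.adjoint_inner_left]
  simp only [map_inv₀, Complex.conj_ofNat]
  rw [show (2⁻¹ : ℂ) = ((2⁻¹ : ℝ) : ℂ) by push_cast; rfl, Complex.re_ofReal_mul, Complex.add_re, h1]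
  ring

lemma map_iterate_mul {A B : Type*} [NonUnitalCStarAlgebra A] [CStarAlgebra B] (σ : A →⋆ₙₐ[ℂ] B)
    (a : A) (n : ℕ) : σ ((a * ·)^[n] a) = σ a ^ (n + 1) := by
  induction n with
  | zero => simp
  | succ n ih => rw [Function.iterate_succ_apply', map_mul, ih, ← pow_succ']

variable {X : Type u} [Groupoid.{u} X] [TopologicalSpace X] [TopologicalSpace (Arr X)]
  [EtaleGroupoid X] [T2Space (Arr X)] [LocallyCompactSpace (Arr X)]

/-- The operator by which a function on the groupoid acts on the fiber over an arrow `g : y ⟶ z` of the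
space of the representation induced from `π`. -/
abbrev fiberOp {y z : X} (g : y ⟶ z) {H : Type u} [NormedAddCommGroup H] [InnerProductSpace ℂ H]
    [CompleteSpace H] (π : URep (End y) H) (f : ConvAlg X) : H →L[ℂ] H :=
  (conjRep g π).sum (isoCoeff z f)

/-- All the arrows with range `z` in the support of `f` belong to the isotropy group at `z`. -/
def IsIsotropicAt (f : ConvAlg X) (z : X) : Prop := ∀ h : RngFib z, f.fn h.arr ≠ 0 → h.1 = z

section fiber

variable {y z : X} (g : y ⟶ z) {H : Type u} [NormedAddCommGroup H] [InnerProductSpace ℂ H]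
    [CompleteSpace H] (π : URep (End y) H)

lemma star_fiberOp (f : ConvAlg X) : star (fiberOp g π f) = fiberOp g π (star f) := by
  rw [fiberOp, fiberOp, ← URep.toCStar_groupSum, ← URep.toCStar_groupSum,
    star_groupSum (isoCoeff z f) (isoCoeff z (star f)) fun a => rfl, map_star]

lemma fiberOp_add (f f' : ConvAlg X) : fiberOp g π (f + f') = fiberOp g π f + fiberOp g π f' := by
  rw [fiberOp, fiberOp, fiberOp, ← map_add]
  congr 1
  ext a; simp [isoCoeff_apply]

lemma fiberOp_smul (c : ℂ) (f : ConvAlg X) : fiberOp g π (c • f) = c • fiberOp g π f := by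
  rw [fiberOp, fiberOp, ← map_smul]
  congr 1
  ext a; simp [isoCoeff_apply]

lemma fiberOp_herm (f : ConvAlg X) : fiberOp g π (herm f) = herm (fiberOp g π f) := by
  rw [herm, herm, fiberOp_smul, fiberOp_add, star_fiberOp]

variable {π}

open IndSpace in
lemma IsIsotropicAt.op_fn {f : ConvAlg X} (hf : IsIsotropicAt f z)
    (ξ : IndSpace (MonoidHom.id (End y)) π Function.injective_id) :
    (op f ξ).fn ⟨z, g⟩ = fiberOp g π f (ξ.fn ⟨z, g⟩) :=
  op_fn_eq_sum g f ξ fun h hh => hf h (smul_ne_zero_iff.1 hh).1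

open IndSpace in
lemma IsIsotropicAt.op_pow_fn {f : ConvAlg X} (hf : IsIsotropicAt f z) (n : ℕ)
    (ξ : IndSpace (MonoidHom.id (End y)) π Function.injective_id) :
    ((op f ^ n) ξ).fn ⟨z, g⟩ = (fiberOp g π f ^ n) (ξ.fn ⟨z, g⟩) := by
  induction n with
  | zero => rfl
  | succ n ih =>
    rw [pow_succ', pow_succ', mul_apply_eq_comp, mul_apply_eq_comp, hf.op_fn, ih]

open IndSpace in
lemma IsIsotropicAt.op_point {f : ConvAlg X} (hf : IsIsotropicAt f z) (hfs : star f = f) (ζ : H) :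
    (op f (point ⟨z, g⟩ ζ) : IndSpace (MonoidHom.id (End y)) π Function.injective_id) =
      point ⟨z, g⟩ (fiberOp g π f ζ) := by
  rw [← sub_eq_zero]
  generalize hη : (op f (point ⟨z, g⟩ ζ) - point ⟨z, g⟩ (fiberOp g π f ζ) :
    IndSpace (MonoidHom.id (End y)) π Function.injective_id) = η
  have h1 : ⟪η, op f (point ⟨z, g⟩ ζ)⟫_ℂ = ⟪η.fn ⟨z, g⟩, fiberOp g π f ζ⟫_ℂ := by
    have := op_inner f η (point ⟨z, g⟩ ζ)
    rw [hfs] at this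
    rw [← this, inner_point, hf.op_fn, ← ContinuousLinearMap.adjoint_inner_right,
      ← ContinuousLinearMap.star_eq_adjoint, star_fiberOp, hfs]
  have h2 : ⟪η, op f (point ⟨z, g⟩ ζ) - point ⟨z, g⟩ (fiberOp g π f ζ)⟫_ℂ = 0 := by
    rw [inner_sub_right, h1, inner_point, sub_self]
  rw [hη] at h2
  exact inner_self_eq_zero.1 h2

open IndSpace in
lemma IsIsotropicAt.op_pow_point {f : ConvAlg X} (hf : IsIsotropicAt f z) (hfs : star f = f) (n : ℕ)
    (ζ : H) :
    ((op f ^ n) (point ⟨z, g⟩ ζ) : IndSpace (MonoidHom.id (End y)) π Function.injective_id) =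
      point ⟨z, g⟩ ((fiberOp g π f ^ n) ζ) := by
  induction n with
  | zero => rfl
  | succ n ih => rw [pow_succ', pow_succ', mul_apply_eq_comp, mul_apply_eq_comp, ih, hf.op_point g hfs]

end fiber

open IndSpace in
/-- If over every point of a set `U` of units one of the self-adjoint functions `a i` acts on each vector
with a numerical value at least one, then the powers of the `a i` do not decrease the part of a vector
which lies over `U`. -/
lemma norm_sq_op_le_sum {y : X} {H : Type u} [NormedAddCommGroup H] [InnerProductSpace ℂ H]
    [CompleteSpace H] (π : URep (End y) H) {U : Set X} {ι : Type*} (T : Finset ι) (a : ι → ConvAlg X)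
    (ha : ∀ i, star (a i) = a i)
    (hT : ∀ z ∈ U, ∀ (g : y ⟶ z) (ζ : H), ζ ≠ 0 → ∃ i ∈ T, IsIsotropicAt (a i) z ∧
      ‖ζ‖ ^ 2 ≤ (⟪fiberOp g π (a i) ζ, ζ⟫_ℂ).re)
    (q : ConvAlg X) (hq : ∀ z ∈ U, IsIsotropicAt q z ∧ ∀ (g : y ⟶ z) (ζ : H), ‖fiberOp g π q ζ‖ ≤ ‖ζ‖)
    (hqU : ∀ h : Arr X, q.fn h ≠ 0 → h.rng ∈ U) (n : ℕ)
    (ξ : IndSpace (MonoidHom.id (End y)) π Function.injective_id) :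
    ‖op q ξ‖ ^ 2 ≤ ∑ i ∈ T, ‖(op (a i) ^ n) ξ‖ ^ 2 := by
  simp only [norm_sq_eq]
  rw [← Summable.tsum_finsetSum fun i _ => summable_norm_sq _]
  refine (summable_norm_sq _).tsum_le_tsum (fun p => ?_) (summable_sum fun i _ => summable_norm_sq _)
  obtain ⟨z, g⟩ := p.out
  by_cases hz : z ∈ U ∧ ξ.fn ⟨z, g⟩ ≠ 0
  · obtain ⟨hz, hne⟩ := hz
    obtain ⟨i, hi, hiso, hle⟩ := hT z hz g (ξ.fn ⟨z, g⟩) hne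
    have h1 : ‖(op q ξ).fn ⟨z, g⟩‖ ≤ ‖ξ.fn ⟨z, g⟩‖ := by
      rw [(hq z hz).1.op_fn]; exact (hq z hz).2 g _
    have hsymm : ((fiberOp g π (a i) : H →L[ℂ] H) : H →ₗ[ℂ] H).IsSymmetric := by
      have h2 : IsSelfAdjoint (fiberOp g π (a i)) := by
        rw [isSelfAdjoint_iff, star_fiberOp, ha]
      exact h2.isSymmetric
    have h2 : ‖ξ.fn ⟨z, g⟩‖ ≤ ‖((op (a i) ^ n) ξ).fn ⟨z, g⟩‖ := by
      have := pow_mul_norm_le_of_isSymmetric hsymm zero_le_one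
        (x := ξ.fn ⟨z, g⟩) (by rw [one_mul]; exact hle) n
      rw [one_pow, one_mul] at this
      rw [hiso.op_pow_fn]
      refine this.trans_eq ?_
      rw [← ContinuousLinearMap.toLinearMap_pow]
      rfl
    calc ‖(op q ξ).fn ⟨z, g⟩‖ ^ 2 ≤ ‖((op (a i) ^ n) ξ).fn ⟨z, g⟩‖ ^ 2 := by
          gcongr; exact h1.trans h2
      _ ≤ _ := Finset.single_le_sum (f := fun i => ‖((op (a i) ^ n) ξ).fn ⟨z, g⟩‖ ^ 2)
          (fun i _ => by positivity) hi
  · have h0 : (op q ξ).fn ⟨z, g⟩ = 0 := by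
      by_cases hzU : z ∈ U
      · rw [(hq z hzU).1.op_fn, not_not.1 fun h => hz ⟨hzU, h⟩, map_zero]
      · exact convAct_eq_zero _ _ fun h => by
          by_contra h0
          exact hzU (hqU _ h0)
    rw [h0, norm_zero, zero_pow two_ne_zero]
    exact Finset.sum_nonneg fun i _ => by positivity

end inequalities

/-! ### From weak containment to approximation by states -/

section approximation

lemma exists_unit_inner_eq {H : Type*} [NormedAddCommGroup H] [InnerProductSpace ℂ H] {ξ : H}
    (hξ : ξ ≠ 0) : ∃ η : H, ‖η‖ = 1 ∧
      ∀ T : H →L[ℂ] H, (⟪ξ, T ξ⟫_ℂ).re = ‖ξ‖ ^ 2 * (⟪η, T η⟫_ℂ).re := by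
  have hn : ‖ξ‖ ≠ 0 := norm_ne_zero_iff.2 hξ
  let η : H := ((‖ξ‖⁻¹ : ℝ) : ℂ) • ξ
  have hη : ‖η‖ = 1 := by
    rw [norm_smul, Complex.norm_of_nonneg (by positivity), inv_mul_cancel₀ hn]
  have hξη : ξ = (‖ξ‖ : ℂ) • η := by
    rw [smul_smul, Complex.ofReal_inv, mul_inv_cancel₀ (by exact_mod_cast hn), one_smul]
  refine ⟨η, hη, fun T => ?_⟩
  conv_lhs => rw [hξη]
  rw [map_smul, inner_smul_left, inner_smul_right, Complex.conj_ofReal, ← mul_assoc,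
    ← Complex.ofReal_mul, Complex.re_ofReal_mul, sq]

/-- Functionals with small values on the states of a representation are given by elements whose
hermitian parts are small in the representation. -/
lemma norm_herm_le {Γ : Type v} [Group Γ] {L : Type v} [NormedAddCommGroup L] [InnerProductSpace ℂ L]
    [CompleteSpace L] (ρ : URep Γ L) {b : GroupCStar Γ} {r : ℝ} (hr : 0 ≤ r)
    (h : ∀ φ : State Γ, φ.IsOn ρ → 0 ≤ (φ.1 b).re ∧ (φ.1 b).re ≤ r) :
    ‖herm (ρ.toCStar b)‖ ≤ r := by
  have hval : ∀ ξ : L, 0 ≤ (⟪herm (ρ.toCStar b) ξ, ξ⟫_ℂ).re ∧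
      (⟪herm (ρ.toCStar b) ξ, ξ⟫_ℂ).re ≤ r * ‖ξ‖ ^ 2 := by
    intro ξ
    by_cases hξ : ξ = 0
    · simp [hξ]
    obtain ⟨η, hη, hηξ⟩ := exists_unit_inner_eq hξ
    have h1 := h _ (ρ.vectorState_isOn η hη)
    rw [ρ.vectorState_apply] at h1
    rw [re_inner_herm, hηξ]
    exact ⟨mul_nonneg (by positivity) h1.1, by
      rw [mul_comm]; exact mul_le_mul_of_nonneg_right h1.2 (by positivity)⟩
  have hsa : IsSelfAdjoint (herm (ρ.toCStar b)) := star_herm _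
  have h0 : 0 ≤ herm (ρ.toCStar b) := by
    rw [ContinuousLinearMap.nonneg_iff_isPositive, ContinuousLinearMap.isPositive_def']
    exact ⟨hsa, fun ξ => (hval ξ).1⟩
  rw [CStarAlgebra.norm_le_iff_le_algebraMap _ hr h0, ContinuousLinearMap.le_def,
    ContinuousLinearMap.isPositive_def']
  refine ⟨(IsSelfAdjoint.algebraMap _ (IsSelfAdjoint.all r)).sub hsa, fun ξ => ?_⟩
  rw [ContinuousLinearMap.reApplyInnerSelf_apply, sub_apply, inner_sub_left, map_sub, sub_nonneg]
  refine (hval ξ).2.trans_eq ?_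
  rw [Algebra.algebraMap_eq_smul_one]
  change _ = RCLike.re ⟪(r : ℝ) • ξ, ξ⟫_ℂ
  rw [← Complex.coe_smul, inner_smul_left, inner_self_eq_norm_sq_to_K]
  simp only [Complex.conj_ofReal]
  norm_cast
  change _ = ((r : ℂ) * ((‖ξ‖ ^ 2 : ℝ) : ℂ)).re
  rw [Complex.re_ofReal_mul, Complex.ofReal_re]

lemma herm_map {A B : Type*} [NonUnitalCStarAlgebra A] [NonUnitalCStarAlgebra B] (σ : A →⋆ₙₐ[ℂ] B)
    (a : A) : σ (herm a) = herm (σ a) := by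
  rw [herm, map_smul, map_add, map_star, herm]

variable {X : Type u} [Groupoid.{u} X] [TopologicalSpace X] [TopologicalSpace (Arr X)]
  [EtaleGroupoid X] [T2Space (Arr X)] [LocallyCompactSpace (Arr X)] {x : X}
  {W : End x → Set (Arr X)}

/-- A linear combination of functions supported in the bisections `W s`. -/
def bumpSum {Δ : Subgroup (End x)} (q : End x → ConvAlg X) (c : Δ →₀ ℂ) : ConvAlg X :=
  c.sum fun s w => w • q s

lemma bumpSum_fn {Δ : Subgroup (End x)} (q : End x → ConvAlg X) (c : Δ →₀ ℂ) (a : Arr X) :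
    (bumpSum q c).fn a = c.sum fun s w => w * (q s).fn a := by
  let e : ConvAlg X →+ ℂ := ⟨⟨fun f => f.fn a, rfl⟩, fun _ _ => rfl⟩
  change e _ = _
  rw [bumpSum, map_finsuppSum]
  rfl

section

variable {Δ : Subgroup (End x)} {q : End x → ConvAlg X} {z : X} {c : Δ →₀ ℂ}

lemma isIsotropicAt_herm_bumpSum (hWb : ∀ g, Arr.IsBisection (W g))
    (hq : ∀ s, Function.support (q s).fn ⊆ W s) (hc : ∀ s ∈ c.support, ∃ h : End z, isoArr h ∈ W s) :
    IsIsotropicAt (herm (bumpSum q c)) z := by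
  have key : ∀ a : Arr X, (bumpSum q c).fn a ≠ 0 → (a.rng = z ∨ a.src = z) → a.rng = z ∧ a.src = z := by
    intro a ha haz
    rw [bumpSum_fn] at ha
    obtain ⟨s, hs, hne⟩ := Finset.exists_ne_zero_of_sum_ne_zero ha
    have haW : a ∈ W s := hq s (right_ne_zero_of_mul hne)
    have hmem := isoPt_mem (hc s hs)
    have : a = isoArr (isoPt (W s) z) := by
      rcases haz with haz | haz
      · exact (hWb s).2 haW hmem haz
      · exact (hWb s).1 haW hmem haz
    rw [this]
    exact ⟨rfl, rfl⟩
  intro h hh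
  have h1 : (herm (bumpSum q c)).fn h.arr = 2⁻¹ * ((bumpSum q c).fn h.arr +
      starRingEnd ℂ ((bumpSum q c).fn h.arr.inv)) := rfl
  by_cases h2 : (bumpSum q c).fn h.arr = 0
  · have h3 : (bumpSum q c).fn h.arr.inv ≠ 0 := fun h3 => hh (by rw [h1, h2, h3]; simp)
    exact (key _ h3 (Or.inr rfl)).1
  · exact (key _ h2 (Or.inl rfl)).2

lemma fiberOp_bumpSum (hWb : ∀ g, Arr.IsBisection (W g))
    (hq : ∀ s, Function.support (q s).fn ⊆ W s) (hc : ∀ s ∈ c.support, ∃ h : End z, isoArr h ∈ W s)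
    {y : X} (g : y ⟶ z) {H : Type u} [NormedAddCommGroup H] [InnerProductSpace ℂ H]
    [CompleteSpace H] (π : URep (End y) H)
    (h1 : ∀ s ∈ c.support, (q s).fn (isoArr (isoPt (W s) z)) = 1) :
    fiberOp g π (bumpSum q c) =
      c.sum fun s w => w • (conjRep g π (isoPt (W s) z) : H →L[ℂ] H) := by
  let e : ConvAlg X →+ (H →L[ℂ] H) :=
    ⟨⟨fun f => fiberOp g π f, by
      have := fiberOp_smul g π 0 (0 : ConvAlg X)
      rwa [zero_smul, zero_smul] at this⟩, fun _ _ => fiberOp_add g π _ _⟩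
  change e _ = _
  rw [bumpSum, map_finsuppSum]
  refine Finsupp.sum_congr fun s hs => ?_
  change fiberOp g π _ = _
  rw [fiberOp_smul, fiberOp, isoCoeff_eq_single (hWb s) (hq s) (isoPt_mem (hc s hs)), h1 s hs,
    URep.sum_single, one_smul]

end

variable {Y : Set X} {HY : Y → Type u} [∀ y, NormedAddCommGroup (HY y)]
  [∀ y, InnerProductSpace ℂ (HY y)] [∀ y, CompleteSpace (HY y)]
  {πY : ∀ y : Y, URep (End (y : X)) (HY y)} {H : Type u} [NormedAddCommGroup H]
  [InnerProductSpace ℂ H] [CompleteSpace H] {π : URep (End x) H} {Δ : Subgroup (End x)} {L : Type u}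
  [NormedAddCommGroup L] [InnerProductSpace ℂ L] [CompleteSpace L] {ρ : URep Δ L}

lemma isoPt_self (hWb : ∀ g, Arr.IsBisection (W g)) (hWg : ∀ g, isoArr g ∈ W g) (g : End x) :
    isoPt (W g) x = g := isoPt_eq (hWb g) (hWg g)

/-- If the representation induced from `π` is weakly contained in the sum of the representations induced
from the `π_y`, then there are a state on `ρ ≺ π|_Δ` and a state on one of the representations `π_y^g`,
with `r(g)` close to `x`, which have close values on a given finite set. Otherwise the values of the
states on the `π_y^g` could be separated from the values of the states on `ρ` by a finite number of
self-adjoint functions `a` on the groupoid, with `a ≥ 1` on the former and `0 ≤ a ≤ r < 1` on the latter.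
As these functions commute with the decomposition over the units near `x`, their high powers would
contradict the weak containment. -/
theorem exists_close_states (hWo : ∀ g, IsOpen (W g)) (hWb : ∀ g, Arr.IsBisection (W g))
    (hWg : ∀ g, isoArr g ∈ W g)
    (hπ : WeaklyContained (isoIndRep π) (dirSum fun y : Y => isoIndRep (πY y))) [Nontrivial L]
    (hρ : WeaklyContained ρ.toCStar (π.res Δ).toCStar) {U : Set X} (hU : U ∈ 𝓝 x) (E : Finset Δ)
    {ε : ℝ} (hε : 0 < ε) :
    ∃ (y : Y) (z : X) (g : (y : X) ⟶ z) (ν : State (End z)) (φ : State Δ), z ∈ U ∧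
      ν.IsOn (conjRep g (πY y)) ∧ φ.IsOn ρ ∧
      ∀ s ∈ E, ∀ h : End z, isoArr h ∈ W s → ‖φ.evalAt s - ν.evalAt h‖ < ε := by
  classical
  by_contra! hcon
  have hsep := fun E' : Finset Δ =>
    exists_separating_family ρ.ker (insert 1 E') (Finset.mem_insert_self _ _) hε
  choose T r hr0 hr1 hT hTw using hsep
  let E₀ : Finset Δ := insert 1 E
  let 𝓣 : Finset (Δ →₀ ℂ) := E₀.powerset.biUnion T
  obtain ⟨r₀, hr₀0, hr₀1, hr₀⟩ := exists_lt_one_of_finset E₀.powerset r fun E' _ => hr1 E'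
  have h𝓣 : ∀ c ∈ 𝓣, c.support ⊆ E₀ ∧ ∀ φ : State Δ, φ.IsOn ρ →
      0 ≤ (φ.1 (groupSum c)).re ∧ (φ.1 (groupSum c)).re ≤ r₀ := by
    intro c hc
    obtain ⟨E', hE', hc⟩ := Finset.mem_biUnion.1 hc
    refine ⟨(hT E' c hc).1.trans (Finset.insert_subset (Finset.mem_insert_self _ _)
      (Finset.mem_powerset.1 hE')), fun φ hφ => ?_⟩
    have := (hT E' c hc).2 φ hφ
    exact ⟨this.1, this.2.trans (hr₀ E' hE')⟩
  have hb := fun s : End x => exists_bump (hWo s) (hWg s)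
  choose q hqW hqV _ using hb
  choose V hVo hgV hV using hqV
  have hq : ∀ s, Function.support (q s).fn ⊆ W s := fun s => (subset_tsupport _).trans (hqW s)
  -- a neighbourhood of `x` over which the functions `q s` are equal to one on the isotropy groups
  have hN : ∀ᶠ z in 𝓝 x, z ∈ U ∧ isoArr (1 : End z) ∈ W 1 ∧
      ∀ s ∈ E₀, ∀ a ∈ W s, a.src = z → a ∈ V s := by
    refine (eventually_mem_set.2 hU).and (Eventually.and ?_ ?_)
    · exact (tendsto_isoArr_one tendsto_id).eventually ((hWo 1).mem_nhds (hWg 1))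
    · exact (eventually_all_finset E₀).2 fun s _ =>
        eventually_mem_of_isBisection (hWo s) (hWb s) (hWg s) ((hVo s).mem_nhds (hgV s))
  obtain ⟨U₁, hU₁, hU₁o, hxU₁⟩ := mem_nhds_iff.1 hN
  have hone : ∀ z ∈ U₁, isoArr (1 : End z) ∈ W 1 := fun z hz => (hU₁ hz).2.1
  have hqone : ∀ z ∈ U₁, ∀ s ∈ E₀, (∃ h : End z, isoArr h ∈ W s) →
      (q s).fn (isoArr (isoPt (W s) z)) = 1 := fun z hz s hs hm =>
    hV s _ ((hU₁ hz).2.2 s hs _ (isoPt_mem hm) rfl)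
  obtain ⟨q₀, hq₀W, ⟨V₀, -, hgV₀, hV₀⟩, hq₀n⟩ := exists_bump
    (W := W 1 ∩ (Arr.src ⁻¹' U₁ ∩ Arr.rng ⁻¹' U₁)) ((hWo 1).inter
      ((hU₁o.preimage Arr.continuous_src).inter (hU₁o.preimage Arr.continuous_rng)))
    (g := isoArr (1 : End x)) ⟨hWg 1, hxU₁, hxU₁⟩
  have hq₀ := (subset_tsupport _).trans hq₀W
  have hq₀W1 : Function.support q₀.fn ⊆ W 1 := hq₀.trans Set.inter_subset_left
  let a : (Δ →₀ ℂ) → ConvAlg X := fun c => herm (bumpSum q c)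
  have hiso : ∀ z ∈ U₁, IsIsotropicAt q₀ z ∧ ∀ (y : Y) (g : (y : X) ⟶ z) (ζ : HY y),
      ‖fiberOp g (πY y) q₀ ζ‖ ≤ ‖ζ‖ := by
    refine fun z hz => ⟨fun h hh => ?_, fun y g ζ => ?_⟩
    · exact congrArg Arr.src ((hWb 1).2 (hq₀W1 hh) (hone z hz) rfl)
    · rw [fiberOp, isoCoeff_eq_single (hWb 1) hq₀W1 (hone z hz), URep.sum_single, smul_apply,
        norm_smul, URep.norm_apply]
      exact mul_le_of_le_one_left (norm_nonneg _) (hq₀n _)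
  have hYT : ∀ (y : Y), ∀ z ∈ U₁, ∀ (g : (y : X) ⟶ z) (ζ : HY y), ζ ≠ 0 → ∃ c ∈ 𝓣,
      IsIsotropicAt (a c) z ∧ ‖ζ‖ ^ 2 ≤ (⟪fiberOp g (πY y) (a c) ζ, ζ⟫_ℂ).re := by
    intro y z hz g ζ hζ
    obtain ⟨η, hη, hηζ⟩ := exists_unit_inner_eq hζ
    let ν := (conjRep g (πY y)).vectorState η hη
    let E' := E₀.filter fun s : Δ => ∃ h : End z, isoArr h ∈ W s
    have h1pt : isoPt (W ((1 : Δ) : End x)) z = 1 := isoPt_eq (hWb _) (hone z hz)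
    obtain ⟨c, hc, hle⟩ := hTw E' (fun s => ν.evalAt (isoPt (W s) z)) (by
      rw [h1pt]; exact ν.apply_one) (fun s => ν.norm_evalAt_le _) fun φ hφ => by
        obtain ⟨s, hs, h, hhs, hle⟩ := hcon y z g ν φ (hU₁ hz).1
          ((conjRep g (πY y)).vectorState_isOn η hη) hφ
        refine ⟨s, Finset.mem_insert_of_mem (Finset.mem_filter.2 ⟨Finset.mem_insert_of_mem hs,
          h, hhs⟩), ?_⟩
        rw [isoPt_eq (hWb s) hhs]
        exact hle
    have hc𝓣 : c ∈ 𝓣 :=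
      Finset.mem_biUnion.2 ⟨E', Finset.mem_powerset.2 (Finset.filter_subset _ _), hc⟩
    have hcm : ∀ s ∈ c.support, ∃ h : End z, isoArr h ∈ W s := by
      intro s hs
      rcases Finset.mem_insert.1 ((hT E' c hc).1 hs) with rfl | hs
      · exact ⟨1, hone z hz⟩
      · exact (Finset.mem_filter.1 hs).2
    refine ⟨c, hc𝓣, isIsotropicAt_herm_bumpSum hWb hq hcm, ?_⟩
    rw [fiberOp_herm, re_inner_herm, hηζ, fiberOp_bumpSum hWb hq hcm g (πY y) fun s hs =>
      hqone z hz s ((h𝓣 c hc𝓣).1 hs) (hcm s hs)]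
    refine le_mul_of_one_le_right (by positivity) (hle.trans_eq ?_)
    rw [Finsupp.sum, Finsupp.sum, sum_apply, inner_sum]
    refine congrArg Complex.re (Finset.sum_congr rfl fun s _ => ?_)
    rw [smul_apply, inner_smul_right]
    refine congrArg _ ?_
    change (ν.1 _ : ℂ) = _
    rw [URep.vectorState_apply, URep.toCStar_gElt]
  -- the powers of the functions do not decrease the part over `U₁`
  have hmain : ∀ n (ζ : H), ‖ζ‖ ^ 2 ≤ ∑ c ∈ 𝓣, ‖((π.res Δ).toCStar (herm (groupSum c)) ^ (n + 1)) ζ‖ ^ 2 := by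
    intro n ζ
    let b : (Δ →₀ ℂ) → GpdCStar X := fun c =>
      (PreCStarAlg.toCompl (a c) * ·)^[n] (PreCStarAlg.toCompl (a c))
    have h1 := norm_sq_le_sum_of_ker_le hπ 𝓣 b (PreCStarAlg.toCompl q₀)
      (norm_sq_le_sum_dirSum _ 𝓣 b _ fun y ξ => by
        simp only [b, map_iterate_mul, isoIndRep_toCompl]
        exact norm_sq_op_le_sum (πY y) 𝓣 a (fun c => star_herm _) (hYT y) q₀
          (fun z hz => ⟨(hiso z hz).1, (hiso z hz).2 y⟩) (fun h hh => (hq₀ hh).2.2) (n + 1) ξ)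
      (IndSpace.point (SrcFib.one x) ζ)
    rw [isoIndRep_toCompl, IndSpace.op_point_one q₀ (hWb 1) hq₀W1 (SrcFib.one x) (hV₀ _ hgV₀),
      IndSpace.norm_point] at h1
    refine h1.trans_eq (Finset.sum_congr rfl fun c hc => ?_)
    have hcm : ∀ s ∈ c.support, ∃ h : End x, isoArr h ∈ W s := fun s _ => ⟨s, hWg s⟩
    have h2 : fiberOp (𝟙 x) π (a c) = (π.res Δ).toCStar (herm (groupSum c)) := by
      rw [fiberOp_herm, herm_map, URep.toCStar_groupSum, fiberOp_bumpSum hWb hq hcm (𝟙 x) π fun s hs =>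
        hqone x hxU₁ s ((h𝓣 c hc).1 hs) (hcm s hs), URep.sum, Finsupp.linearCombination_apply,
        conjRep_one]
      simp only [isoPt_self hWb hWg]
      rfl
    simp only [b, map_iterate_mul, isoIndRep_toCompl]
    change ‖(IndSpace.op (a c) ^ (n + 1)) (IndSpace.point ⟨x, 𝟙 x⟩ ζ)‖ ^ 2 = _
    rw [(isIsotropicAt_herm_bumpSum hWb hq hcm).op_pow_point (𝟙 x) (star_herm _), IndSpace.norm_point,
      h2]
  obtain ⟨η, hη⟩ := exists_norm_eq L zero_le_one
  obtain ⟨n, hn⟩ := exists_pow_lt_of_lt_one (y := r₀) (x := ((𝓣.card : ℝ) + 1)⁻¹) (by positivity) hr₀1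
  have h1 := norm_sq_le_sum_of_ker_le hρ 𝓣
    (fun c => (herm (groupSum c) * ·)^[n] (herm (groupSum c))) (gElt 1) (fun ζ => by
      simp only [map_iterate_mul, URep.toCStar_one]
      exact hmain n ζ) η
  simp only [map_iterate_mul, URep.toCStar_one] at h1
  rw [one_apply_eq_self, hη, one_pow] at h1
  have h2 : ∀ c ∈ 𝓣, ‖(ρ.toCStar (herm (groupSum c)) ^ (n + 1)) η‖ ^ 2 ≤ r₀ ^ n := by
    intro c hc
    have h3 : ‖ρ.toCStar (herm (groupSum c))‖ ≤ r₀ := by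
      rw [herm_map]
      exact norm_herm_le ρ hr₀0 (h𝓣 c hc).2
    have h4 : ‖(ρ.toCStar (herm (groupSum c)) ^ (n + 1)) η‖ ≤ r₀ ^ (n + 1) := by
      refine (ContinuousLinearMap.le_opNorm _ _).trans ?_
      rw [hη, mul_one]
      exact (norm_pow_le' _ n.succ_pos).trans (pow_le_pow_left₀ (norm_nonneg _) h3 _)
    calc _ ≤ (r₀ ^ (n + 1)) ^ 2 := by gcongr
      _ = r₀ ^ ((n + 1) * 2) := (pow_mul _ _ _).symm
      _ ≤ r₀ ^ n := pow_le_pow_of_le_one hr₀0 hr₀1.le (by omega)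
  have h3 := h1.trans (Finset.sum_le_sum h2)
  rw [Finset.sum_const, nsmul_eq_mul] at h3
  have h4 : (𝓣.card : ℝ) * r₀ ^ n ≤ 𝓣.card * ((𝓣.card : ℝ) + 1)⁻¹ := by gcongr
  have h5 : (𝓣.card : ℝ) * ((𝓣.card : ℝ) + 1)⁻¹ < 1 := by
    rw [← div_eq_mul_inv, div_lt_one (by positivity)]
    linarith
  linarith

/-- A weak containment of induced representations yields approximations by states. -/
theorem hasStateApproximation_of_weaklyContained (hWo : ∀ g, IsOpen (W g))
    (hWb : ∀ g, Arr.IsBisection (W g)) (hWg : ∀ g, isoArr g ∈ W g)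
    (hπ : WeaklyContained (isoIndRep π) (dirSum fun y : Y => isoIndRep (πY y))) [Nontrivial L]
    (hρ : WeaklyContained ρ.toCStar (π.res Δ).toCStar) : HasStateApproximation W πY Δ ρ := by
  let J := NetIndex (𝓝 x) × Finset Δ × ℕ
  let F : Filter J := atTop ×ˢ (atTop ×ˢ atTop)
  have hex := fun j : J => exists_close_states hWo hWb hWg hπ hρ j.1.2.1 j.2.1
    (ε := 1 / ((j.2.2 : ℝ) + 1)) (by positivity)
  choose y z g ν φ hzU hν hφ hclose using hex
  have hz : Tendsto z F (𝓝 x) := by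
    intro A hA
    have h1 : ∀ᶠ p : NetIndex (𝓝 x) in atTop, p.1.1 ⊆ A :=
      mem_atTop_sets.2 ⟨⟨(A, x), hA, mem_of_mem_nhds hA⟩, fun p hp => hp⟩
    exact (tendsto_fst.eventually h1).mono fun j hj => hj (hzU j)
  let 𝒰 : Ultrafilter J := Ultrafilter.of F
  have h𝒰 : (𝒰 : Filter J) ≤ F := Ultrafilter.of_le F
  obtain ⟨f, ⟨φ₀, hφ₀, rfl⟩, hf⟩ := (isCompact_stateSet ρ.ker).ultrafilter_le_nhds
    (𝒰.map fun j => ((φ j).1 : GroupCStar Δ → ℂ)) (by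
      rw [le_principal_iff]
      exact mem_map.2 (univ_mem' fun j => ⟨φ j, hφ j, rfl⟩))
  refine hasStateApproximation_of_filter hWb (𝒰 : Filter J) y z g ν hν (hz.mono_left h𝒰) φ₀ hφ₀
    fun ε hε s => ?_
  have h1 : Tendsto (fun j => (φ j).evalAt s) 𝒰 (𝓝 (φ₀.evalAt s)) :=
    ((continuous_apply (gElt s)).tendsto _).comp hf
  have h2 : ∀ᶠ j in F, s ∈ j.2.1 := by
    refine (tendsto_fst.comp tendsto_snd).eventually
      (p := fun E : Finset Δ => s ∈ E) ?_
    exact mem_atTop_sets.2 ⟨{s}, fun E hE => hE (Finset.mem_singleton_self s)⟩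
  have h3 : ∀ᶠ j in F, 1 / ((j.2.2 : ℝ) + 1) < ε / 2 :=
    (tendsto_snd.comp tendsto_snd).eventually (p := fun n : ℕ => 1 / ((n : ℝ) + 1) < ε / 2)
      (tendsto_one_div_add_atTop_nhds_zero_nat.eventually (gt_mem_nhds (half_pos hε)))
  filter_upwards [h𝒰 h2, h𝒰 h3, Metric.tendsto_nhds.1 h1 (ε / 2) (half_pos hε)] with j h4 h5 h6 h hh
  have h7 := hclose j s h4 h hh
  rw [dist_comm, dist_eq_norm] at h6
  calc ‖φ₀.evalAt s - (ν j).evalAt h‖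
      ≤ ‖φ₀.evalAt s - (φ j).evalAt s‖ + ‖(φ j).evalAt s - (ν j).evalAt h‖ :=
        norm_sub_le_norm_sub_add_norm_sub _ _ _
    _ < ε := by linarith

end approximation

/-! ### State limits and weak containment over the isotropy group -/

section equivalence

lemma URep.sum_mapDomain {Γ : Type v} [Group Γ] {S : Subgroup Γ} {H : Type v} [NormedAddCommGroup H]
    [InnerProductSpace ℂ H] [CompleteSpace H] (π : URep Γ H) (c : S →₀ ℂ) :
    π.sum (c.mapDomain ((↑) : S → Γ)) = (π.res S).sum c := by
  rw [URep.sum, Finsupp.linearCombination_mapDomain]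
  rfl

lemma URep.norm_toCStar_le_of_norm_sum_le {Γ : Type v} [Group Γ] {H K : Type v}
    [NormedAddCommGroup H] [InnerProductSpace ℂ H] [CompleteSpace H] [NormedAddCommGroup K]
    [InnerProductSpace ℂ K] [CompleteSpace K] {π : URep Γ H} {σ : URep Γ K}
    (h : ∀ c, ‖π.sum c‖ ≤ ‖σ.sum c‖) (a : GroupCStar Γ) : ‖π.toCStar a‖ ≤ ‖σ.toCStar a‖ := by
  refine groupCStar_induction (p := fun a => ‖π.toCStar a‖ ≤ ‖σ.toCStar a‖) a
    (isClosed_le π.continuous_toCStar.norm σ.continuous_toCStar.norm) fun c => ?_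
  rw [URep.toCStar_groupSum, URep.toCStar_groupSum]
  exact h c

/-- A state on `S` whose values agree with those of a state on `π|_Δ`, for some `Δ ⊇ S`, is a state
on `π|_S`. -/
lemma State.isOn_of_evalAt_eq {Γ : Type v} [Group Γ] {H : Type v} [NormedAddCommGroup H]
    [InnerProductSpace ℂ H] [CompleteSpace H] {π : URep Γ H} {S Δ : Subgroup Γ} (hSΔ : S ≤ Δ)
    {ω : State S} {φ : State Δ} (hφ : φ.IsOn (π.res Δ))
    (h : ∀ s : S, ω.evalAt s = φ.evalAt ⟨s, hSΔ s.2⟩) : ω.IsOn (π.res S) := by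
  have key : ∀ a, ‖ω.1 a‖ ≤ ‖(π.res S).toCStar a‖ := by
    intro a
    refine groupCStar_induction (p := fun a => ‖ω.1 a‖ ≤ ‖(π.res S).toCStar a‖) a
      (isClosed_le ω.1.continuous.norm (π.res S).continuous_toCStar.norm) fun c => ?_
    let i : S → Δ := fun s => ⟨s, hSΔ s.2⟩
    have h1 : ω.1 (groupSum c) = φ.1 (groupSum (c.mapDomain i)) := by
      rw [groupSum, groupSum, Finsupp.linearCombination_mapDomain, Finsupp.linearCombination_apply,
        Finsupp.linearCombination_apply, map_finsuppSum, map_finsuppSum]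
      refine Finsupp.sum_congr fun s _ => ?_
      rw [map_smul, map_smul]
      exact congrArg _ (h s)
    have h2 : (π.res Δ).sum (c.mapDomain i) = (π.res S).sum c := by
      rw [URep.sum, Finsupp.linearCombination_mapDomain]
      rfl
    rw [h1, URep.toCStar_groupSum, ← h2, ← URep.toCStar_groupSum]
    exact State.norm_apply_le_of_isOn hφ _
  intro a ha
  have := key a
  rw [(URep.mem_ker _ _).1 ha, norm_zero, norm_le_zero_iff] at this
  exact this

lemma State.mul_conj_nonneg {Γ : Type v} [Group Γ] {S : Subgroup Γ} (ω : State S) (g : Γ) (w : ℂ)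
    (h : ∀ hg : g ∈ S, ω.evalAt ⟨g, hg⟩ = w) :
    0 ≤ ⟪ω.indVec, (ω.ind g : ω.IndGNS →L[ℂ] ω.IndGNS) ω.indVec⟫_ℂ * starRingEnd ℂ w := by
  by_cases hg : g ∈ S
  · rw [ω.inner_indVec_of_mem ⟨g, hg⟩, h hg, Complex.mul_conj]
    exact_mod_cast Complex.normSq_nonneg w
  · rw [ω.inner_indVec_of_notMem hg, zero_mul]

lemma groupCStar_dirSum_one {Γ : Type v} [Group Γ] {J : Type*} {H : J → Type*}
    [∀ j, NormedAddCommGroup (H j)] [∀ j, InnerProductSpace ℂ (H j)] [∀ j, CompleteSpace (H j)]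
    (σ : ∀ j, GroupCStar Γ →⋆ₙₐ[ℂ] (H j →L[ℂ] H j)) (h : ∀ j, σ j (gElt 1) = 1) :
    dirSum σ (gElt 1) = 1 := by
  ext ξ j
  rw [dirSum_apply, h]
  rfl

/-- The matrix coefficients of a summand are matrix coefficients of the direct sum. -/
lemma exists_unit_dirSum {A : Type*} [NonUnitalCStarAlgebra A] {J : Type*} {H : J → Type*}
    [∀ j, NormedAddCommGroup (H j)] [∀ j, InnerProductSpace ℂ (H j)] [∀ j, CompleteSpace (H j)]
    (σ : ∀ j, A →⋆ₙₐ[ℂ] (H j →L[ℂ] H j)) (j : J) {e : H j} (he : ‖e‖ = 1) :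
    ∃ e' : lp H 2, ‖e'‖ = 1 ∧ ∀ a, ⟪e', dirSum σ a e'⟫_ℂ = ⟪e, σ j a e⟫_ℂ := by
  classical
  refine ⟨lp.single 2 j e, by rw [lp.norm_single (by norm_num), he], fun a => ?_⟩
  rw [dirSum_single, lp.inner_single_left, lp.single_apply_self]

/-- Weak containment can be checked on the restrictions to subgroups which contain every finite subset. -/
lemma weaklyContained_of_forall_subgroup {Γ : Type v} [Group Γ] {H K : Type v} [NormedAddCommGroup H]
    [InnerProductSpace ℂ H] [CompleteSpace H] [NormedAddCommGroup K] [InnerProductSpace ℂ K]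
    [CompleteSpace K] {π : URep Γ H} {τ : GroupCStar Γ →⋆ₙₐ[ℂ] (K →L[ℂ] K)} (h1 : τ (gElt 1) = 1)
    {J : Type*} (Δ : J → Subgroup Γ) (hΔ : ∀ F : Finset Γ, ∃ k, (F : Set Γ) ⊆ Δ k)
    (h : ∀ k, ((urepOf τ h1).res (Δ k)).ker ≤ (π.res (Δ k)).ker) :
    WeaklyContained π.toCStar τ := by
  classical
  refine weaklyContained_of_forall fun a ha => ?_
  have h2 := URep.norm_toCStar_le_of_norm_sum_le (π := π) (σ := urepOf τ h1) (fun c => ?_) a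
  · rw [toCStar_urepOf, ha, norm_zero, norm_le_zero_iff] at h2
    exact h2
  · obtain ⟨k, hk⟩ := hΔ c.support
    have h2 : (c.subtypeDomain (· ∈ Δ k)).mapDomain ((↑) : Δ k → Γ) = c := by
      ext g
      by_cases hg : g ∈ Δ k
      · exact (Finsupp.mapDomain_apply Subtype.val_injective _ (⟨g, hg⟩ : Δ k)).trans
          Finsupp.subtypeDomain_apply
      · rw [Finsupp.mapDomain_of_notMem_range _ _ (by simpa using hg)]
        exact (Finsupp.notMem_support_iff.1 fun h' => hg (hk h')).symm
    rw [← h2, URep.sum_mapDomain, URep.sum_mapDomain, ← URep.toCStar_groupSum,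
      ← URep.toCStar_groupSum]
    exact norm_apply_le_of_ker_le _ _ (fun b hb => (URep.mem_ker _ _).1
      (h k ((URep.mem_ker _ _).2 hb))) _

variable {X : Type u} [Groupoid.{u} X] [TopologicalSpace X] [TopologicalSpace (Arr X)]
  [EtaleGroupoid X] [T2Space (Arr X)] [LocallyCompactSpace (Arr X)] {x : X}
  {W : End x → Set (Arr X)} {Y : Set X} {HY : Y → Type u} [∀ y, NormedAddCommGroup (HY y)]
  [∀ y, InnerProductSpace ℂ (HY y)] [∀ y, CompleteSpace (HY y)]
  {πY : ∀ y : Y, URep (End (y : X)) (HY y)} {H : Type u} [NormedAddCommGroup H]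
  [InnerProductSpace ℂ H] [CompleteSpace H] {π : URep (End x) H}

/-- If the irreducible representations of the subgroups `Γ k` which correspond to the maximal ideals
containing `ker π|_{Γ k}` have approximations by states, then `π` is weakly contained in the sum of the
representations induced from the state limits. -/
theorem weaklyContained_dirSum_stateLimits (hx : IsAmenable (End x)) (hWo : ∀ g, IsOpen (W g))
    (hWb : ∀ g, Arr.IsBisection (W g)) (hWg : ∀ g, isoArr g ∈ W g)
    {K : Type v} (Γ : K → Subgroup (End x))
    (hΓ : ∀ F : Finset (End x), ∃ k, (F : Set (End x)) ⊆ Γ k)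
    (hker : ∀ k, IsIntersectionOfMaximalIdeals (π.res (Γ k)).ker)
    (h : ∀ (k : K) (L : Type u) [NormedAddCommGroup L] [InnerProductSpace ℂ L] [CompleteSpace L]
      (ρ : URep (Γ k) L), ρ.IsIrreducible →
      WeaklyContained ρ.toCStar (π.res (Γ k)).toCStar → IsMaximalIdeal ρ.ker →
      HasStateApproximation W πY (Γ k) ρ) :
    WeaklyContained π.toCStar
      (dirSum fun p : {p : Σ S : Subgroup (End x), State S // IsStateLimit W πY p.1 p.2} =>
        groupIndRep p.1.1 p.1.2.gns) := by
  refine weaklyContained_of_forall_subgroup (groupCStar_dirSum_one _ fun p => groupIndRep_gElt_one _) Γ hΓ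
    fun k => ?_
  obtain ⟨𝓜, h𝓜, hI⟩ := hker k
  rw [hI]
  refine le_sInf fun M hM => ?_
  obtain ⟨φ₀, hirr, hφ₀⟩ := (h𝓜 M hM).exists_irreducible
  have hmax : IsMaximalIdeal φ₀.gns.ker := hφ₀ ▸ h𝓜 M hM
  have hwc : (π.res (Γ k)).ker ≤ φ₀.gns.ker := by
    rw [hI, hφ₀]
    exact sInf_le hM
  obtain ⟨φ, hφ, S, ω, hω, hagree⟩ :=
    (h k _ φ₀.gns hirr hwc hmax).exists_isStateLimit hWo hWb hWg
  rw [← hφ₀]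
  obtain ⟨e, he, heg⟩ := exists_unit_dirSum (fun p : {p : Σ S : Subgroup (End x), State S //
    IsStateLimit W πY p.1 p.2} => groupIndRep p.1.1 p.1.2.gns) ⟨⟨S, ω⟩, hω⟩ ω.norm_indVec
  refine (hx.subgroup (Γ k)).ker_le_of_isMaximalIdeal hmax hφ _ he fun g => ?_
  have h1 : ⟪e, ((urepOf _ (groupCStar_dirSum_one (fun p : {p : Σ S : Subgroup (End x), State S //
      IsStateLimit W πY p.1 p.2} => groupIndRep p.1.1 p.1.2.gns) fun p => groupIndRep_gElt_one _)).res
      (Γ k) g : _ →L[ℂ] _) e⟫_ℂ = ⟪ω.indVec, (ω.ind (g : End x) : ω.IndGNS →L[ℂ] ω.IndGNS) ω.indVec⟫_ℂ :=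
    heg (gElt (g : End x))
  rw [h1]
  exact ω.mul_conj_nonneg _ _ fun hg => hagree g hg g.2

/-- If `ker π` is maximal, then a single state limit on a restriction of `π` suffices for the weak
containment of `π`. -/
theorem weaklyContained_dirSum_of_isMaximalIdeal (hx : IsAmenable (End x))
    (hπ : IsMaximalIdeal π.ker) {S : Subgroup (End x)} {ω : State S} (hω : ω.IsOn (π.res S))
    (hlim : IsStateLimit W πY S ω) :
    WeaklyContained π.toCStar
      (dirSum fun p : {p : Σ S : Subgroup (End x), State S // IsStateLimit W πY p.1 p.2} =>
        groupIndRep p.1.1 p.1.2.gns) := by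
  obtain ⟨φ, hφ, hφω⟩ := State.exists_extension π hω
  have hle : ω.ind.ker ≤ π.ker := hx.ker_le_of_isMaximalIdeal hπ hφ ω.ind ω.norm_indVec
    fun g => ω.mul_conj_nonneg g _ fun hg => (hφω ⟨g, hg⟩).symm
  refine weaklyContained_of_forall fun a ha => (URep.mem_ker _ _).1 (hle ((URep.mem_ker _ _).2 ?_))
  rw [State.toCStar_ind]
  exact (dirSum_eq_zero_iff _ _).1 ha ⟨⟨S, ω⟩, hlim⟩

/-- If `ker π` is maximal, then the weak containment of induced representations provides a state limit
on a restriction of `π`. -/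
theorem exists_isStateLimit_isOn (hWo : ∀ g, IsOpen (W g)) (hWb : ∀ g, Arr.IsBisection (W g))
    (hWg : ∀ g, isoArr g ∈ W g) (hπ : IsMaximalIdeal π.ker)
    (h : WeaklyContained (isoIndRep π) (dirSum fun y : Y => isoIndRep (πY y))) :
    ∃ (S : Subgroup (End x)) (ω : State S), ω.IsOn (π.res S) ∧ IsStateLimit W πY S ω := by
  have : Nontrivial H := by
    by_contra hH
    rw [not_nontrivial_iff_subsingleton] at hH
    refine hπ.2.1 (top_le_iff.1 fun a _ => (URep.mem_ker _ _).2 ?_)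
    ext ξ
    exact Subsingleton.elim _ _
  obtain ⟨φ, hφ, S, ω, hω, hagree⟩ := (hasStateApproximation_of_weaklyContained (Δ := ⊤)
    (ρ := π.res ⊤) hWo hWb hWg h le_rfl).exists_isStateLimit hWo hWb hWg
  exact ⟨S, ω, State.isOn_of_evalAt_eq le_top hφ fun s => hagree s s.2 (Subgroup.mem_top _), hω⟩

end equivalence

theorem theorem2p2
    {X : Type u} [Groupoid.{u} X] [TopologicalSpace X] [TopologicalSpace (Arr X)]
    [EtaleGroupoid X] [T2Space (Arr X)] [LocallyCompactSpace (Arr X)]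
    (x : X) (hx : IsAmenable (End x))
    (W : End x → Set (Arr X)) (hWo : ∀ g, IsOpen (W g)) (hWb : ∀ g, Arr.IsBisection (W g))
    (hWg : ∀ g, isoArr g ∈ W g)
    {H : Type u} [NormedAddCommGroup H] [InnerProductSpace ℂ H] [CompleteSpace H]
    (π : URep (End x) H)
    (Y : Set X) {HY : Y → Type u} [∀ y, NormedAddCommGroup (HY y)]
    [∀ y, InnerProductSpace ℂ (HY y)] [∀ y, CompleteSpace (HY y)]
    (πY : ∀ y : Y, URep (End (y : X)) (HY y))
    {K : Type v} (Γ : K → Subgroup (End x))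
    (hΓ : ∀ F : Finset (End x), ∃ k, (F : Set (End x)) ⊆ Γ k)
    (hker : ∀ k, IsIntersectionOfMaximalIdeals (π.res (Γ k)).ker) :
    List.TFAE
      [WeaklyContained (isoIndRep π) (dirSum fun y : Y => isoIndRep (πY y)),
        ∀ (k : K) (L : Type u) [NormedAddCommGroup L] [InnerProductSpace ℂ L] [CompleteSpace L]
          (ρ : URep (Γ k) L), ρ.IsIrreducible →
          WeaklyContained ρ.toCStar (π.res (Γ k)).toCStar → IsMaximalIdeal ρ.ker →
          HasStateApproximation W πY (Γ k) ρ,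
        WeaklyContained π.toCStar
          (dirSum fun p : {p : Σ S : Subgroup (End x), State S // IsStateLimit W πY p.1 p.2} =>
            groupIndRep p.1.1 p.1.2.gns)] ∧
    (IsMaximalIdeal π.ker →
      (WeaklyContained (isoIndRep π) (dirSum fun y : Y => isoIndRep (πY y)) ↔
        ∃ (S : Subgroup (End x)) (ω : State S), ω.IsOn (π.res S) ∧ IsStateLimit W πY S ω)) := by
  have h31 := weaklyContained_isoIndRep (πY := πY) hWo hWb hWg π
  refine ⟨?_, fun hmax => ⟨exists_isStateLimit_isOn hWo hWb hWg hmax, fun ⟨S, ω, hω, hlim⟩ =>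
    h31 (weaklyContained_dirSum_of_isMaximalIdeal hx hmax hω hlim)⟩⟩
  tfae_have 1 → 2 := by
    intro h k L _ _ _ ρ hirr hρ _
    have := hirr.1
    exact hasStateApproximation_of_weaklyContained hWo hWb hWg h hρ
  tfae_have 2 → 3 := weaklyContained_dirSum_stateLimits hx hWo hWb hWg Γ hΓ hker
  tfae_have 3 → 1 := h31
  tfae_finish

end
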